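/- **Notation.** Let $\mathbb{R}^2_+=\{x\in\mathbb{R}^2: x_2>0\}$, $y^*=(y_1,-y_2)$, $E(x)=-\frac1{2\pi}\log|x|$, $D(x,y)=E(x-y)-E(x-y^*)$, and for $t>0$ $$\Gamma(x,t)=\frac{1}{4\pi t}e^{-|x|^2/4t},\qquad \Gamma_0(r,t)=\frac{1}{(4\pi t)^{1/2}}e^{-r^2/4t},\qquad P_s(r)=\frac{s}{\pi(r^2+s^2)}\quad(P_0=0).$$ Let $G_{ij}(x,z,t)=\Gamma(x-z,t)\delta_{ij}+G^*_{ij}(x,z,t)$ be the Green matrix of the Stokes semigroup in the half plane, where $$G^*_{ij}(x,z,t)=-\Gamma(x-z^*,t)\delta_{ij}-4(1-\delta_{j2})\,\partial_{x_j}\int_0^{x_2}\!\!\int_{\mathbb{R}}\partial_{x_i}E(x-w)\,\Gamma(w-z^*,t)\,dw_1\,dw_2 .$$ Set (all double integrals over strips being iterated integrals, first over the real line) $$\tilde W(x,y,t)=4\int_0^{y_2}\!\!\int_{\mathbb{R}}\Gamma(x-z^*,t)\,\partial_{z_1}^2E(z-y)\,dz_1\,dz_2,\qquad W^*(x,y,t)=\Gamma(x-y^*,t)+\tilde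 W(x,y,t),$$ $$W_{\mathrm{tr}}(x,y,t)=-2\Gamma_0(x_2,t)\int_{\mathbb{R}}\Gamma_0(x_1-z_1,t)P_{y_2}(z_1-y_1)\,dz_1,\qquad W(x,y,t)=\Gamma(x-y,t)+W^*(x,y,t)+W_{\mathrm{tr}}(x,y,t).$$ Let $M$ be the space of finite signed Borel measures on $\overline{\mathbb{R}^2_+}$, let $(-\Delta_D)^{-1}\omega_0(x)=\int D(x,y)\,\omega_0(dy)$, and let $e^{t\Delta_N}$, $e^{t\Delta_D}$ be the operators with kernels $\Gamma(x-y,t)\pm\Gamma(x-y^*,t)$ (sign $+$ for $N$, $-$ for $D$). Let $H$ be the Hilbert transform in the first variable, $\widehat{H\varphi}(\xi_1)=-i\,\xi_1|\xi_1|^{-1}\hat\varphi(\xi_1)$. For $\psi=(-\Delta_D)^{-1}\omega_0$ the distribution $(H\partial_2-\partial_1)\partial_1\psi$ is $\partial_1v$ with $v=H\partial_2\psi-\partial_1\psi$ (weak derivatives in $\mathbb{R}^2_+$), and its pairing with a heat kernel $\varphi$ is $-\int_{\mathbb{R}^2_+}v\,\partial_1\varphi\,dz$. **Lemma 3.4.**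 The integrals and the derivative defining $\tilde W(x,y,t)$ and $G^*_{11}(y,x,t)$ exist for all $x,y\in\overline{\mathbb{R}^2_+}$, $t>0$, and: (i) For all $x,y\in\overline{\mathbb{R}^2_+}$, $t>0$ and $\lambda>0$, $$W(x,y,t)=\lambda^2W(\lambda x,\lambda y,\lambda^2t),\qquad W^*(x,y,t)=-G^*_{11}(y,x,t).$$ The function $W^*$ is smooth on $\mathbb{R}^2_+\times\mathbb{R}^2_+\times(0,\infty)$, and there is a constant $c>0$ such that for all integers $s\ge0$ and multi-indices $k=(k_1,k_2)$, $m=(m_1,m_2)$ there is a constant $C$ with $$|\partial_t^s\partial_x^k\partial_y^mW^*(x,y,t)|\le\frac{C\,e^{-cx_2^2/t}}{t^{s+k_2/2}\,(y_2^2+t)^{m_2/2}\,(|x-y^*|^2+t)^{(k_1+m_1+2)/2}}\qquad (x,y\in\mathbb{R}^2_+,\ t>0).$$ (ii) For every $\omega_0\in M$, the integral defining $(-\Delta_D)^{-1}\omega_0$ converges absolutely a.e. in $\mathbb{R}^2_+$, the function $v$ above exists (for a.e. $x_2>0$, $\partial_2\psi(\cdot,x_2)\in L^1(\mathbb{R})$,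 and $H\partial_2\psi$ is a locally integrable function), and for all $t>0$ and $x\in\overline{\mathbb{R}^2_+}$, all integrals converging absolutely, $$-\big(e^{t\Delta_N}-e^{t\Delta_D}\big)(H\partial_2-\partial_1)\partial_1(-\Delta_D)^{-1}\omega_0\,(x)=\int_{\overline{\mathbb{R}^2_+}}\tilde W(x,y,t)\,\omega_0(dy).$$ -/

import Mathlib

open MeasureTheory Set
open scoped FourierTransform ContDiff SchwartzMap

noncomputable section

namespace StokesHalfPlane

/-- The open half plane `{x₂ > 0}`. Points of the plane are pairs of reals; Lebesgue measure is the
product measure, and the Euclidean length is written out through `normSq`. -/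
def halfPlane : Set (ℝ × ℝ) := {x | 0 < x.2}

/-- The closed half plane `{x₂ ≥ 0}`. -/
def closedHalfPlane : Set (ℝ × ℝ) := {x | 0 ≤ x.2}

/-- The reflection `x* = (x₁, -x₂)`. -/
def reflect (x : ℝ × ℝ) : ℝ × ℝ := (x.1, -x.2)

/-- The squared Euclidean length `|x|² = x₁² + x₂²`. -/
def normSq (x : ℝ × ℝ) : ℝ := x.1 ^ 2 + x.2 ^ 2

/-- The partial derivative `∂₁ f` (for `i = 0`) or `∂₂ f` (for `i = 1`). -/
def partialDeriv (i : Fin 2) (f : ℝ × ℝ → ℝ) (x : ℝ × ℝ) : ℝ :=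
  if i = 0 then deriv (fun r => f (r, x.2)) x.1 else deriv (fun r => f (x.1, r)) x.2

/-- The one-dimensional heat kernel `Γ₀(r,t) = (4πt)^{-1/2} e^{-r²/4t}`. -/
def heatKernel1 (r t : ℝ) : ℝ := 1 / Real.sqrt (4 * Real.pi * t) * Real.exp (-r ^ 2 / (4 * t))

/-- The two-dimensional heat kernel `Γ(x,t) = (4πt)^{-1} e^{-|x|²/4t}`. -/
def heatKernel (x : ℝ × ℝ) (t : ℝ) : ℝ :=
  1 / (4 * Real.pi * t) * Real.exp (-normSq x / (4 * t))

/-- The fundamental solution `E(x) = -(2π)⁻¹ log |x|` of `-Δ` in the plane. -/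
def newton (x : ℝ × ℝ) : ℝ := -(1 / (2 * Real.pi)) * Real.log (Real.sqrt (normSq x))

/-- The Dirichlet Green function `D(x,y) = E(x-y) - E(x-y*)` of the half plane. -/
def greenD (x y : ℝ × ℝ) : ℝ := newton (x - y) - newton (x - reflect y)

/-- The Poisson kernel `P_s(r) = s / (π (r² + s²))`. -/
def poisson (s r : ℝ) : ℝ := s / (Real.pi * (r ^ 2 + s ^ 2))

/-! ### The Green matrix of the Stokes semigroup -/

/-- `∂_{x_i}E(x-w) Γ(w-z*,t)` at `w = (w₁, w₂)`; the second coordinate comes first. -/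
def greenIntegrand (i : Fin 2) (x z : ℝ × ℝ) (t w2 w1 : ℝ) : ℝ :=
  partialDeriv i newton (x - (w1, w2)) * heatKernel ((w1, w2) - reflect z) t

/-- `∫₀^{x₂} ∫_ℝ ∂_{x_i}E(x-w) Γ(w-z*,t) dw₁ dw₂`. -/
def greenPotential (i : Fin 2) (x z : ℝ × ℝ) (t : ℝ) : ℝ :=
  ∫ w2 in (0 : ℝ)..x.2, ∫ w1 : ℝ, greenIntegrand i x z t w2 w1

/-- `G*_{ij}(x,z,t) = -Γ(x-z*,t) δ_{ij}
  - 4 (1-δ_{j2}) ∂_{x_j} ∫₀^{x₂} ∫_ℝ ∂_{x_i}E(x-w) Γ(w-z*,t) dw`.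
Indices start at `0`, so the entry `11` of the text is the entry `0 0` here. -/
def greenStar (i j : Fin 2) (x z : ℝ × ℝ) (t : ℝ) : ℝ :=
  -(heatKernel (x - reflect z) t * if i = j then 1 else 0)
    - 4 * (1 - if j = 1 then 1 else 0) * partialDeriv j (fun x' => greenPotential i x' z t) x

/-- The Green matrix `G_{ij}(x,z,t) = Γ(x-z,t) δ_{ij} + G*_{ij}(x,z,t)`. -/
def greenMatrix (i j : Fin 2) (x z : ℝ × ℝ) (t : ℝ) : ℝ :=
  heatKernel (x - z) t * (if i = j then 1 else 0) + greenStar i j x z t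

/-! ### The vorticity kernels -/

/-- `Γ(x-z*,t) ∂_{z₁}²E(z-y)` at `z = (z₁, z₂)`; the second coordinate comes first. -/
def wTildeIntegrand (x y : ℝ × ℝ) (t z2 z1 : ℝ) : ℝ :=
  heatKernel (x - reflect (z1, z2)) t *
    partialDeriv 0 (partialDeriv 0 newton) ((z1, z2) - y)

/-- `W̃(x,y,t) = 4 ∫₀^{y₂} ∫_ℝ Γ(x-z*,t) ∂_{z₁}²E(z-y) dz₁ dz₂`, an iterated integral: the integrand
is not absolutely integrable over the strip, because of its singularity of order two at the boundary
point `z = y`. -/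
def wTilde (x y : ℝ × ℝ) (t : ℝ) : ℝ :=
  4 * ∫ z2 in (0 : ℝ)..y.2, ∫ z1 : ℝ, wTildeIntegrand x y t z2 z1

/-- `W*(x,y,t) = Γ(x-y*,t) + W̃(x,y,t)`. -/
def wStar (x y : ℝ × ℝ) (t : ℝ) : ℝ := heatKernel (x - reflect y) t + wTilde x y t

/-- `W_tr(x,y,t) = -2 Γ₀(x₂,t) ∫_ℝ Γ₀(x₁-z₁,t) P_{y₂}(z₁-y₁) dz₁`. -/
def wTr (x y : ℝ × ℝ) (t : ℝ) : ℝ :=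
  -2 * heatKernel1 x.2 t * ∫ z1 : ℝ, heatKernel1 (x.1 - z1) t * poisson y.2 (z1 - y.1)

/-- `W(x,y,t) = Γ(x-y,t) + W*(x,y,t) + W_tr(x,y,t)`. -/
def wKernel (x y : ℝ × ℝ) (t : ℝ) : ℝ := heatKernel (x - y) t + wStar x y t + wTr x y t

/-- The iterated integral `∫₀^s ∫_ℝ f(b,a) da db` converges absolutely in each of its two steps. -/
def IteratedIntegrable (s : ℝ) (f : ℝ → ℝ → ℝ) : Prop :=
  (∀ b ∈ Ico 0 s, Integrable (f b)) ∧
    IntervalIntegrable (fun b => ∫ a : ℝ, f b a) volume 0 s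

/-- `∂_t^s ∂_{x₁}^{k1} ∂_{x₂}^{k2} ∂_{y₁}^{m1} ∂_{y₂}^{m2} F (x,y,t)`. -/
def mixedDeriv (s k1 k2 m1 m2 : ℕ) (F : ℝ × ℝ → ℝ × ℝ → ℝ → ℝ) (x y : ℝ × ℝ) (t : ℝ) : ℝ :=
  iteratedDeriv s (fun τ =>
    iteratedDeriv k1 (fun a =>
      iteratedDeriv k2 (fun b =>
        iteratedDeriv m1 (fun c =>
          iteratedDeriv m2 (fun d => F (a, b) (c, d) τ) y.2) y.1) x.2) x.1) t

/-! ### The nonlocal operator -/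

/-- `(-Δ_D)⁻¹ ω₀ (x) = ∫ D(x,y) ω₀(dy)`, for a finite signed Borel measure on the closed half plane
(all of which are regular). -/
def invLaplaceD (μ : SignedMeasure closedHalfPlane) (x : ℝ × ℝ) : ℝ :=
  ∫ᵛ y, greenD x (y : ℝ × ℝ) ∂•μ

/-- `g` is the weak partial derivative `∂_i f` in the open half plane. -/
def IsWeakPartial (i : Fin 2) (f g : ℝ × ℝ → ℝ) : Prop :=
  LocallyIntegrableOn f halfPlane ∧ LocallyIntegrableOn g halfPlane ∧
    ∀ φ : ℝ × ℝ → ℝ, ContDiff ℝ ∞ φ → HasCompactSupport φ → tsupport φ ⊆ halfPlane →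
      ∫ z in halfPlane, f z * partialDeriv i φ z = -∫ z in halfPlane, g z * φ z

/-- `h = H f`, where `H` is the Hilbert transform on `ℝ`, for integrable `f`: the function `h` defines
a tempered distribution whose Fourier transform is the bounded function `-i (ξ/|ξ|) f̂(ξ)`, that is,
`(h, θ̂) = (-i (ξ/|ξ|) f̂, θ)` for all Schwartz functions `θ`. (The multiplier is homogeneous of degree
zero, so the normalisation of the Fourier transform does not matter.) -/
def IsHilbertTransform (f h : ℝ → ℝ) : Prop :=
  Integrable f ∧ (∃ N : ℕ, Integrable (fun r => h r / (1 + r ^ 2) ^ N)) ∧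
    ∀ θ : 𝓢(ℝ, ℂ),
      ∫ r : ℝ, (h r : ℂ) * 𝓕 (θ : ℝ → ℂ) r =
        ∫ ξ : ℝ, -Complex.I * ((ξ / |ξ| : ℝ) : ℂ) * 𝓕 (fun r : ℝ => (f r : ℂ)) ξ * θ ξ

/-- `h = H f` in the half plane, where `H` acts in the first variable. -/
def IsTangentialHilbert (f h : ℝ × ℝ → ℝ) : Prop :=
  LocallyIntegrableOn h halfPlane ∧
    ∀ᵐ b : ℝ ∂(volume.restrict (Ioi 0)),
      IsHilbertTransform (fun a => f (a, b)) (fun a => h (a, b))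

/-- `v = H ∂₂ψ - ∂₁ψ` in the half plane, with weak derivatives of `ψ`. -/
def IsHilbertGradient (ψ v : ℝ × ℝ → ℝ) : Prop :=
  ∃ g₁ g₂ h : ℝ × ℝ → ℝ, IsWeakPartial 0 ψ g₁ ∧ IsWeakPartial 1 ψ g₂ ∧
    IsTangentialHilbert g₂ h ∧ ∀ z, v z = h z - g₁ z

/-- The distribution `∂₁ v` in the half plane, `φ ↦ -∫ v ∂₁φ`. As the derivative is tangential to the
boundary, `φ` need not vanish there. -/
def tangentialDeriv (v : ℝ × ℝ → ℝ) (φ : ℝ × ℝ → ℝ) : ℝ :=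
  -∫ z in halfPlane, v z * partialDeriv 0 φ z

/-- The Neumann heat kernel `Γ(x-y,t) + Γ(x-y*,t)` of the half plane. -/
def heatKernelN (t : ℝ) (x y : ℝ × ℝ) : ℝ := heatKernel (x - y) t + heatKernel (x - reflect y) t

/-- The Dirichlet heat kernel `Γ(x-y,t) - Γ(x-y*,t)` of the half plane. -/
def heatKernelD (t : ℝ) (x y : ℝ × ℝ) : ℝ := heatKernel (x - y) t - heatKernel (x - reflect y) t

/-- `e^{tΔ_N} F`, for a distribution `F` in the half plane: `F` is paired with the kernel. If `F` is a
function `f`, acting by `φ ↦ ∫ f φ`, this is the integral of the kernel against `f`. -/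
def heatN (t : ℝ) (F : (ℝ × ℝ → ℝ) → ℝ) (x : ℝ × ℝ) : ℝ := F (heatKernelN t x)

/-- `e^{tΔ_D} F`, for a distribution `F` in the half plane. -/
def heatD (t : ℝ) (F : (ℝ × ℝ → ℝ) → ℝ) (x : ℝ × ℝ) : ℝ := F (heatKernelD t x)

end StokesHalfPlane

end

open StokesHalfPlane

/-! ### The Laplace–Gauss integrals: derivatives, recurrence and decay. -/

section LaplaceGauss

open Filter Topology Complex

/-! Part (i) rests on a Laplace representation in the tangential variable. For `s = y₂ - z₂ > 0`,
`∂₁²E(z-y)` is `-1/(2π)` times the real part of `(s + i(z₁-y₁))⁻² = ∫₀^∞ ξ e^{-(s+i(z₁-y₁))ξ} dξ`.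
Convolution with the heat kernel in `z₁` multiplies this integrand by `e^{-tξ²}` and replaces `z₁`
by `x₁`. So the inner integral of `W̃` is a Gaussian in `x₂ + z₂` times `Re K₁(s + i(x₁-y₁), t)`,
where `K_n(w,t) = ∫₀^∞ ξⁿ e^{-wξ-tξ²} dξ`. As `K_n` is entire in `w`, the singularity at `z = y` has
disappeared, and `W̃` is a one-dimensional integral of a smooth function (`wTilde_eq_stripTerm`).
The potential in `G*₁₁` is the same with `Im K₀`, and `∂_w K₀ = -K₁` gives `W* = -G*₁₁`. Scaling is
a change of variables.

The estimates need two facts. One is `|K_n(w,t)| ≤ C (|w|² + t)^{-(n+1)/2}` up to the line `Re w =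
0`, which follows from scaling and repeated integration by parts (`exists_norm_laplaceGauss_le`).
The other is a class of functions, `KernelTerm`, which contains `W*` (as a real part) and is closed
under the five first derivatives; its indices count the factors gained. Every member obeys the bound
that its indices announce (`KernelTerm.exists_bound`), and smoothness follows since all derivatives
stay in a class of continuous functions.

Part (ii) is an identity of kernels. With `Q` the conjugate Poisson kernel, `∂₂E = -P/2` and `∂₁E =
-Q/2`; moreover `H P_s = Q_s` for `s > 0`, while `P_s` is odd and `Q_s` even in `s`. Hence in `(H∂₂
- ∂₁)D(z,y)` everything cancels for `z₂ > y₂`, as does the image term, and for `z₂ < y₂` there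
remains `Q_{z₂-y₂}(z₁-y₁)` (`gradKernel`). The difference of the two heat kernels is `2Γ(x-z*)`; one
integration by parts on each line `0 < z₂ < y₂`, with `∂₁Q = -2∂₁²E`, yields `W̃`.

To make this rigorous for measures, all kernels involved are dominated by `(2 +
z₂)|z₁-y₁|^{-1/2}|z₂-y₂|^{-1/2}`. The product form gives integrability uniformly in `y`, so Fubini
applies against any finite measure and the Green function, its derivatives and the Hilbert transform
can be handled for one fixed `y`. Weak derivatives and Hilbert transforms are unique almost
everywhere, so the result holds for every admissible `v`. -/

/-- The function `∫₀^∞ ξⁿ e^{-wξ - tξ²} dξ`. -/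
noncomputable def laplaceGauss (n : ℕ) (w : ℂ) (t : ℝ) : ℂ :=
  ∫ ξ in Ioi (0 : ℝ), (ξ : ℂ) ^ n * cexp (-w * ξ - t * ξ ^ 2)

/-- Completing the square absorbs a linear exponent of either sign into half of the Gaussian. This
is the dominating function for all differentiations under the integral, and it is why `w` may range
over the whole complex plane. -/
theorem integrableOn_pow_mul_exp_linear_sub_sq (n : ℕ) (M : ℝ) {t : ℝ} (ht : 0 < t) :
    IntegrableOn (fun ξ : ℝ => ξ ^ n * Real.exp (M * ξ - t * ξ ^ 2)) (Ioi 0) := by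
  have h1 : IntegrableOn (fun ξ : ℝ => Real.exp (M ^ 2 / (2 * t)) *
      (ξ ^ (n : ℝ) * Real.exp (-(t / 2) * ξ ^ 2))) (Ioi 0) :=
    ((integrable_rpow_mul_exp_neg_mul_sq (by positivity : 0 < t / 2)
      (by have : (0 : ℝ) ≤ n := n.cast_nonneg
          linarith)).const_mul _).integrableOn
  refine Integrable.mono' h1 (by fun_prop) ?_
  refine (ae_restrict_iff' measurableSet_Ioi).2 (Eventually.of_forall fun ξ hξ => ?_)
  have hξ0 : (0 : ℝ) < ξ := hξ
  rw [Real.rpow_natCast, Real.norm_of_nonneg (by positivity),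
    mul_left_comm, ← Real.exp_add]
  gcongr
  have : M ^ 2 / (2 * t) + -(t / 2) * ξ ^ 2 - (M * ξ - t * ξ ^ 2) =
      (M - t * ξ) ^ 2 / (2 * t) := by field_simp; ring
  have h2 : 0 ≤ (M - t * ξ) ^ 2 / (2 * t) := by positivity
  linarith

theorem norm_laplaceGauss_integrand (n : ℕ) (w : ℂ) (t : ℝ) {ξ : ℝ} (hξ : 0 < ξ) :
    ‖(ξ : ℂ) ^ n * cexp (-w * ξ - t * ξ ^ 2)‖ =
      ξ ^ n * Real.exp (-w.re * ξ - t * ξ ^ 2) := by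
  rw [norm_mul, norm_pow, Complex.norm_real, Real.norm_of_nonneg hξ.le, Complex.norm_exp]
  congr 2
  have : ((t : ℂ) * ξ ^ 2) = ((t * ξ ^ 2 : ℝ) : ℂ) := by push_cast; ring
  rw [this, Complex.sub_re, Complex.ofReal_re]
  simp

theorem norm_laplaceGauss_integrand_le (n : ℕ) {w : ℂ} {t M t₀ : ℝ} (hw : -M ≤ w.re) (ht : t₀ ≤ t)
    {ξ : ℝ} (hξ : 0 < ξ) :
    ‖(ξ : ℂ) ^ n * cexp (-w * ξ - t * ξ ^ 2)‖ ≤ ξ ^ n * Real.exp (M * ξ - t₀ * ξ ^ 2) := by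
  rw [norm_laplaceGauss_integrand n w t hξ]
  gcongr
  linarith

theorem integrableOn_laplaceGauss (n : ℕ) (w : ℂ) {t : ℝ} (ht : 0 < t) :
    IntegrableOn (fun ξ : ℝ => (ξ : ℂ) ^ n * cexp (-w * ξ - t * ξ ^ 2)) (Ioi 0) := by
  refine Integrable.mono' (integrableOn_pow_mul_exp_linear_sub_sq n (-w.re) ht)
    (by fun_prop) ?_
  refine (ae_restrict_iff' measurableSet_Ioi).2 (Eventually.of_forall fun ξ hξ => ?_)
  exact norm_laplaceGauss_integrand_le n (by simp) le_rfl hξ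

theorem continuousOn_laplaceGauss (n : ℕ) :
    ContinuousOn (fun p : ℂ × ℝ => laplaceGauss n p.1 p.2) {p | 0 < p.2} := by
  intro p hp
  have hp0 : 0 < p.2 := hp
  refine ContinuousAt.continuousWithinAt ?_
  unfold laplaceGauss
  refine continuousAt_of_dominated
    (bound := fun ξ => ξ ^ n * Real.exp ((1 - p.1.re) * ξ - (p.2 / 2) * ξ ^ 2))
    (Eventually.of_forall fun q => by fun_prop) ?_
    (integrableOn_pow_mul_exp_linear_sub_sq n _ (by positivity)) ?_
  · have h1 : ∀ᶠ q : ℂ × ℝ in 𝓝 p, p.1.re - 1 < q.1.re :=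
      (Complex.continuous_re.comp continuous_fst).continuousAt.eventually
        (lt_mem_nhds (by simp : p.1.re - 1 < p.1.re))
    have h2 : ∀ᶠ q : ℂ × ℝ in 𝓝 p, p.2 / 2 < q.2 :=
      continuous_snd.continuousAt.eventually (lt_mem_nhds (by linarith : p.2 / 2 < p.2))
    filter_upwards [h1, h2] with q hq1 hq2
    refine (ae_restrict_iff' measurableSet_Ioi).2 (Eventually.of_forall fun ξ hξ => ?_)
    exact norm_laplaceGauss_integrand_le n (by linarith) hq2.le hξ
  · exact Eventually.of_forall fun ξ => by fun_prop

theorem hasDerivAt_laplaceGauss_left (n : ℕ) (w : ℂ) {t : ℝ} (ht : 0 < t) :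
    HasDerivAt (fun w => laplaceGauss n w t) (-laplaceGauss (n + 1) w t) w := by
  have key := hasDerivAt_integral_of_dominated_loc_of_deriv_le
    (μ := volume.restrict (Ioi (0 : ℝ)))
    (F := fun (w : ℂ) (ξ : ℝ) => (ξ : ℂ) ^ n * cexp (-w * ξ - t * ξ ^ 2))
    (F' := fun (w : ℂ) (ξ : ℝ) => -((ξ : ℂ) ^ (n + 1) * cexp (-w * ξ - t * ξ ^ 2)))
    (x₀ := w) (s := Metric.ball w 1) (Metric.ball_mem_nhds w one_pos)
    (bound := fun ξ => ξ ^ (n + 1) * Real.exp ((1 - w.re) * ξ - t * ξ ^ 2))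
    (Eventually.of_forall fun q => by fun_prop) (integrableOn_laplaceGauss n w ht)
    (by fun_prop) ?_ (integrableOn_pow_mul_exp_linear_sub_sq _ _ ht) ?_
  · have := key.2
    rw [integral_neg] at this
    exact this
  · refine (ae_restrict_iff' measurableSet_Ioi).2 (Eventually.of_forall fun ξ hξ q hq => ?_)
    rw [norm_neg]
    refine norm_laplaceGauss_integrand_le (n + 1) ?_ le_rfl hξ
    have h1 : |(q - w).re| ≤ ‖q - w‖ := Complex.abs_re_le_norm _
    have h2 : ‖q - w‖ < 1 := by simpa [dist_eq_norm] using hq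
    have h3 := (abs_lt.1 (h1.trans_lt h2)).1
    rw [Complex.sub_re] at h3
    linarith
  · refine Eventually.of_forall fun ξ q _ => ?_
    have h : HasDerivAt (fun w : ℂ => -w * (ξ : ℂ) - t * ξ ^ 2) (-(ξ : ℂ)) q := by
      simpa using ((hasDerivAt_id q).neg.mul_const (ξ : ℂ)).sub_const ((t : ℂ) * ξ ^ 2)
    exact (h.cexp.const_mul ((ξ : ℂ) ^ n)).congr_deriv (by ring)

theorem hasDerivAt_laplaceGauss_right (n : ℕ) (w : ℂ) {t : ℝ} (ht : 0 < t) :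
    HasDerivAt (fun t => laplaceGauss n w t) (-laplaceGauss (n + 2) w t) t := by
  have key := hasDerivAt_integral_of_dominated_loc_of_deriv_le
    (μ := volume.restrict (Ioi (0 : ℝ)))
    (F := fun (t : ℝ) (ξ : ℝ) => (ξ : ℂ) ^ n * cexp (-w * ξ - t * ξ ^ 2))
    (F' := fun (t : ℝ) (ξ : ℝ) => -((ξ : ℂ) ^ (n + 2) * cexp (-w * ξ - t * ξ ^ 2)))
    (x₀ := t) (s := Ioi (t / 2)) (Ioi_mem_nhds (by linarith))
    (bound := fun ξ => ξ ^ (n + 2) * Real.exp ((-w.re) * ξ - (t / 2) * ξ ^ 2))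
    (Eventually.of_forall fun q => by fun_prop) (integrableOn_laplaceGauss n w ht)
    (by fun_prop) ?_ (integrableOn_pow_mul_exp_linear_sub_sq _ _ (by positivity)) ?_
  · have := key.2
    rw [integral_neg] at this
    exact this
  · refine (ae_restrict_iff' measurableSet_Ioi).2 (Eventually.of_forall fun ξ hξ q hq => ?_)
    rw [norm_neg]
    exact norm_laplaceGauss_integrand_le (n + 2) (by simp) (le_of_lt hq) hξ
  · refine Eventually.of_forall fun ξ q _ => ?_
    have h0 : HasDerivAt (fun q : ℝ => (q : ℂ)) 1 q := Complex.ofRealCLM.hasDerivAt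
    have h : HasDerivAt (fun q : ℝ => -w * (ξ : ℂ) - q * ξ ^ 2) (-(ξ : ℂ) ^ 2) q := by
      simpa using (h0.mul_const ((ξ : ℂ) ^ 2)).const_sub (-w * (ξ : ℂ))
    exact (h.cexp.const_mul ((ξ : ℂ) ^ n)).congr_deriv (by ring)

theorem hasDerivAt_laplaceGauss_integrand (n : ℕ) (w : ℂ) (t ξ : ℝ) :
    HasDerivAt (fun ξ : ℝ => (ξ : ℂ) ^ n * cexp (-w * ξ - t * ξ ^ 2))
      (n * ((ξ : ℂ) ^ (n - 1) * cexp (-w * ξ - t * ξ ^ 2)) -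
        w * ((ξ : ℂ) ^ n * cexp (-w * ξ - t * ξ ^ 2)) -
        2 * t * ((ξ : ℂ) ^ (n + 1) * cexp (-w * ξ - t * ξ ^ 2))) ξ := by
  have h0 : HasDerivAt (fun q : ℝ => (q : ℂ)) 1 ξ := Complex.ofRealCLM.hasDerivAt
  have h1 : HasDerivAt (fun q : ℝ => -w * (q : ℂ) - t * (q : ℂ) ^ 2) (-w - 2 * t * ξ) ξ := by
    exact ((h0.const_mul (-w)).sub ((h0.pow 2).const_mul (t : ℂ))).congr_deriv (by simp; ring)
  exact ((h0.pow n).mul h1.cexp).congr_deriv (by simp; ring)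

/-- Integration by parts: `w K_n = n K_{n-1} - 2t K_{n+1} + 0ⁿ`. -/
theorem mul_laplaceGauss (n : ℕ) (w : ℂ) {t : ℝ} (ht : 0 < t) :
    w * laplaceGauss n w t =
      n * laplaceGauss (n - 1) w t - 2 * t * laplaceGauss (n + 1) w t + 0 ^ n := by
  have hi : ∀ k, IntegrableOn (fun ξ : ℝ => (ξ : ℂ) ^ k * cexp (-w * ξ - t * ξ ^ 2)) (Ioi 0) :=
    fun k => integrableOn_laplaceGauss k w ht
  have hd := fun ξ => hasDerivAt_laplaceGauss_integrand n w t ξ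
  have hi1 : IntegrableOn (fun ξ : ℝ => (n : ℂ) * ((ξ : ℂ) ^ (n - 1) * cexp (-w * ξ - t * ξ ^ 2)) -
        w * ((ξ : ℂ) ^ n * cexp (-w * ξ - t * ξ ^ 2)) -
        2 * t * ((ξ : ℂ) ^ (n + 1) * cexp (-w * ξ - t * ξ ^ 2))) (Ioi 0) :=
    (((hi _).const_mul _).sub ((hi _).const_mul _)).sub ((hi _).const_mul _)
  have hlim := tendsto_zero_of_hasDerivAt_of_integrableOn_Ioi (fun ξ _ => hd ξ) hi1 (hi n)
  -- The only boundary value is the one at `ξ = 0`, namely `0 ^ n`, equal to `1` for `n = 0`. In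
  -- that case the truncated index `n - 1` is harmless, its coefficient being `n = 0`.
  have h := integral_Ioi_of_hasDerivAt_of_tendsto (hd 0).continuousAt.continuousWithinAt
    (fun ξ _ => hd ξ) hi1 hlim
  have e1 := integral_sub (((hi (n - 1)).const_mul n).sub ((hi n).const_mul w))
    ((hi (n + 1)).const_mul (2 * t))
  have e2 := integral_sub ((hi (n - 1)).const_mul n) ((hi n).const_mul w)
  simp only [Pi.sub_apply] at e1
  rw [e1, e2, integral_const_mul, integral_const_mul, integral_const_mul] at h
  simp only [ofReal_zero, mul_zero, ne_eq, OfNat.ofNat_ne_zero, not_false_eq_true, zero_pow,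
    sub_zero, Complex.exp_zero, mul_one, zero_sub] at h
  unfold laplaceGauss
  linear_combination -h

/-- For `0 ≤ w.re` the factor `e^{-wξ}` has modulus at most one; the substitution `u = √t ξ` then
extracts the power of `t`. -/
theorem exists_norm_laplaceGauss_mul_le (n : ℕ) : ∃ C : ℝ, 0 < C ∧ ∀ (w : ℂ) (t : ℝ), 0 ≤ w.re →
    0 < t → ‖laplaceGauss n w t‖ * √t ^ (n + 1) ≤ C := by
  set g : ℝ → ℝ := fun u => u ^ n * Real.exp (-u ^ 2) with hg
  refine ⟨|∫ u in Ioi (0 : ℝ), g u| + 1, by positivity, fun w t hw ht => ?_⟩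
  have hτ : 0 < √t := Real.sqrt_pos.2 ht
  have h1 : ‖laplaceGauss n w t‖ ≤ ∫ ξ in Ioi (0 : ℝ), ξ ^ n * Real.exp (0 * ξ - t * ξ ^ 2) := by
    refine norm_integral_le_of_norm_le (integrableOn_pow_mul_exp_linear_sub_sq n 0 ht) ?_
    refine (ae_restrict_iff' measurableSet_Ioi).2 (Eventually.of_forall fun ξ hξ => ?_)
    exact norm_laplaceGauss_integrand_le n (by simpa using hw) le_rfl hξ
  have h2 : ∀ ξ : ℝ, ξ ^ n * Real.exp (0 * ξ - t * ξ ^ 2) = (√t ^ n)⁻¹ * g (√t * ξ) := by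
    intro ξ
    simp only [hg, mul_pow, Real.sq_sqrt ht.le]
    field_simp
    ring_nf
  simp_rw [h2] at h1
  rw [integral_const_mul, integral_comp_mul_left_Ioi g 0 hτ, mul_zero, smul_eq_mul] at h1
  calc ‖laplaceGauss n w t‖ * √t ^ (n + 1)
      ≤ ((√t ^ n)⁻¹ * ((√t)⁻¹ * ∫ u in Ioi (0 : ℝ), g u)) * √t ^ (n + 1) := by gcongr
    _ = ∫ u in Ioi (0 : ℝ), g u := by field_simp; ring
    _ ≤ _ := (le_abs_self _).trans (by linarith)

/-- Each use of the recurrence of `mul_laplaceGauss` trades one factor `w` for `K_{n-1}` or `t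
K_{n+1}`, which have the same homogeneity; so the induction on `j` runs over all `n` at once. The
limit `j ≤ n + 1` is forced by the boundary term: `w K₀` is only bounded. -/
theorem exists_norm_pow_mul_laplaceGauss_le (j : ℕ) : ∀ n : ℕ, j ≤ n + 1 → ∃ C : ℝ, 0 < C ∧
    ∀ (w : ℂ) (t : ℝ), 0 ≤ w.re → 0 < t →
      ‖w‖ ^ j * ‖laplaceGauss n w t‖ * √t ^ (n + 1 - j) ≤ C := by
  induction j with
  | zero =>
    intro n _
    obtain ⟨C, hC, h⟩ := exists_norm_laplaceGauss_mul_le n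
    exact ⟨C, hC, fun w t hw ht => by simpa using h w t hw ht⟩
  | succ j ih =>
    intro n hn
    obtain ⟨C₂, hC₂, h₂⟩ := ih (n + 1) (by omega)
    have main : ∀ (w : ℂ) (t : ℝ), 0 ≤ w.re → 0 < t →
        ‖w‖ * ‖laplaceGauss n w t‖ ≤ n * ‖laplaceGauss (n - 1) w t‖ +
          2 * t * ‖laplaceGauss (n + 1) w t‖ + 0 ^ n := by
      intro w t hw ht
      rw [← norm_mul, mul_laplaceGauss n w ht]
      refine (norm_add_le _ _).trans (add_le_add ((norm_sub_le _ _).trans ?_) ?_)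
      · simp [abs_of_pos ht]
      · simp
    have hsucc : ∀ (w : ℂ) (t : ℝ), 0 ≤ w.re → 0 < t →
        ‖w‖ ^ j * (2 * t * ‖laplaceGauss (n + 1) w t‖) * √t ^ (n + 1 - (j + 1)) ≤ 2 * C₂ := by
      intro w t hw ht
      have h := h₂ w t hw ht
      have e : n + 1 + 1 - j = (n + 1 - (j + 1)) + 2 := by omega
      rw [e, pow_add, Real.sq_sqrt ht.le] at h
      nlinarith [h]
    -- For `n = 0` the boundary term `1` survives, and `j = 0` leaves no power of `√t` to be paid.
    rcases n with _ | n
    · obtain rfl : j = 0 := by omega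
      refine ⟨2 * C₂ + 1, by positivity, fun w t hw ht => ?_⟩
      have h1 := main w t hw ht
      have h2 := hsucc w t hw ht
      simp at h1 h2 ⊢
      linarith
    · obtain ⟨C₁, hC₁, h₁⟩ := ih n (by omega)
      refine ⟨2 * C₂ + (n + 1) * C₁, by positivity, fun w t hw ht => ?_⟩
      have h1 := main w t hw ht
      have h2 := hsucc w t hw ht
      have h3 := h₁ w t hw ht
      have e : n + 1 + 1 - (j + 1) = n + 1 - j := by omega
      rw [e] at h2 ⊢
      simp only [Nat.add_sub_cancel, ne_eq, Nat.succ_ne_zero, not_false_eq_true, zero_pow, add_zero,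
        Nat.cast_add, Nat.cast_one] at h1
      calc ‖w‖ ^ (j + 1) * ‖laplaceGauss (n + 1) w t‖ * √t ^ (n + 1 - j)
          = ‖w‖ ^ j * √t ^ (n + 1 - j) * (‖w‖ * ‖laplaceGauss (n + 1) w t‖) := by ring
        _ ≤ ‖w‖ ^ j * √t ^ (n + 1 - j) * ((n + 1) * ‖laplaceGauss n w t‖ +
              2 * t * ‖laplaceGauss (n + 1 + 1) w t‖) := by gcongr
        _ = (n + 1) * (‖w‖ ^ j * ‖laplaceGauss n w t‖ * √t ^ (n + 1 - j)) +
            ‖w‖ ^ j * (2 * t * ‖laplaceGauss (n + 1 + 1) w t‖) * √t ^ (n + 1 - j) := by ring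
        _ ≤ (n + 1) * C₁ + 2 * C₂ := by gcongr
        _ = _ := by ring

/-- The decay `|K_n(w,t)| ≤ C (|w|² + t)^{-(n+1)/2}` in the right half plane. -/
theorem exists_norm_laplaceGauss_le (n : ℕ) : ∃ C : ℝ, 0 < C ∧ ∀ (w : ℂ) (t : ℝ), 0 ≤ w.re →
    0 < t → ‖laplaceGauss n w t‖ ≤ C / √(‖w‖ ^ 2 + t) ^ (n + 1) := by
  obtain ⟨C₁, hC₁, h₁⟩ := exists_norm_laplaceGauss_mul_le n
  obtain ⟨C₂, hC₂, h₂⟩ := exists_norm_pow_mul_laplaceGauss_le (n + 1) n le_rfl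
  refine ⟨2 ^ n * (C₁ + C₂), by positivity, fun w t hw ht => ?_⟩
  have hR : 0 < √(‖w‖ ^ 2 + t) := Real.sqrt_pos.2 (by positivity)
  rw [le_div_iff₀ (by positivity)]
  have h3 : √(‖w‖ ^ 2 + t) ≤ ‖w‖ + √t := by
    rw [Real.sqrt_le_left (by positivity)]
    nlinarith [Real.sq_sqrt ht.le, mul_nonneg (norm_nonneg w) (Real.sqrt_nonneg t)]
  have h4 : √(‖w‖ ^ 2 + t) ^ (n + 1) ≤ 2 ^ n * (‖w‖ ^ (n + 1) + √t ^ (n + 1)) :=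
    (pow_le_pow_left₀ hR.le h3 _).trans
      (by simpa using add_pow_le (norm_nonneg w) (Real.sqrt_nonneg t) (n + 1))
  have h5 := h₁ w t hw ht
  have h6 := h₂ w t hw ht
  simp only [Nat.sub_self, pow_zero, mul_one] at h6
  calc ‖laplaceGauss n w t‖ * √(‖w‖ ^ 2 + t) ^ (n + 1)
      ≤ ‖laplaceGauss n w t‖ * (2 ^ n * (‖w‖ ^ (n + 1) + √t ^ (n + 1))) := by gcongr
    _ = 2 ^ n * (‖laplaceGauss n w t‖ * √t ^ (n + 1) +
          ‖w‖ ^ (n + 1) * ‖laplaceGauss n w t‖) := by ring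
    _ ≤ _ := by gcongr

end LaplaceGauss

/-! ### Differentiation of integrals over intervals. -/

section ParametricIntegrals

open Filter Topology

/-- A dominating constant is the maximum of the derivative over a compact ball of parameters times
the segment of integration. -/
theorem hasDerivAt_intervalIntegral_of_continuousOn {E : Type*} [NormedAddCommGroup E]
    [NormedSpace ℝ E] {F F' : ℝ → ℝ → E} {U : Set ℝ} (hU : IsOpen U)
    (hF : ∀ q ∈ U, ∀ b, HasDerivAt (fun q => F q b) (F' q b) q)
    (hc : ContinuousOn (fun p : ℝ × ℝ => F p.1 p.2) (U ×ˢ univ))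
    (hc' : ContinuousOn (fun p : ℝ × ℝ => F' p.1 p.2) (U ×ˢ univ)) {q : ℝ} (hq : q ∈ U) (u v : ℝ) :
    HasDerivAt (fun q => ∫ b in u..v, F q b) (∫ b in u..v, F' q b) q := by
  obtain ⟨ε, hε, hball⟩ := Metric.nhds_basis_closedBall.mem_iff.1 (hU.mem_nhds hq)
  have hslice : ∀ q ∈ U, Continuous (F q) := fun q hq =>
    continuousOn_univ.1 (hc.comp (by fun_prop : ContinuousOn (fun b : ℝ => (q, b)) univ)
      (fun b _ => ⟨hq, mem_univ _⟩))
  have hslice' : ∀ q ∈ U, Continuous (F' q) := fun q hq =>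
    continuousOn_univ.1 (hc'.comp (by fun_prop : ContinuousOn (fun b : ℝ => (q, b)) univ)
      (fun b _ => ⟨hq, mem_univ _⟩))
  obtain ⟨C, hC⟩ := ((isCompact_closedBall q ε).prod (isCompact_uIcc (a := u)
    (b := v))).exists_bound_of_continuousOn
    (hc'.mono (prod_mono hball (subset_univ _)))
  refine (intervalIntegral.hasDerivAt_integral_of_dominated_loc_of_deriv_le
    (s := Metric.ball q ε) (bound := fun _ => C) (Metric.ball_mem_nhds q hε) ?_
    ((hslice q hq).intervalIntegrable _ _) (hslice' q hq).aestronglyMeasurable ?_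
    intervalIntegrable_const ?_).2
  · filter_upwards [hU.mem_nhds hq] with x hx using (hslice x hx).aestronglyMeasurable
  · exact Eventually.of_forall fun b hb x hx =>
      hC (x, b) ⟨Metric.ball_subset_closedBall hx, uIoc_subset_uIcc hb⟩
  · exact Eventually.of_forall fun b _ x hx => hF x (hball (Metric.ball_subset_closedBall hx)) b

/-- Differentiation of an integral with variable endpoint and parameter. -/
theorem hasDerivAt_intervalIntegral_endpoint {E : Type*} [NormedAddCommGroup E]
    [NormedSpace ℝ E] [CompleteSpace E] {g g' : ℝ → ℝ → E}
    (hg : ∀ d s, HasDerivAt (fun d => g d s) (g' d s) d)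
    (hc : Continuous fun p : ℝ × ℝ => g p.1 p.2) (hc' : Continuous fun p : ℝ × ℝ => g' p.1 p.2)
    (d : ℝ) :
    HasDerivAt (fun d => ∫ s in (0 : ℝ)..d, g d s) (g d d + ∫ s in (0 : ℝ)..d, g' d s) d := by
  -- The endpoint and the parameter are treated as independent variables with continuous partial
  -- derivatives; the curve `d ↦ (d, d)` then gives the chain rule.
  have h := hasStrictFDerivAt_uncurry_coprod (𝕜 := ℝ) (u := (d, d))
    (f := fun u e => ∫ s in (0 : ℝ)..u, g e s)
    (f₁ := fun u e => ContinuousLinearMap.toSpanSingleton ℝ (g e u))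
    (f₂ := fun u e => ContinuousLinearMap.toSpanSingleton ℝ (∫ s in (0 : ℝ)..u, g' e s))
    (Eventually.of_forall fun v => ?_) (Eventually.of_forall fun v => ?_) ?_ ?_
  · have h2 := HasFDerivAt.comp_hasDerivAt (f := fun d : ℝ => (d, d)) d h.hasFDerivAt
      ((hasDerivAt_id d).prodMk (hasDerivAt_id d))
    refine h2.congr_deriv ?_
    simp [Function.HasUncurry.uncurry]
  · have hs : Continuous (g v.2) := by fun_prop
    exact (intervalIntegral.integral_hasDerivAt_right (hs.intervalIntegrable _ _)
      (hs.stronglyMeasurableAtFilter _ _) hs.continuousAt).hasFDerivAt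
  · exact (hasDerivAt_intervalIntegral_of_continuousOn isOpen_univ (fun q _ b => hg q b)
      hc.continuousOn hc'.continuousOn (mem_univ _) 0 v.1).hasFDerivAt
  · refine Continuous.continuousAt ?_
    exact (ContinuousLinearMap.toSpanSingletonCLE (𝕜 := ℝ) (E := E)).continuous.comp
      (hc.comp (continuous_snd.prodMk continuous_fst))
  · refine Continuous.continuousAt ?_
    refine (ContinuousLinearMap.toSpanSingletonCLE (𝕜 := ℝ) (E := E)).continuous.comp ?_
    exact intervalIntegral.continuous_parametric_intervalIntegral_of_continuous
      (f := fun (p : ℝ × ℝ) s => g' p.2 s) (by fun_prop) continuous_fst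

end ParametricIntegrals

/-! ### Gaussians with polynomial factors. -/

section GaussTerm

open Filter Topology

/-- The functions `r^m t^{-(m+i+1)/2} e^{-r²/4t}`. -/
noncomputable def gaussTerm (m i : ℕ) (r t : ℝ) : ℝ :=
  r ^ m / √t ^ (m + i + 1) * Real.exp (-r ^ 2 / (4 * t))

/-- The index `i` measures size, since the power of `r / √t` is absorbed by the exponential: a space
derivative raises `i` by one in both terms, and a time derivative by two. -/
theorem hasDerivAt_gaussTerm_left (m i : ℕ) (r : ℝ) {t : ℝ} (ht : 0 < t) :
    HasDerivAt (fun r => gaussTerm m i r t)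
      (m * gaussTerm (m - 1) (i + 1) r t - 1 / 2 * gaussTerm (m + 1) (i + 1) r t) r := by
  have h1 : HasDerivAt (fun r : ℝ => -r ^ 2 / (4 * t)) (-(2 * r) / (4 * t)) r := by
    simpa using ((hasDerivAt_pow 2 r).neg.div_const (4 * t))
  have hτ : 0 < √t := Real.sqrt_pos.2 ht
  refine (((hasDerivAt_pow m r).div_const (√t ^ (m + i + 1))).mul h1.exp).congr_deriv ?_
  unfold gaussTerm
  have e2 : √t ^ (m + 1 + (i + 1) + 1) = √t ^ (m + i + 1) * t := by
    rw [show m + 1 + (i + 1) + 1 = (m + i + 1) + 2 by ring, pow_add, Real.sq_sqrt ht.le]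
  rw [e2]
  rcases m with _ | m
  · field_simp
    simp
    ring
  · have e1 : √t ^ (m + 1 - 1 + (i + 1) + 1) = √t ^ (m + 1 + i + 1) := by
      congr 1
      omega
    rw [e1]
    field_simp
    ring

theorem hasDerivAt_gaussTerm_right (m i : ℕ) (r : ℝ) {t : ℝ} (ht : 0 < t) :
    HasDerivAt (fun t => gaussTerm m i r t)
      (-((m + i + 1 : ℝ) / 2) * gaussTerm m (i + 2) r t + 1 / 4 * gaussTerm (m + 2) (i + 2) r t)
      t := by
  have hτ : 0 < √t := Real.sqrt_pos.2 ht
  have h1 : HasDerivAt (fun t : ℝ => -r ^ 2 / (4 * t)) (r ^ 2 / (4 * t ^ 2)) t := by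
    refine ((hasDerivAt_const t (-r ^ 2)).div ((hasDerivAt_id t).const_mul 4)
      (by simpa using ht.ne')).congr_deriv ?_
    simp
    field_simp
  have h2 : HasDerivAt (fun t : ℝ => √t ^ (m + i + 1))
      ((m + i + 1 : ℕ) * √t ^ (m + i) * (1 / (2 * √t))) t :=
    (Real.hasDerivAt_sqrt ht.ne').pow (m + i + 1)
  refine ((((hasDerivAt_const t (r ^ m)).div h2 (by positivity))).mul h1.exp).congr_deriv ?_
  simp only [Pi.div_apply]
  unfold gaussTerm
  have e1 : √t ^ (m + (i + 2) + 1) = √t ^ (m + i) * √t * t := by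
    rw [show m + (i + 2) + 1 = (m + i) + 1 + 2 by ring, pow_add _ _ 2, Real.sq_sqrt ht.le, pow_succ]
  have e2 : √t ^ (m + 2 + (i + 2) + 1) = √t ^ (m + i) * √t * t ^ 2 := by
    rw [show m + 2 + (i + 2) + 1 = (m + i) + 1 + 2 + 2 by ring, pow_add _ _ 2, pow_add _ _ 2,
      Real.sq_sqrt ht.le, pow_succ]
    ring
  have e3 : √t ^ (m + i + 1) = √t ^ (m + i) * √t := pow_succ _ _
  have e4 : √t * √t = t := Real.mul_self_sqrt ht.le
  rw [e1, e2, e3]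
  push_cast
  field_simp
  rw [Real.sq_sqrt ht.le]
  ring

theorem continuousOn_gaussTerm (m i : ℕ) :
    ContinuousOn (fun p : ℝ × ℝ => gaussTerm m i p.1 p.2) {p | 0 < p.2} := by
  unfold gaussTerm
  have h : ∀ p ∈ {p : ℝ × ℝ | 0 < p.2}, p.2 ≠ 0 := fun p hp => ne_of_gt hp
  have h2 : ∀ p ∈ {p : ℝ × ℝ | 0 < p.2}, √p.2 ^ (m + i + 1) ≠ 0 := fun p hp =>
    (pow_pos (Real.sqrt_pos.2 hp) _).ne'
  have h3 : ∀ p ∈ {p : ℝ × ℝ | 0 < p.2}, 4 * p.2 ≠ 0 := fun p hp => by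
    have := h p hp
    positivity
  exact (ContinuousOn.div (by fun_prop) (by fun_prop) h2).mul
    (Real.continuous_exp.comp_continuousOn (ContinuousOn.div (by fun_prop) (by fun_prop) h3))

/-- One term of the exponential series bounds the even power `u ^ (2 * m)`; `|u| ^ m ≤ 1 + u ^ (2 *
m)` covers the rest. -/
theorem exists_abs_pow_mul_exp_le (m : ℕ) {c : ℝ} (hc : 0 < c) :
    ∃ C : ℝ, 0 < C ∧ ∀ u : ℝ, |u| ^ m * Real.exp (-c * u ^ 2) ≤ C := by
  refine ⟨1 + m.factorial / c ^ m, by positivity, fun u => ?_⟩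
  have h1 := Real.pow_div_factorial_le_exp (c * u ^ 2) (by positivity) m
  have h2 : (u ^ 2) ^ m ≤ m.factorial / c ^ m * Real.exp (c * u ^ 2) := by
    rw [mul_pow, div_le_iff₀ (by positivity)] at h1
    rw [div_mul_eq_mul_div, le_div_iff₀ (by positivity)]
    linarith
  have h3 : |u| ^ m ≤ 1 + (u ^ 2) ^ m := by
    rw [← sq_abs u, ← pow_mul, mul_comm 2 m, pow_mul]
    nlinarith [sq_nonneg (|u| ^ m - 1)]
  have h4 : 1 ≤ Real.exp (c * u ^ 2) := Real.one_le_exp (by positivity)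
  rw [neg_mul, Real.exp_neg, ← div_eq_mul_inv, div_le_iff₀ (Real.exp_pos _)]
  nlinarith

/-- Half of the Gaussian is spent on the polynomial in `r / √t`; the other half is kept, whence the
`8`. -/
theorem exists_abs_gaussTerm_le (m i : ℕ) : ∃ C : ℝ, 0 < C ∧ ∀ r t : ℝ, 0 < t →
    |gaussTerm m i r t| ≤ C / √t ^ (i + 1) * Real.exp (-r ^ 2 / (8 * t)) := by
  obtain ⟨C, hC, h⟩ := exists_abs_pow_mul_exp_le m (by norm_num : (0 : ℝ) < 1 / 8)
  refine ⟨C, hC, fun r t ht => ?_⟩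
  have hτ : 0 < √t := Real.sqrt_pos.2 ht
  have h1 := h (r / √t)
  have e : -(1 / 8) * (r / √t) ^ 2 = -r ^ 2 / (8 * t) := by
    rw [div_pow, Real.sq_sqrt ht.le]
    field_simp
  have e2 : -r ^ 2 / (4 * t) = -r ^ 2 / (8 * t) + -r ^ 2 / (8 * t) := by
    field_simp
    ring
  rw [e, abs_div, abs_of_pos hτ, div_pow] at h1
  unfold gaussTerm
  rw [e2, Real.exp_add, abs_mul, abs_div, abs_pow, abs_of_pos (pow_pos hτ _),
    abs_of_pos (mul_pos (Real.exp_pos _) (Real.exp_pos _))]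
  calc |r| ^ m / √t ^ (m + i + 1) * (Real.exp (-r ^ 2 / (8 * t)) * Real.exp (-r ^ 2 / (8 * t)))
      = (|r| ^ m / √t ^ m * Real.exp (-r ^ 2 / (8 * t))) / √t ^ (i + 1) *
          Real.exp (-r ^ 2 / (8 * t)) := by
        rw [add_assoc, pow_add]
        field_simp
    _ ≤ _ := by gcongr

end GaussTerm

/-! ### Products of Gaussians with Laplace–Gauss integrals, and their integrals over strips. -/

section GaussLaplace

open Filter Topology

/-- The product of `gaussTerm m i` at `(p,t)` and of `laplaceGauss n` at `(u + iv, t)`. -/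
noncomputable def gaussLaplace (m i n : ℕ) (p u v t : ℝ) : ℂ :=
  (gaussTerm m i p t : ℂ) * laplaceGauss n ((u : ℂ) + v * Complex.I) t

theorem hasDerivAt_gaussLaplace_gauss (m i n : ℕ) (p u v : ℝ) {t : ℝ} (ht : 0 < t) :
    HasDerivAt (fun p => gaussLaplace m i n p u v t)
      (m * gaussLaplace (m - 1) (i + 1) n p u v t +
        (-1 / 2) * gaussLaplace (m + 1) (i + 1) n p u v t) p := by
  refine ((hasDerivAt_gaussTerm_left m i p ht).ofReal_comp.mul_const _).congr_deriv ?_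
  unfold gaussLaplace
  push_cast
  ring

theorem hasDerivAt_gaussLaplace_re (m i n : ℕ) (p u v : ℝ) {t : ℝ} (ht : 0 < t) :
    HasDerivAt (fun u => gaussLaplace m i n p u v t) (-gaussLaplace m i (n + 1) p u v t) u := by
  have h0 : HasDerivAt (fun u : ℝ => (u : ℂ) + v * Complex.I) 1 u :=
    Complex.ofRealCLM.hasDerivAt.add_const _
  refine (((hasDerivAt_laplaceGauss_left n _ ht).comp u h0).const_mul _).congr_deriv ?_
  unfold gaussLaplace
  ring

theorem hasDerivAt_gaussLaplace_im (m i n : ℕ) (p u v : ℝ) {t : ℝ} (ht : 0 < t) :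
    HasDerivAt (fun v => gaussLaplace m i n p u v t)
      (-Complex.I * gaussLaplace m i (n + 1) p u v t) v := by
  have h0 : HasDerivAt (fun v : ℝ => (u : ℂ) + v * Complex.I) Complex.I v := by
    simpa using ((Complex.ofRealCLM.hasDerivAt (x := v)).mul_const Complex.I).const_add (u : ℂ)
  refine (((hasDerivAt_laplaceGauss_left n _ ht).comp v h0).const_mul _).congr_deriv ?_
  unfold gaussLaplace
  ring

theorem hasDerivAt_gaussLaplace_time (m i n : ℕ) (p u v : ℝ) {t : ℝ} (ht : 0 < t) :
    HasDerivAt (fun t => gaussLaplace m i n p u v t)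
      (-((m + i + 1) / 2) * gaussLaplace m (i + 2) n p u v t +
        (1 / 4 * gaussLaplace (m + 2) (i + 2) n p u v t +
          (-1) * gaussLaplace m i (n + 2) p u v t)) t := by
  refine ((hasDerivAt_gaussTerm_right m i p ht).ofReal_comp.mul
    (hasDerivAt_laplaceGauss_right n _ ht)).congr_deriv ?_
  unfold gaussLaplace
  push_cast
  ring

theorem ContinuousOn.gaussLaplace {X : Type*} [TopologicalSpace X] {s : Set X} {p u v t : X → ℝ}
    (m i n : ℕ) (hp : ContinuousOn p s) (hu : ContinuousOn u s) (hv : ContinuousOn v s)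
    (ht : ContinuousOn t s) (hpos : ∀ x ∈ s, 0 < t x) :
    ContinuousOn (fun x => gaussLaplace m i n (p x) (u x) (v x) (t x)) s := by
  have h1 : ContinuousOn (fun x => gaussTerm m i (p x) (t x)) s :=
    (continuousOn_gaussTerm m i).comp (hp.prodMk ht) fun x hx => hpos x hx
  have h2 : ContinuousOn (fun x => laplaceGauss n ((u x : ℂ) + v x * Complex.I) (t x)) s :=
    (continuousOn_laplaceGauss n).comp
      (f := fun x => (((u x : ℂ) + v x * Complex.I), t x)) (by fun_prop) fun x hx => hpos x hx
  exact (Complex.continuous_ofReal.comp_continuousOn h1).mul h2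

/-- The integral over the strip `0 < s < d` of the product of a Gaussian in `b + s` and of the
function `laplaceGauss` at `(d - s) + i(a - c)`. -/
noncomputable def stripTerm (m i n : ℕ) (a b c d t : ℝ) : ℂ :=
  ∫ s in (0 : ℝ)..d, gaussLaplace m i n (b + s) (d - s) (a - c) t

theorem intervalIntegrable_stripTerm (m i n : ℕ) (a b c d : ℝ) {t : ℝ} (ht : 0 < t) (x y : ℝ) :
    IntervalIntegrable (fun s => gaussLaplace m i n (b + s) (d - s) (a - c) t) volume x y :=
  Continuous.intervalIntegrable (continuousOn_univ.1 (ContinuousOn.gaussLaplace m i n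
    (by fun_prop) (by fun_prop) (by fun_prop) (by fun_prop) fun _ _ => ht)) _ _

theorem hasDerivAt_stripTerm_a (m i n : ℕ) (a b c d : ℝ) {t : ℝ} (ht : 0 < t) :
    HasDerivAt (fun a => stripTerm m i n a b c d t)
      (-Complex.I * stripTerm m i (n + 1) a b c d t) a := by
  refine (hasDerivAt_intervalIntegral_of_continuousOn
    (F' := fun a s => -Complex.I * gaussLaplace m i (n + 1) (b + s) (d - s) (a - c) t) isOpen_univ
    (fun q _ s => ?_) ?_ ?_ (mem_univ a) 0 d).congr_deriv (intervalIntegral.integral_const_mul _ _)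
  · exact (hasDerivAt_gaussLaplace_im m i n _ _ _ ht).comp_sub_const q c
  · exact ContinuousOn.gaussLaplace m i n
      (by fun_prop) (by fun_prop) (by fun_prop) (by fun_prop) fun _ _ => ht
  · exact continuousOn_const.mul (ContinuousOn.gaussLaplace m i (n + 1)
      (by fun_prop) (by fun_prop) (by fun_prop) (by fun_prop) fun _ _ => ht)

theorem hasDerivAt_stripTerm_c (m i n : ℕ) (a b c d : ℝ) {t : ℝ} (ht : 0 < t) :
    HasDerivAt (fun c => stripTerm m i n a b c d t)
      (Complex.I * stripTerm m i (n + 1) a b c d t) c := by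
  refine (hasDerivAt_intervalIntegral_of_continuousOn
    (F' := fun c s => Complex.I * gaussLaplace m i (n + 1) (b + s) (d - s) (a - c) t) isOpen_univ
    (fun q _ s => ?_) ?_ ?_ (mem_univ c) 0 d).congr_deriv (intervalIntegral.integral_const_mul _ _)
  · refine ((hasDerivAt_gaussLaplace_im m i n _ _ _ ht).comp_const_sub a q).congr_deriv ?_
    ring
  · exact ContinuousOn.gaussLaplace m i n
      (by fun_prop) (by fun_prop) (by fun_prop) (by fun_prop) fun _ _ => ht
  · exact continuousOn_const.mul (ContinuousOn.gaussLaplace m i (n + 1)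
      (by fun_prop) (by fun_prop) (by fun_prop) (by fun_prop) fun _ _ => ht)

theorem hasDerivAt_stripTerm_b (m i n : ℕ) (a b c d : ℝ) {t : ℝ} (ht : 0 < t) :
    HasDerivAt (fun b => stripTerm m i n a b c d t)
      (m * stripTerm (m - 1) (i + 1) n a b c d t +
        (-1 / 2) * stripTerm (m + 1) (i + 1) n a b c d t) b := by
  refine (hasDerivAt_intervalIntegral_of_continuousOn
    (F' := fun b s => m * gaussLaplace (m - 1) (i + 1) n (b + s) (d - s) (a - c) t +
        (-1 / 2) * gaussLaplace (m + 1) (i + 1) n (b + s) (d - s) (a - c) t) isOpen_univ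
    (fun q _ s => ?_) ?_ ?_ (mem_univ b) 0 d).congr_deriv ?_
  · exact (hasDerivAt_gaussLaplace_gauss m i n _ _ _ ht).comp_add_const q s
  · exact ContinuousOn.gaussLaplace m i n
      (by fun_prop) (by fun_prop) (by fun_prop) (by fun_prop) fun _ _ => ht
  · exact (continuousOn_const.mul (ContinuousOn.gaussLaplace _ _ n
      (by fun_prop) (by fun_prop) (by fun_prop) (by fun_prop) fun _ _ => ht)).add
      (continuousOn_const.mul (ContinuousOn.gaussLaplace _ _ n
      (by fun_prop) (by fun_prop) (by fun_prop) (by fun_prop) fun _ _ => ht))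
  · rw [intervalIntegral.integral_add ((intervalIntegrable_stripTerm _ _ _ _ _ _ _ ht _ _).const_mul _)
      ((intervalIntegrable_stripTerm _ _ _ _ _ _ _ ht _ _).const_mul _),
      intervalIntegral.integral_const_mul, intervalIntegral.integral_const_mul]
    rfl

theorem hasDerivAt_stripTerm_t (m i n : ℕ) (a b c d : ℝ) {t : ℝ} (ht : 0 < t) :
    HasDerivAt (fun t => stripTerm m i n a b c d t)
      (-((m + i + 1) / 2) * stripTerm m (i + 2) n a b c d t +
        (1 / 4 * stripTerm (m + 2) (i + 2) n a b c d t +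
          (-1) * stripTerm m i (n + 2) a b c d t)) t := by
  refine (hasDerivAt_intervalIntegral_of_continuousOn
    (F' := fun t s => -((m + i + 1) / 2) * gaussLaplace m (i + 2) n (b + s) (d - s) (a - c) t +
        (1 / 4 * gaussLaplace (m + 2) (i + 2) n (b + s) (d - s) (a - c) t +
          (-1) * gaussLaplace m i (n + 2) (b + s) (d - s) (a - c) t)) isOpen_Ioi
    (fun q hq s => hasDerivAt_gaussLaplace_time m i n _ _ _ hq) ?_ ?_ ht 0 d).congr_deriv ?_
  · exact ContinuousOn.gaussLaplace m i n
      (by fun_prop) (by fun_prop) (by fun_prop) (by fun_prop) fun _ h => h.1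
  · exact (continuousOn_const.mul (ContinuousOn.gaussLaplace _ _ _
      (by fun_prop) (by fun_prop) (by fun_prop) (by fun_prop) fun _ h => h.1)).add
      ((continuousOn_const.mul (ContinuousOn.gaussLaplace _ _ _
      (by fun_prop) (by fun_prop) (by fun_prop) (by fun_prop) fun _ h => h.1)).add
      (continuousOn_const.mul (ContinuousOn.gaussLaplace _ _ _
      (by fun_prop) (by fun_prop) (by fun_prop) (by fun_prop) fun _ h => h.1)))
  · have hi := fun m i n k => (intervalIntegrable_stripTerm m i n a b c d ht 0 d).const_mul k
    rw [intervalIntegral.integral_add (hi _ _ _ _) ((hi _ _ _ _).add (hi _ _ _ _)),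
      intervalIntegral.integral_add (hi _ _ _ _) (hi _ _ _ _),
      intervalIntegral.integral_const_mul, intervalIntegral.integral_const_mul,
      intervalIntegral.integral_const_mul]
    rfl

/-- The moving endpoint contributes the integrand at `s = d`, where the argument of `laplaceGauss`
is purely imaginary. This is why its decay is needed up to the boundary of the right half plane. -/
theorem hasDerivAt_stripTerm_d (m i n : ℕ) (a b c d : ℝ) {t : ℝ} (ht : 0 < t) :
    HasDerivAt (fun d => stripTerm m i n a b c d t)
      (gaussLaplace m i n (b + d) 0 (a - c) t + (-1) * stripTerm m i (n + 1) a b c d t) d := by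
  refine (hasDerivAt_intervalIntegral_endpoint
    (g := fun d s => gaussLaplace m i n (b + s) (d - s) (a - c) t)
    (g' := fun d s => (-1) * gaussLaplace m i (n + 1) (b + s) (d - s) (a - c) t)
    (fun d s => ?_) ?_ ?_ d).congr_deriv ?_
  · refine ((hasDerivAt_gaussLaplace_re m i n _ _ _ ht).comp_sub_const d s).congr_deriv ?_
    ring
  · exact continuousOn_univ.1 (ContinuousOn.gaussLaplace m i n
      (by fun_prop) (by fun_prop) (by fun_prop) (by fun_prop) fun _ _ => ht)
  · exact continuous_const.mul (continuousOn_univ.1 (ContinuousOn.gaussLaplace m i (n + 1)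
      (by fun_prop) (by fun_prop) (by fun_prop) (by fun_prop) fun _ _ => ht))
  · rw [intervalIntegral.integral_const_mul, sub_self]
    rfl

theorem continuousOn_stripTerm (m i n : ℕ) :
    ContinuousOn (fun p : (ℝ × ℝ) × (ℝ × ℝ) × ℝ =>
      stripTerm m i n p.1.1 p.1.2 p.2.1.1 p.2.1.2 p.2.2) {p | 0 < p.2.2} := by
  rw [continuousOn_iff_continuous_domRestrict]
  have hopen : IsOpen {p : (ℝ × ℝ) × (ℝ × ℝ) × ℝ | 0 < p.2.2} :=
    isOpen_lt continuous_const (by fun_prop)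
  have := hopen.locallyCompactSpace
  refine intervalIntegral.continuous_parametric_intervalIntegral_of_continuous
    (f := fun (p : {p : (ℝ × ℝ) × (ℝ × ℝ) × ℝ | 0 < p.2.2}) s =>
      gaussLaplace m i n (p.1.1.2 + s) (p.1.2.1.2 - s) (p.1.1.1 - p.1.2.1.1) p.1.2.2)
    ?_ (by fun_prop)
  exact continuousOn_univ.1 (ContinuousOn.gaussLaplace m i n
      (by fun_prop) (by fun_prop) (by fun_prop) (by fun_prop) fun q _ => q.1.2)

/-! ### A class of kernels closed under differentiation. -/

/-- Finite sums of products of Gaussians and functions `laplaceGauss`. The indices record the decay: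
`α` counts the factors `t^{-1/2}`, `β` the factors `(d² + t)^{-1/2}` and `γ` the factors
`((a - c)² + (b + d)² + t)^{-1/2}`. -/
inductive KernelTerm : ℕ → ℕ → ℕ → (ℝ → ℝ → ℝ → ℝ → ℝ → ℂ) → Prop
  -- The natural size is `t^{-i/2} R^{-(n+1)}` with `R² = (a-c)² + (b+d)² + t`. The equation `h`
  -- matches total homogeneity; by `h'` the powers of `R` suffice for the `β` and `γ` factors, and
  -- those left over are converted into powers of `√t ≤ R`.
  | strip {α β γ m i n : ℕ} (h : i + n + 1 = α + β + γ) (h' : β + γ ≤ n + 1) :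
      KernelTerm α β γ (stripTerm m i n)
  -- Here a Gaussian in `b + d` is present, which pays for any number of factors `(d² + t)^{-1/2}`;
  -- so only `γ` is limited by the decay of `laplaceGauss`.
  | edge {α β γ m i n : ℕ} (h : i + n + 2 = α + β + γ) (h' : γ ≤ n + 1) :
      KernelTerm α β γ (fun a b c d t => gaussLaplace m i n (b + d) 0 (a - c) t)
  -- With Gaussians in both variables every distribution of the homogeneity over the three indices
  -- is allowed.
  | gauss {α β γ m i m' i' : ℕ} (h : i + i' + 2 = α + β + γ) :
      KernelTerm α β γ (fun a b c d t => ((gaussTerm m i (b + d) t * gaussTerm m' i' (a - c) t : ℝ) : ℂ))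
  | add {α β γ : ℕ} {f g : ℝ → ℝ → ℝ → ℝ → ℝ → ℂ} (hf : KernelTerm α β γ f)
      (hg : KernelTerm α β γ g) : KernelTerm α β γ (fun a b c d t => f a b c d t + g a b c d t)
  | smul {α β γ : ℕ} (z : ℂ) {f : ℝ → ℝ → ℝ → ℝ → ℝ → ℂ} (hf : KernelTerm α β γ f) :
      KernelTerm α β γ (fun a b c d t => z * f a b c d t)

namespace KernelTerm

variable {α β γ : ℕ} {f : ℝ → ℝ → ℝ → ℝ → ℝ → ℂ}

theorem continuousOn (hf : KernelTerm α β γ f) :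
    ContinuousOn (fun p : (ℝ × ℝ) × (ℝ × ℝ) × ℝ => f p.1.1 p.1.2 p.2.1.1 p.2.1.2 p.2.2)
      {p | 0 < p.2.2} := by
  induction hf with
  | strip h h' => exact continuousOn_stripTerm _ _ _
  | edge h h' =>
    exact ContinuousOn.gaussLaplace _ _ _
      (by fun_prop) (by fun_prop) (by fun_prop) (by fun_prop) fun _ h => h
  | @gauss m i m' i' h =>
    refine Complex.continuous_ofReal.comp_continuousOn (ContinuousOn.mul ?_ ?_)
    · exact (continuousOn_gaussTerm m i).comp
        (f := fun p : (ℝ × ℝ) × (ℝ × ℝ) × ℝ => (p.1.2 + p.2.1.2, p.2.2)) (by fun_prop) fun _ h => h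
    · exact (continuousOn_gaussTerm m' i').comp
        (f := fun p : (ℝ × ℝ) × (ℝ × ℝ) × ℝ => (p.1.1 - p.2.1.1, p.2.2)) (by fun_prop) fun _ h => h
  | add _ _ h1 h2 => exact h1.add h2
  | smul z _ h => exact continuousOn_const.mul h

/-- The five rules of differentiation raise exactly the index whose exponent grows in the pointwise
bound: `γ` for `a` and `c`, `α` for `b`, `β` for `d`, and `α` twice for `t`. The side conditions
survive because each rule raises `n` or a Gaussian index accordingly. -/
theorem exists_deriv_a (hf : KernelTerm α β γ f) : ∃ g, KernelTerm α β (γ + 1) g ∧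
    ∀ a b c d t, 0 < t → HasDerivAt (fun a => f a b c d t) (g a b c d t) a := by
  induction hf with
  | @strip m i n h h' =>
    exact ⟨_, .smul (-Complex.I) (.strip (m := m) (i := i) (n := n + 1) (by omega) (by omega)),
      fun a b c d t ht => hasDerivAt_stripTerm_a _ _ _ a b c d ht⟩
  | @edge m i n h h' =>
    exact ⟨_, .smul (-Complex.I) (.edge (m := m) (i := i) (n := n + 1) (by omega) (by omega)),
      fun a b c d t ht => (hasDerivAt_gaussLaplace_im _ _ _ _ _ _ ht).comp_sub_const a c⟩
  | @gauss m i m' i' h =>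
    refine ⟨_, .add (.smul m' (.gauss (m := m) (i := i) (m' := m' - 1) (i' := i' + 1) (by omega)))
      (.smul (-1 / 2) (.gauss (m := m) (i := i) (m' := m' + 1) (i' := i' + 1) (by omega))),
      fun a b c d t ht => ?_⟩
    refine (((hasDerivAt_gaussTerm_left m' i' _ ht).comp_sub_const a c).const_mul
      _).ofReal_comp.congr_deriv ?_
    push_cast
    ring
  | add _ _ h1 h2 =>
    obtain ⟨g1, hg1, h1⟩ := h1
    obtain ⟨g2, hg2, h2⟩ := h2
    exact ⟨_, .add hg1 hg2, fun a b c d t ht => (h1 a b c d t ht).add (h2 a b c d t ht)⟩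
  | smul z _ h =>
    obtain ⟨g, hg, h⟩ := h
    exact ⟨_, .smul z hg, fun a b c d t ht => (h a b c d t ht).const_mul z⟩

theorem exists_deriv_c (hf : KernelTerm α β γ f) : ∃ g, KernelTerm α β (γ + 1) g ∧
    ∀ a b c d t, 0 < t → HasDerivAt (fun c => f a b c d t) (g a b c d t) c := by
  induction hf with
  | @strip m i n h h' =>
    exact ⟨_, .smul Complex.I (.strip (m := m) (i := i) (n := n + 1) (by omega) (by omega)),
      fun a b c d t ht => hasDerivAt_stripTerm_c _ _ _ a b c d ht⟩
  | @edge m i n h h' =>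
    refine ⟨_, .smul Complex.I (.edge (m := m) (i := i) (n := n + 1) (by omega) (by omega)), fun a b c d t ht =>
      ((hasDerivAt_gaussLaplace_im _ _ _ _ _ _ ht).comp_const_sub a c).congr_deriv ?_⟩
    ring
  | @gauss m i m' i' h =>
    refine ⟨_, .add (.smul (-m') (.gauss (m := m) (i := i) (m' := m' - 1) (i' := i' + 1) (by omega)))
      (.smul (1 / 2) (.gauss (m := m) (i := i) (m' := m' + 1) (i' := i' + 1) (by omega))),
      fun a b c d t ht => ?_⟩
    refine (((hasDerivAt_gaussTerm_left m' i' _ ht).comp_const_sub a c).const_mul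
      _).ofReal_comp.congr_deriv ?_
    push_cast
    ring
  | add _ _ h1 h2 =>
    obtain ⟨g1, hg1, h1⟩ := h1
    obtain ⟨g2, hg2, h2⟩ := h2
    exact ⟨_, .add hg1 hg2, fun a b c d t ht => (h1 a b c d t ht).add (h2 a b c d t ht)⟩
  | smul z _ h =>
    obtain ⟨g, hg, h⟩ := h
    exact ⟨_, .smul z hg, fun a b c d t ht => (h a b c d t ht).const_mul z⟩

theorem exists_deriv_b (hf : KernelTerm α β γ f) : ∃ g, KernelTerm (α + 1) β γ g ∧
    ∀ a b c d t, 0 < t → HasDerivAt (fun b => f a b c d t) (g a b c d t) b := by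
  induction hf with
  | @strip m i n h h' =>
    exact ⟨_, .add (.smul m (.strip (m := m - 1) (i := i + 1) (n := n) (by omega) (by omega)))
      (.smul (-1 / 2) (.strip (m := m + 1) (i := i + 1) (n := n) (by omega) (by omega))),
      fun a b c d t ht => hasDerivAt_stripTerm_b _ _ _ a b c d ht⟩
  | @edge m i n h h' =>
    exact ⟨_, .add (.smul m (.edge (m := m - 1) (i := i + 1) (n := n) (by omega) (by omega)))
      (.smul (-1 / 2) (.edge (m := m + 1) (i := i + 1) (n := n) (by omega) (by omega))),
      fun a b c d t ht => (hasDerivAt_gaussLaplace_gauss _ _ _ _ _ _ ht).comp_add_const b d⟩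
  | @gauss m i m' i' h =>
    refine ⟨_, .add (.smul m (.gauss (m := m - 1) (i := i + 1) (m' := m') (i' := i') (by omega)))
      (.smul (-1 / 2) (.gauss (m := m + 1) (i := i + 1) (m' := m') (i' := i') (by omega))),
      fun a b c d t ht => ?_⟩
    refine (((hasDerivAt_gaussTerm_left m i _ ht).comp_add_const b d).mul_const
      _).ofReal_comp.congr_deriv ?_
    push_cast
    ring
  | add _ _ h1 h2 =>
    obtain ⟨g1, hg1, h1⟩ := h1
    obtain ⟨g2, hg2, h2⟩ := h2
    exact ⟨_, .add hg1 hg2, fun a b c d t ht => (h1 a b c d t ht).add (h2 a b c d t ht)⟩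
  | smul z _ h =>
    obtain ⟨g, hg, h⟩ := h
    exact ⟨_, .smul z hg, fun a b c d t ht => (h a b c d t ht).const_mul z⟩

theorem exists_deriv_d (hf : KernelTerm α β γ f) : ∃ g, KernelTerm α (β + 1) γ g ∧
    ∀ a b c d t, 0 < t → HasDerivAt (fun d => f a b c d t) (g a b c d t) d := by
  induction hf with
  | @strip m i n h h' =>
    exact ⟨_, .add (.edge (m := m) (i := i) (n := n) (by omega) (by omega)) (.smul (-1) (.strip (m := m) (i := i) (n := n + 1) (by omega) (by omega))),
      fun a b c d t ht => hasDerivAt_stripTerm_d _ _ _ a b c d ht⟩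
  | @edge m i n h h' =>
    exact ⟨_, .add (.smul m (.edge (m := m - 1) (i := i + 1) (n := n) (by omega) (by omega)))
      (.smul (-1 / 2) (.edge (m := m + 1) (i := i + 1) (n := n) (by omega) (by omega))),
      fun a b c d t ht => (hasDerivAt_gaussLaplace_gauss _ _ _ _ _ _ ht).comp_const_add b d⟩
  | @gauss m i m' i' h =>
    refine ⟨_, .add (.smul m (.gauss (m := m - 1) (i := i + 1) (m' := m') (i' := i') (by omega)))
      (.smul (-1 / 2) (.gauss (m := m + 1) (i := i + 1) (m' := m') (i' := i') (by omega))),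
      fun a b c d t ht => ?_⟩
    refine (((hasDerivAt_gaussTerm_left m i _ ht).comp_const_add b d).mul_const
      _).ofReal_comp.congr_deriv ?_
    push_cast
    ring
  | add _ _ h1 h2 =>
    obtain ⟨g1, hg1, h1⟩ := h1
    obtain ⟨g2, hg2, h2⟩ := h2
    exact ⟨_, .add hg1 hg2, fun a b c d t ht => (h1 a b c d t ht).add (h2 a b c d t ht)⟩
  | smul z _ h =>
    obtain ⟨g, hg, h⟩ := h
    exact ⟨_, .smul z hg, fun a b c d t ht => (h a b c d t ht).const_mul z⟩

/-- Differentiating `laplaceGauss` in time raises `n` by two, a gain of two powers of spatial decay;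
this surplus is booked as a loss of `t` only, which the inequality in the side condition permits. -/
theorem exists_deriv_t (hf : KernelTerm α β γ f) : ∃ g, KernelTerm (α + 2) β γ g ∧
    ∀ a b c d t, 0 < t → HasDerivAt (fun t => f a b c d t) (g a b c d t) t := by
  induction hf with
  | @strip m i n h h' =>
    exact ⟨_, .add (.smul (-((m + i + 1) / 2)) (.strip (m := m) (i := i + 2) (n := n) (by omega) (by omega)))
      (.add (.smul (1 / 4) (.strip (m := m + 2) (i := i + 2) (n := n) (by omega) (by omega)))
        (.smul (-1) (.strip (m := m) (i := i) (n := n + 2) (by omega) (by omega)))),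
      fun a b c d t ht => hasDerivAt_stripTerm_t _ _ _ a b c d ht⟩
  | @edge m i n h h' =>
    exact ⟨_, .add (.smul (-((m + i + 1) / 2)) (.edge (m := m) (i := i + 2) (n := n) (by omega) (by omega)))
      (.add (.smul (1 / 4) (.edge (m := m + 2) (i := i + 2) (n := n) (by omega) (by omega)))
        (.smul (-1) (.edge (m := m) (i := i) (n := n + 2) (by omega) (by omega)))),
      fun a b c d t ht => hasDerivAt_gaussLaplace_time _ _ _ _ _ _ ht⟩
  | @gauss m i m' i' h =>
    refine ⟨_, .add
      (.add (.smul (-((m + i + 1) / 2)) (.gauss (m := m) (i := i + 2) (m' := m') (i' := i') (by omega)))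
        (.smul (1 / 4) (.gauss (m := m + 2) (i := i + 2) (m' := m') (i' := i') (by omega))))
      (.add
        (.smul (-((m' + i' + 1) / 2)) (.gauss (m := m) (i := i) (m' := m') (i' := i' + 2) (by omega)))
        (.smul (1 / 4) (.gauss (m := m) (i := i) (m' := m' + 2) (i' := i' + 2) (by omega)))),
      fun a b c d t ht => ?_⟩
    refine ((hasDerivAt_gaussTerm_right m i _ ht).mul
      (hasDerivAt_gaussTerm_right m' i' _ ht)).ofReal_comp.congr_deriv ?_
    push_cast
    ring
  | add _ _ h1 h2 =>
    obtain ⟨g1, hg1, h1⟩ := h1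
    obtain ⟨g2, hg2, h2⟩ := h2
    exact ⟨_, .add hg1 hg2, fun a b c d t ht => (h1 a b c d t ht).add (h2 a b c d t ht)⟩
  | smul z _ h =>
    obtain ⟨g, hg, h⟩ := h
    exact ⟨_, .smul z hg, fun a b c d t ht => (h a b c d t ht).const_mul z⟩

end KernelTerm

end GaussLaplace

/-! ### Joint smoothness and mixed derivatives of kernel terms. -/

section Smoothness

open Filter Topology

theorem hasFDerivAt_of_partial {E₁ E₂ F : Type*} [NormedAddCommGroup E₁] [NormedSpace ℝ E₁]
    [NormedAddCommGroup E₂] [NormedSpace ℝ E₂] [NormedAddCommGroup F] [NormedSpace ℝ F]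
    {f : E₁ × E₂ → F} {f₁ : E₁ × E₂ → E₁ →L[ℝ] F} {f₂ : E₁ × E₂ → E₂ →L[ℝ] F} {U : Set (E₁ × E₂)}
    (hU : IsOpen U) (h₁ : ∀ v ∈ U, HasFDerivAt (fun x => f (x, v.2)) (f₁ v) v.1)
    (h₂ : ∀ v ∈ U, HasFDerivAt (fun x => f (v.1, x)) (f₂ v) v.2)
    (c₁ : ContinuousOn f₁ U) (c₂ : ContinuousOn f₂ U) :
    ∀ u ∈ U, HasFDerivAt f ((f₁ u).coprod (f₂ u)) u := by
  intro u hu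
  have hev := hU.mem_nhds hu
  exact (hasStrictFDerivAt_uncurry_coprod (f := fun x y => f (x, y)) (f₁ := fun x y => f₁ (x, y))
    (f₂ := fun x y => f₂ (x, y)) (by filter_upwards [hev] with v hv using h₁ v hv)
    (by filter_upwards [hev] with v hv using h₂ v hv) (c₁.continuousAt hev)
    (c₂.continuousAt hev)).hasFDerivAt

theorem ContinuousOn.clm_coprod {X E₁ E₂ F : Type*} [TopologicalSpace X] [NormedAddCommGroup E₁]
    [NormedSpace ℝ E₁] [NormedAddCommGroup E₂] [NormedSpace ℝ E₂] [NormedAddCommGroup F]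
    [NormedSpace ℝ F] {f₁ : X → E₁ →L[ℝ] F} {f₂ : X → E₂ →L[ℝ] F} {s : Set X}
    (h₁ : ContinuousOn f₁ s) (h₂ : ContinuousOn f₂ s) :
    ContinuousOn (fun x => (f₁ x).coprod (f₂ x)) s :=
  (ContinuousLinearMap.coprodEquivL ℝ :
    ((E₁ →L[ℝ] F) × (E₂ →L[ℝ] F)) ≃L[ℝ] (E₁ × E₂ →L[ℝ] F)).continuous.comp_continuousOn (h₁.prodMk h₂)

theorem ContDiffOn.clm_coprod {X E₁ E₂ F : Type*} [NormedAddCommGroup X] [NormedSpace ℝ X]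
    [NormedAddCommGroup E₁] [NormedSpace ℝ E₁] [NormedAddCommGroup E₂] [NormedSpace ℝ E₂]
    [NormedAddCommGroup F] [NormedSpace ℝ F] {f₁ : X → E₁ →L[ℝ] F} {f₂ : X → E₂ →L[ℝ] F}
    {s : Set X} {n : WithTop ℕ∞} (h₁ : ContDiffOn ℝ n f₁ s) (h₂ : ContDiffOn ℝ n f₂ s) :
    ContDiffOn ℝ n (fun x => (f₁ x).coprod (f₂ x)) s :=
  (ContinuousLinearMap.coprodEquivL ℝ :
    ((E₁ →L[ℝ] F) × (E₂ →L[ℝ] F)) ≃L[ℝ] (E₁ × E₂ →L[ℝ] F)).contDiff.comp_contDiffOn (h₁.prodMk h₂)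

namespace KernelTerm

variable {α β γ : ℕ} {f : ℝ → ℝ → ℝ → ℝ → ℝ → ℂ}

/-- All five partial derivatives are again kernel terms, hence of class `C^N` by induction. The
total derivative is assembled from them pair by pair, following the nesting of the product `(ℝ × ℝ)
× (ℝ × ℝ) × ℝ`; no sign of `b` or `d` is needed. -/
theorem contDiffOn_nat (N : ℕ) : ∀ {α β γ : ℕ} {f : ℝ → ℝ → ℝ → ℝ → ℝ → ℂ}, KernelTerm α β γ f →
    ContDiffOn ℝ N (fun p : (ℝ × ℝ) × (ℝ × ℝ) × ℝ => f p.1.1 p.1.2 p.2.1.1 p.2.1.2 p.2.2)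
      {p | 0 < p.2.2} := by
  induction N with
  | zero => exact fun hf => contDiffOn_zero.2 hf.continuousOn
  | succ N ih =>
    intro α β γ f hf
    obtain ⟨fa, ka, ha⟩ := hf.exists_deriv_a
    obtain ⟨fb, kb, hb⟩ := hf.exists_deriv_b
    obtain ⟨fc, kc, hc⟩ := hf.exists_deriv_c
    obtain ⟨fd, kd, hd⟩ := hf.exists_deriv_d
    obtain ⟨ft, kt, ht⟩ := hf.exists_deriv_t
    have hopen : IsOpen {p : (ℝ × ℝ) × (ℝ × ℝ) × ℝ | 0 < p.2.2} :=
      isOpen_lt continuous_const (by fun_prop)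
    let L : (ℝ → ℝ → ℝ → ℝ → ℝ → ℂ) → (ℝ × ℝ) × (ℝ × ℝ) × ℝ → ℝ →L[ℝ] ℂ := fun g p =>
      ContinuousLinearMap.toSpanSingleton ℝ (g p.1.1 p.1.2 p.2.1.1 p.2.1.2 p.2.2)
    have hLc : ∀ {α β γ g}, KernelTerm α β γ g → ContinuousOn (L g) {p | 0 < p.2.2} := fun h =>
      (ContinuousLinearMap.toSpanSingletonCLE (𝕜 := ℝ) (E := ℂ)).continuous.comp_continuousOn
        h.continuousOn
    have hLd : ∀ {α β γ g}, KernelTerm α β γ g → ContDiffOn ℝ N (L g) {p | 0 < p.2.2} := fun h =>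
      (ContinuousLinearMap.toSpanSingletonCLE (𝕜 := ℝ) (E := ℂ)).contDiff.comp_contDiffOn (ih h)
    have hx : ∀ p : (ℝ × ℝ) × (ℝ × ℝ) × ℝ, 0 < p.2.2 →
        HasFDerivAt (fun x : ℝ × ℝ => f x.1 x.2 p.2.1.1 p.2.1.2 p.2.2)
          ((L fa p).coprod (L fb p)) p.1 := fun p hp =>
      hasFDerivAt_of_partial (f := fun x : ℝ × ℝ => f x.1 x.2 p.2.1.1 p.2.1.2 p.2.2)
        (f₁ := fun x => L fa (x, p.2)) (f₂ := fun x => L fb (x, p.2)) isOpen_univ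
        (fun v _ => (ha _ _ _ _ _ hp).hasFDerivAt) (fun v _ => (hb _ _ _ _ _ hp).hasFDerivAt)
        ((hLc ka).comp (by fun_prop) fun _ _ => hp) ((hLc kb).comp (by fun_prop) fun _ _ => hp)
        p.1 (mem_univ _)
    have hy : ∀ p : (ℝ × ℝ) × (ℝ × ℝ) × ℝ, 0 < p.2.2 →
        HasFDerivAt (fun y : ℝ × ℝ => f p.1.1 p.1.2 y.1 y.2 p.2.2)
          ((L fc p).coprod (L fd p)) p.2.1 := fun p hp =>
      hasFDerivAt_of_partial (f := fun y : ℝ × ℝ => f p.1.1 p.1.2 y.1 y.2 p.2.2)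
        (f₁ := fun y => L fc (p.1, y, p.2.2)) (f₂ := fun y => L fd (p.1, y, p.2.2)) isOpen_univ
        (fun v _ => (hc _ _ _ _ _ hp).hasFDerivAt) (fun v _ => (hd _ _ _ _ _ hp).hasFDerivAt)
        ((hLc kc).comp (by fun_prop) fun _ _ => hp) ((hLc kd).comp (by fun_prop) fun _ _ => hp)
        p.2.1 (mem_univ _)
    have hyt : ∀ p : (ℝ × ℝ) × (ℝ × ℝ) × ℝ, 0 < p.2.2 →
        HasFDerivAt (fun q : (ℝ × ℝ) × ℝ => f p.1.1 p.1.2 q.1.1 q.1.2 q.2)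
          (((L fc p).coprod (L fd p)).coprod (L ft p)) p.2 := fun p hp =>
      hasFDerivAt_of_partial (f := fun q : (ℝ × ℝ) × ℝ => f p.1.1 p.1.2 q.1.1 q.1.2 q.2)
        (f₁ := fun q => (L fc (p.1, q)).coprod (L fd (p.1, q))) (f₂ := fun q => L ft (p.1, q))
        (U := {q | 0 < q.2}) (isOpen_lt continuous_const (by fun_prop))
        (fun v hv => hy (p.1, v) hv) (fun v hv => (ht p.1.1 p.1.2 v.1.1 v.1.2 v.2 hv).hasFDerivAt)
        (((hLc kc).comp (f := fun q => (p.1, q)) (by fun_prop) fun _ h => h).clm_coprod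
          ((hLc kd).comp (f := fun q => (p.1, q)) (by fun_prop) fun _ h => h))
        ((hLc kt).comp (f := fun q => (p.1, q)) (by fun_prop) fun _ h => h) p.2 hp
    have htot := hasFDerivAt_of_partial
      (f := fun p : (ℝ × ℝ) × (ℝ × ℝ) × ℝ => f p.1.1 p.1.2 p.2.1.1 p.2.1.2 p.2.2)
      (f₁ := fun p => (L fa p).coprod (L fb p))
      (f₂ := fun p => ((L fc p).coprod (L fd p)).coprod (L ft p)) hopen hx hyt
      ((hLc ka).clm_coprod (hLc kb)) (((hLc kc).clm_coprod (hLc kd)).clm_coprod (hLc kt))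
    push_cast
    rw [contDiffOn_succ_iff_hasFDerivWithinAt_of_uniqueDiffOn hopen.uniqueDiffOn]
    exact ⟨by simp, _, ((hLd ka).clm_coprod (hLd kb)).clm_coprod
      (((hLd kc).clm_coprod (hLd kd)).clm_coprod (hLd kt)),
      fun p hp => (htot p hp).hasFDerivWithinAt⟩

theorem contDiffOn (hf : KernelTerm α β γ f) :
    ContDiffOn ℝ ∞ (fun p : (ℝ × ℝ) × (ℝ × ℝ) × ℝ => f p.1.1 p.1.2 p.2.1.1 p.2.1.2 p.2.2)
      {p | 0 < p.2.2} :=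
  contDiffOn_infty.2 fun N => contDiffOn_nat N hf

theorem hasDerivAt_re {f : ℝ → ℂ} {f' : ℂ} {x : ℝ} (h : HasDerivAt f f' x) :
    HasDerivAt (fun x => (f x).re) f'.re x :=
  HasFDerivAt.comp_hasDerivAt (l := Complex.reCLM) x Complex.reCLM.hasFDerivAt h

theorem exists_iteratedDeriv_a (n : ℕ) (hf : KernelTerm α β γ f) :
    ∃ g, KernelTerm α β (γ + n) g ∧ ∀ a b c d t, 0 < t →
      iteratedDeriv n (fun a => (f a b c d t).re) a = (g a b c d t).re := by
  induction n with
  | zero => exact ⟨f, hf, by simp⟩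
  | succ n ih =>
    obtain ⟨g, hg, h⟩ := ih
    obtain ⟨g', hg', h'⟩ := hg.exists_deriv_a
    refine ⟨g', hg', fun a b c d t ht => ?_⟩
    rw [iteratedDeriv_succ, funext fun a => h a b c d t ht]
    exact (hasDerivAt_re (h' a b c d t ht)).deriv

theorem exists_iteratedDeriv_b (n : ℕ) (hf : KernelTerm α β γ f) :
    ∃ g, KernelTerm (α + n) β γ g ∧ ∀ a b c d t, 0 < t →
      iteratedDeriv n (fun b => (f a b c d t).re) b = (g a b c d t).re := by
  induction n with
  | zero => exact ⟨f, hf, by simp⟩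
  | succ n ih =>
    obtain ⟨g, hg, h⟩ := ih
    obtain ⟨g', hg', h'⟩ := hg.exists_deriv_b
    refine ⟨g', hg', fun a b c d t ht => ?_⟩
    rw [iteratedDeriv_succ, funext fun b => h a b c d t ht]
    exact (hasDerivAt_re (h' a b c d t ht)).deriv

theorem exists_iteratedDeriv_c (n : ℕ) (hf : KernelTerm α β γ f) :
    ∃ g, KernelTerm α β (γ + n) g ∧ ∀ a b c d t, 0 < t →
      iteratedDeriv n (fun c => (f a b c d t).re) c = (g a b c d t).re := by
  induction n with
  | zero => exact ⟨f, hf, by simp⟩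
  | succ n ih =>
    obtain ⟨g, hg, h⟩ := ih
    obtain ⟨g', hg', h'⟩ := hg.exists_deriv_c
    refine ⟨g', hg', fun a b c d t ht => ?_⟩
    rw [iteratedDeriv_succ, funext fun c => h a b c d t ht]
    exact (hasDerivAt_re (h' a b c d t ht)).deriv

theorem exists_iteratedDeriv_d (n : ℕ) (hf : KernelTerm α β γ f) :
    ∃ g, KernelTerm α (β + n) γ g ∧ ∀ a b c d t, 0 < t →
      iteratedDeriv n (fun d => (f a b c d t).re) d = (g a b c d t).re := by
  induction n with
  | zero => exact ⟨f, hf, by simp⟩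
  | succ n ih =>
    obtain ⟨g, hg, h⟩ := ih
    obtain ⟨g', hg', h'⟩ := hg.exists_deriv_d
    refine ⟨g', hg', fun a b c d t ht => ?_⟩
    rw [iteratedDeriv_succ, funext fun d => h a b c d t ht]
    exact (hasDerivAt_re (h' a b c d t ht)).deriv

theorem exists_iteratedDeriv_t (n : ℕ) (hf : KernelTerm α β γ f) :
    ∃ g, KernelTerm (α + 2 * n) β γ g ∧ ∀ a b c d t, 0 < t →
      iteratedDeriv n (fun t => (f a b c d t).re) t = (g a b c d t).re := by
  induction n with
  | zero => exact ⟨f, hf, by simp⟩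
  | succ n ih =>
    obtain ⟨g, hg, h⟩ := ih
    obtain ⟨g', hg', h'⟩ := hg.exists_deriv_t
    refine ⟨g', hg', fun a b c d t ht => ?_⟩
    have hev : iteratedDeriv n (fun t => (f a b c d t).re) =ᶠ[𝓝 t] fun t => (g a b c d t).re := by
      filter_upwards [lt_mem_nhds ht] with s hs using h a b c d s hs
    rw [iteratedDeriv_succ, hev.deriv_eq]
    exact (hasDerivAt_re (h' a b c d t ht)).deriv

/-- The mixed derivatives of the real part of a kernel term. -/
theorem exists_mixedDeriv (hf : KernelTerm α β γ f) {F : ℝ × ℝ → ℝ × ℝ → ℝ → ℝ}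
    (hF : ∀ a b c d t, 0 < d → 0 < t → F (a, b) (c, d) t = (f a b c d t).re)
    (s k₁ k₂ m₁ m₂ : ℕ) :
    ∃ g, KernelTerm (α + (k₂ + 2 * s)) (β + m₂) (γ + (m₁ + k₁)) g ∧
      ∀ x y t, 0 < y.2 → 0 < t →
        mixedDeriv s k₁ k₂ m₁ m₂ F x y t = (g x.1 x.2 y.1 y.2 t).re := by
  obtain ⟨g₁, hg₁, h₁⟩ := hf.exists_iteratedDeriv_d m₂
  obtain ⟨g₂, hg₂, h₂⟩ := hg₁.exists_iteratedDeriv_c m₁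
  obtain ⟨g₃, hg₃, h₃⟩ := hg₂.exists_iteratedDeriv_b k₂
  obtain ⟨g₄, hg₄, h₄⟩ := hg₃.exists_iteratedDeriv_a k₁
  obtain ⟨g₅, hg₅, h₅⟩ := hg₄.exists_iteratedDeriv_t s
  refine ⟨g₅, by simpa only [add_assoc] using hg₅, fun x y t hy ht => ?_⟩
  rw [← h₅ _ _ _ _ _ ht]
  unfold mixedDeriv
  -- The representation of `F` is available only for `d > 0` and `t > 0`, so in these two variables
  -- germs are compared instead of functions; the derivatives are then peeled off from the outermost
  -- inwards.
  refine Filter.EventuallyEq.iteratedDeriv_eq s ?_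
  filter_upwards [lt_mem_nhds ht] with τ hτ
  rw [← h₄ _ _ _ _ _ hτ]
  congr 1
  funext a
  rw [← h₃ _ _ _ _ _ hτ]
  congr 1
  funext b
  rw [← h₂ _ _ _ _ _ hτ]
  congr 1
  funext c
  rw [← h₁ _ _ _ _ _ hτ]
  refine Filter.EventuallyEq.iteratedDeriv_eq m₂ ?_
  filter_upwards [lt_mem_nhds hy] with d hd using hF a b c d τ hd hτ

end KernelTerm

end Smoothness

/-! ### Pointwise bounds for kernel terms. -/

section KernelBounds

open Filter Topology

/-- A Gaussian in the distance `√q` turns powers of `√(q + t)` into powers of `√t`. All exchanges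
between spatial and temporal decay below are of this kind. -/
theorem exists_exp_mul_sqrt_pow_le (k : ℕ) : ∃ C : ℝ, 0 < C ∧ ∀ q t : ℝ, 0 ≤ q → 0 < t →
    Real.exp (-q / (16 * t)) * √(q + t) ^ k ≤ C * √t ^ k := by
  obtain ⟨C, hC, h⟩ := exists_abs_pow_mul_exp_le k (by norm_num : (0 : ℝ) < 1 / 16)
  refine ⟨2 ^ (k - 1) * (C + 1), by positivity, fun q t hq ht => ?_⟩
  have hτ : 0 < √t := Real.sqrt_pos.2 ht
  have h1 := h (√q / √t)
  have e : -(1 / 16) * (√q / √t) ^ 2 = -q / (16 * t) := by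
    rw [div_pow, Real.sq_sqrt ht.le, Real.sq_sqrt hq]
    field_simp
  rw [e, abs_of_nonneg (by positivity), div_pow, div_mul_eq_mul_div, div_le_iff₀ (by positivity)]
    at h1
  have h2 : √(q + t) ≤ √q + √t := by
    rw [Real.sqrt_le_left (by positivity)]
    nlinarith [Real.sq_sqrt ht.le, Real.sq_sqrt hq, mul_nonneg (Real.sqrt_nonneg q) hτ.le]
  have h3 : √(q + t) ^ k ≤ 2 ^ (k - 1) * (√q ^ k + √t ^ k) :=
    (pow_le_pow_left₀ (Real.sqrt_nonneg _) h2 k).trans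
      (add_pow_le (Real.sqrt_nonneg _) hτ.le k)
  have h4 : Real.exp (-q / (16 * t)) ≤ 1 := by
    rw [Real.exp_le_one_iff, neg_div]
    have : 0 ≤ q / (16 * t) := by positivity
    linarith
  calc Real.exp (-q / (16 * t)) * √(q + t) ^ k
      ≤ Real.exp (-q / (16 * t)) * (2 ^ (k - 1) * (√q ^ k + √t ^ k)) := by gcongr
    _ = 2 ^ (k - 1) * (√q ^ k * Real.exp (-q / (16 * t)) +
          Real.exp (-q / (16 * t)) * √t ^ k) := by ring
    _ ≤ 2 ^ (k - 1) * (C * √t ^ k + 1 * √t ^ k) := by gcongr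
    _ = _ := by ring

theorem exists_norm_gaussLaplace_le (m i n : ℕ) : ∃ C : ℝ, 0 < C ∧ ∀ p u v t : ℝ, 0 ≤ u → 0 < t →
    ‖gaussLaplace m i n p u v t‖ ≤
      C / √t ^ (i + 1) * Real.exp (-p ^ 2 / (8 * t)) / √(u ^ 2 + v ^ 2 + t) ^ (n + 1) := by
  obtain ⟨C₁, hC₁, h₁⟩ := exists_abs_gaussTerm_le m i
  obtain ⟨C₂, hC₂, h₂⟩ := exists_norm_laplaceGauss_le n
  refine ⟨C₁ * C₂, by positivity, fun p u v t hu ht => ?_⟩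
  have h3 := h₂ ((u : ℂ) + v * Complex.I) t (by simpa using hu) ht
  rw [Complex.sq_norm, Complex.normSq_add_mul_I] at h3
  have h4 := h₁ p t ht
  unfold gaussLaplace
  rw [norm_mul, Complex.norm_real, Real.norm_eq_abs]
  calc |gaussTerm m i p t| * ‖laplaceGauss n ((u : ℂ) + v * Complex.I) t‖
      ≤ (C₁ / √t ^ (i + 1) * Real.exp (-p ^ 2 / (8 * t))) *
          (C₂ / √(u ^ 2 + v ^ 2 + t) ^ (n + 1)) := by gcongr
    _ = _ := by ring

/-- The Gaussian in `b + s` localises to `b, s ≲ √t`, where the distance `|(d-s) + i(a-c)|` seen by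
`laplaceGauss` is comparable, up to `√t`, to the full distance. Integration over `s` returns one
factor `√t`, lowering the exponent `i + 1` to `i`. -/
theorem exists_norm_stripTerm_le (m i n : ℕ) : ∃ C : ℝ, 0 < C ∧ ∀ a b c d t : ℝ, 0 ≤ b → 0 ≤ d →
    0 < t → ‖stripTerm m i n a b c d t‖ ≤
      C * Real.exp (-b ^ 2 / (16 * t)) /
        (√t ^ i * √((a - c) ^ 2 + (b + d) ^ 2 + t) ^ (n + 1)) := by
  obtain ⟨C₁, hC₁, h₁⟩ := exists_norm_gaussLaplace_le m i n
  obtain ⟨C₂, hC₂, h₂⟩ := exists_exp_mul_sqrt_pow_le (n + 1)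
  refine ⟨C₁ * (3 ^ (n + 1) * C₂) * √(16 * Real.pi), by positivity, fun a b c d t hb hd ht => ?_⟩
  have hτ : 0 < √t := Real.sqrt_pos.2 ht
  set E := Real.exp (-b ^ 2 / (16 * t)) with hE
  set R := √((a - c) ^ 2 + (b + d) ^ 2 + t) with hR
  have hR0 : 0 < R := Real.sqrt_pos.2 (by positivity)
  set K := C₁ * (3 ^ (n + 1) * C₂) * E / (√t ^ (i + 1) * R ^ (n + 1)) with hK
  have hpt : ∀ s ∈ Ioc 0 d, ‖gaussLaplace m i n (b + s) (d - s) (a - c) t‖ ≤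
      K * Real.exp (-(1 / (16 * t)) * s ^ 2) := by
    intro s hs
    have hs0 : 0 < s := hs.1
    refine (h₁ _ _ _ _ (by linarith [hs.2]) ht).trans ?_
    set V := √((d - s) ^ 2 + (a - c) ^ 2 + t) with hV
    set S := √(b ^ 2 + s ^ 2 + t) with hS
    set G := Real.exp (-(b ^ 2 + s ^ 2) / (16 * t)) with hG
    have hV0 : 0 < V := Real.sqrt_pos.2 (by positivity)
    have hS0 : 0 < S := Real.sqrt_pos.2 (by positivity)
    -- As `b, s ≥ 0`, the cross term may be dropped. Of the three resulting factors, `E` is the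
    -- decay in the statement, `G` is spent on comparing distances, and the last makes the
    -- `s`-integral converge.
    have hexp : Real.exp (-(b + s) ^ 2 / (8 * t)) ≤
        E * G * Real.exp (-(1 / (16 * t)) * s ^ 2) := by
      rw [hE, hG, ← Real.exp_add, ← Real.exp_add, Real.exp_le_exp]
      have : -b ^ 2 / (16 * t) + -(b ^ 2 + s ^ 2) / (16 * t) + -(1 / (16 * t)) * s ^ 2 -
          -(b + s) ^ 2 / (8 * t) = 2 * b * s / (8 * t) := by
        field_simp
        ring
      have h0 : 0 ≤ 2 * b * s / (8 * t) := by positivity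
      linarith
    -- From `b + d = (d - s) + (b + s)`, `R²` is at most a multiple of `V² + S²`, and both `V` and
    -- `S` are at least `√t`.
    have hRVS : R * √t ≤ 3 * (V * S) := by
      rw [hR, hV, hS, ← Real.sqrt_mul (by positivity), ← Real.sqrt_mul (by positivity)]
      refine Real.sqrt_le_iff.2 ⟨by positivity, ?_⟩
      rw [mul_pow, Real.sq_sqrt (by positivity)]
      have k1 : (b + d) ^ 2 ≤ 2 * (d - s) ^ 2 + 4 * b ^ 2 + 4 * s ^ 2 := by
        nlinarith [sq_nonneg (b - s), sq_nonneg ((d - s) - (b + s))]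
      have k2 : 0 ≤ ((d - s) ^ 2 + (a - c) ^ 2) * (b ^ 2 + s ^ 2) := by positivity
      nlinarith [mul_le_mul_of_nonneg_right k1 ht.le, sq_nonneg (d - s), sq_nonneg (a - c),
        sq_nonneg b, sq_nonneg s, mul_nonneg (sq_nonneg (d - s)) ht.le,
        mul_nonneg (sq_nonneg (a - c)) ht.le, mul_nonneg (sq_nonneg b) ht.le,
        mul_nonneg (sq_nonneg s) ht.le, mul_pos ht ht]
    have hpow : R ^ (n + 1) * √t ^ (n + 1) ≤ 3 ^ (n + 1) * (V ^ (n + 1) * S ^ (n + 1)) := by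
      rw [← mul_pow, ← mul_pow, ← mul_pow]
      exact pow_le_pow_left₀ (by positivity) hRVS _
    have hGS : G * S ^ (n + 1) ≤ C₂ * √t ^ (n + 1) := h₂ _ t (by positivity) ht
    have hGV : G / V ^ (n + 1) ≤ 3 ^ (n + 1) * C₂ / R ^ (n + 1) := by
      rw [div_le_div_iff₀ (by positivity) (by positivity)]
      refine le_of_mul_le_mul_right ?_ (by positivity : 0 < √t ^ (n + 1))
      calc G * R ^ (n + 1) * √t ^ (n + 1) = G * (R ^ (n + 1) * √t ^ (n + 1)) := by ring
        _ ≤ G * (3 ^ (n + 1) * (V ^ (n + 1) * S ^ (n + 1))) := by gcongr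
        _ = 3 ^ (n + 1) * V ^ (n + 1) * (G * S ^ (n + 1)) := by ring
        _ ≤ 3 ^ (n + 1) * V ^ (n + 1) * (C₂ * √t ^ (n + 1)) := by gcongr
        _ = _ := by ring
    calc C₁ / √t ^ (i + 1) * Real.exp (-(b + s) ^ 2 / (8 * t)) / V ^ (n + 1)
        ≤ C₁ / √t ^ (i + 1) * (E * G * Real.exp (-(1 / (16 * t)) * s ^ 2)) / V ^ (n + 1) := by
          gcongr
      _ = C₁ / √t ^ (i + 1) * E * (G / V ^ (n + 1)) * Real.exp (-(1 / (16 * t)) * s ^ 2) := by ring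
      _ ≤ C₁ / √t ^ (i + 1) * E * (3 ^ (n + 1) * C₂ / R ^ (n + 1)) *
            Real.exp (-(1 / (16 * t)) * s ^ 2) := by gcongr
      _ = _ := by
        rw [hK]
        field_simp
  have hgi : Integrable fun s : ℝ => Real.exp (-(1 / (16 * t)) * s ^ 2) :=
    integrable_exp_neg_mul_sq (by positivity)
  have h5 : ‖stripTerm m i n a b c d t‖ ≤
      ∫ s in (0 : ℝ)..d, K * Real.exp (-(1 / (16 * t)) * s ^ 2) :=
    intervalIntegral.norm_integral_le_of_norm_le hd (Eventually.of_forall hpt)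
      (hgi.const_mul K).intervalIntegrable
  have hK0 : 0 ≤ K := by positivity
  have h6 : ∫ s in (0 : ℝ)..d, K * Real.exp (-(1 / (16 * t)) * s ^ 2) ≤
      K * (√(16 * Real.pi) * √t) := by
    rw [intervalIntegral.integral_const_mul, intervalIntegral.integral_of_le hd]
    gcongr
    refine (setIntegral_le_integral hgi (Eventually.of_forall fun s => (Real.exp_pos _).le)).trans ?_
    rw [integral_gaussian, ← Real.sqrt_mul (by positivity)]
    refine le_of_eq ?_
    congr 1
    field_simp
  refine (h5.trans h6).trans (le_of_eq ?_)
  rw [hK, pow_succ √t i]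
  field_simp

theorem KernelTerm.exists_bound {α β γ : ℕ} {f : ℝ → ℝ → ℝ → ℝ → ℝ → ℂ}
    (hf : KernelTerm α β γ f) : ∃ C : ℝ, 0 < C ∧ ∀ a b c d t : ℝ, 0 < b → 0 < d → 0 < t →
      ‖f a b c d t‖ ≤ C * Real.exp (-b ^ 2 / (16 * t)) /
        (√t ^ α * √(d ^ 2 + t) ^ β * √((a - c) ^ 2 + (b + d) ^ 2 + t) ^ γ) := by
  induction hf with
  | @strip m i n h h' =>
    obtain ⟨C, hC, hb⟩ := exists_norm_stripTerm_le m i n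
    refine ⟨C, hC, fun a b c d t hb0 hd ht => (hb a b c d t hb0.le hd.le ht).trans ?_⟩
    -- `l` is the number of surplus powers of `R`, given away against `√t ≤ R`.
    obtain ⟨l, hl⟩ := Nat.exists_eq_add_of_le h'
    obtain rfl : α = i + l := by omega
    have hτ : 0 < √t := Real.sqrt_pos.2 ht
    set R := √((a - c) ^ 2 + (b + d) ^ 2 + t)
    have hρR : √(d ^ 2 + t) ≤ R := Real.sqrt_le_sqrt (by nlinarith [sq_nonneg (a - c)])
    have hτR : √t ≤ R := Real.sqrt_le_sqrt (by nlinarith [sq_nonneg (a - c), sq_nonneg (b + d)])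
    have hρ : 0 < √(d ^ 2 + t) := Real.sqrt_pos.2 (by positivity)
    rw [hl]
    refine div_le_div_of_nonneg_left (by positivity) (by positivity) ?_
    calc √t ^ (i + l) * √(d ^ 2 + t) ^ β * R ^ γ
        = √t ^ i * (√t ^ l * √(d ^ 2 + t) ^ β * R ^ γ) := by rw [pow_add]; ring
      _ ≤ √t ^ i * (R ^ l * R ^ β * R ^ γ) := by gcongr
      _ = √t ^ i * R ^ (β + γ + l) := by rw [pow_add, pow_add]; ring
  | @edge m i n h h' =>
    obtain ⟨C₁, hC₁, h₁⟩ := exists_norm_gaussLaplace_le m i n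
    obtain ⟨C₂, hC₂, h₂⟩ := exists_exp_mul_sqrt_pow_le (β + γ)
    refine ⟨C₁ * C₂, by positivity, fun a b c d t hb hd ht => (h₁ _ _ _ _ le_rfl ht).trans ?_⟩
    obtain ⟨l, hl⟩ := Nat.exists_eq_add_of_le h'
    have hil : i + 1 + l = α + β := by omega
    have hτ : 0 < √t := Real.sqrt_pos.2 ht
    have hρ : 0 < √(d ^ 2 + t) := Real.sqrt_pos.2 (by positivity)
    set R := √((a - c) ^ 2 + (b + d) ^ 2 + t) with hR
    set U := √((b + d) ^ 2 + t) with hU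
    set A := √(0 ^ 2 + (a - c) ^ 2 + t) with hA
    set E := Real.exp (-b ^ 2 / (16 * t)) with hE
    set G := Real.exp (-(b + d) ^ 2 / (16 * t)) with hG
    have hA0 : 0 < A := Real.sqrt_pos.2 (by positivity)
    have hR0 : 0 < R := Real.sqrt_pos.2 (by positivity)
    have hτA : √t ≤ A := Real.sqrt_le_sqrt (by nlinarith [sq_nonneg (a - c)])
    have hρU : √(d ^ 2 + t) ≤ U := Real.sqrt_le_sqrt (by nlinarith)
    -- The full distance factorises into its tangential part `A`, controlled by `laplaceGauss`, and
    -- its normal part `U`, controlled by the Gaussian.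
    have hRAU : R * √t ≤ A * U := by
      rw [hR, hA, hU, ← Real.sqrt_mul (by positivity), ← Real.sqrt_mul (by positivity)]
      refine Real.sqrt_le_sqrt ?_
      nlinarith [mul_nonneg (sq_nonneg (a - c)) (sq_nonneg (b + d))]
    have hexp : Real.exp (-(b + d) ^ 2 / (8 * t)) ≤ E * G := by
      rw [hE, hG, ← Real.exp_add, Real.exp_le_exp]
      have : -b ^ 2 / (16 * t) + -(b + d) ^ 2 / (16 * t) - -(b + d) ^ 2 / (8 * t) =
          (2 * b * d + d ^ 2) / (16 * t) := by
        field_simp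
        ring
      have h0 : 0 ≤ (2 * b * d + d ^ 2) / (16 * t) := by positivity
      linarith
    -- The Gaussian pays for `γ` powers of `U` from the factorisation and for `β` more, since `√(d²
    -- + t) ≤ U`. Of the `n + 1` powers of `A`, `γ` complete the factorisation and the remaining `l`
    -- go to `√t`.
    have hGU : G * U ^ (β + γ) ≤ C₂ * √t ^ (β + γ) := h₂ _ t (by positivity) ht
    rw [div_le_div_iff₀ (by positivity) (by positivity)]
    refine le_of_mul_le_mul_right ?_ (by positivity : 0 < √t ^ (i + 1 + γ))
    calc C₁ / √t ^ (i + 1) * Real.exp (-(b + d) ^ 2 / (8 * t)) *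
          (√t ^ α * √(d ^ 2 + t) ^ β * R ^ γ) * √t ^ (i + 1 + γ)
        ≤ C₁ / √t ^ (i + 1) * (E * G) * (√t ^ α * U ^ β * R ^ γ) * √t ^ (i + 1 + γ) := by gcongr
      _ = C₁ * E * G * √t ^ α * U ^ β * (R * √t) ^ γ := by
        rw [pow_add, mul_pow]
        field_simp
        ring
      _ ≤ C₁ * E * G * √t ^ α * U ^ β * (A * U) ^ γ := by gcongr
      _ = C₁ * E * √t ^ α * A ^ γ * (G * U ^ (β + γ)) := by rw [mul_pow, pow_add]; ring
      _ ≤ C₁ * E * √t ^ α * A ^ γ * (C₂ * √t ^ (β + γ)) := by gcongr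
      _ = C₁ * C₂ * E * A ^ γ * √t ^ γ * √t ^ (α + β) := by rw [pow_add, pow_add]; ring
      _ = C₁ * C₂ * E * A ^ γ * √t ^ l * √t ^ (i + 1 + γ) := by
        rw [← hil, pow_add, pow_add _ _ γ]; ring
      _ ≤ C₁ * C₂ * E * A ^ γ * A ^ l * √t ^ (i + 1 + γ) := by gcongr
      _ = C₁ * C₂ * E * A ^ (n + 1) * √t ^ (i + 1 + γ) := by rw [hl, pow_add]; ring
  | @gauss m i m' i' h =>
    obtain ⟨C₁, hC₁, h₁⟩ := exists_abs_gaussTerm_le m i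
    obtain ⟨C₂, hC₂, h₂⟩ := exists_abs_gaussTerm_le m' i'
    obtain ⟨C₃, hC₃, h₃⟩ := exists_exp_mul_sqrt_pow_le (β + γ)
    refine ⟨C₁ * C₂ * C₃, by positivity, fun a b c d t hb hd ht => ?_⟩
    have hτ : 0 < √t := Real.sqrt_pos.2 ht
    have hρ : 0 < √(d ^ 2 + t) := Real.sqrt_pos.2 (by positivity)
    have h4 := h₁ (b + d) t ht
    have h5 := h₂ (a - c) t ht
    set R := √((a - c) ^ 2 + (b + d) ^ 2 + t) with hR
    set E := Real.exp (-b ^ 2 / (16 * t)) with hE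
    set G := Real.exp (-((a - c) ^ 2 + (b + d) ^ 2) / (16 * t)) with hG
    have hR0 : 0 < R := Real.sqrt_pos.2 (by positivity)
    have hρR : √(d ^ 2 + t) ≤ R := Real.sqrt_le_sqrt (by nlinarith [sq_nonneg (a - c)])
    have hexp : Real.exp (-(b + d) ^ 2 / (8 * t)) * Real.exp (-(a - c) ^ 2 / (8 * t)) ≤ E * G := by
      rw [hE, hG, ← Real.exp_add, ← Real.exp_add, Real.exp_le_exp]
      have : -b ^ 2 / (16 * t) + -((a - c) ^ 2 + (b + d) ^ 2) / (16 * t) -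
          (-(b + d) ^ 2 / (8 * t) + -(a - c) ^ 2 / (8 * t)) =
          (2 * b * d + d ^ 2 + (a - c) ^ 2) / (16 * t) := by
        field_simp
        ring
      have h0 : 0 ≤ (2 * b * d + d ^ 2 + (a - c) ^ 2) / (16 * t) := by positivity
      linarith
    have hGR : G * R ^ (β + γ) ≤ C₃ * √t ^ (β + γ) := h₃ _ t (by positivity) ht
    rw [Complex.norm_real, Real.norm_eq_abs, abs_mul, le_div_iff₀ (by positivity)]
    calc |gaussTerm m i (b + d) t| * |gaussTerm m' i' (a - c) t| *
          (√t ^ α * √(d ^ 2 + t) ^ β * R ^ γ)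
        ≤ (C₁ / √t ^ (i + 1) * Real.exp (-(b + d) ^ 2 / (8 * t))) *
          (C₂ / √t ^ (i' + 1) * Real.exp (-(a - c) ^ 2 / (8 * t))) *
          (√t ^ α * R ^ β * R ^ γ) := by gcongr
      _ = C₁ * C₂ * (Real.exp (-(b + d) ^ 2 / (8 * t)) * Real.exp (-(a - c) ^ 2 / (8 * t))) *
          √t ^ α * R ^ (β + γ) / (√t ^ (i + 1) * √t ^ (i' + 1)) := by
        rw [pow_add R]
        field_simp
      _ ≤ C₁ * C₂ * (E * G) * √t ^ α * R ^ (β + γ) / (√t ^ (i + 1) * √t ^ (i' + 1)) := by gcongr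
      _ = C₁ * C₂ * E * √t ^ α * (G * R ^ (β + γ)) / (√t ^ (i + 1) * √t ^ (i' + 1)) := by ring
      _ ≤ C₁ * C₂ * E * √t ^ α * (C₃ * √t ^ (β + γ)) / (√t ^ (i + 1) * √t ^ (i' + 1)) := by
        gcongr
      _ = C₁ * C₂ * C₃ * E := by
        rw [← pow_add √t (i + 1), show i + 1 + (i' + 1) = α + (β + γ) by omega, pow_add √t α]
        field_simp
  | add _ _ h1 h2 =>
    obtain ⟨C₁, hC₁, h1⟩ := h1
    obtain ⟨C₂, hC₂, h2⟩ := h2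
    refine ⟨C₁ + C₂, by positivity, fun a b c d t hb hd ht => (norm_add_le _ _).trans ?_⟩
    rw [add_mul, add_div]
    exact add_le_add (h1 a b c d t hb hd ht) (h2 a b c d t hb hd ht)
  | smul z _ h =>
    obtain ⟨C, hC, h⟩ := h
    refine ⟨(‖z‖ + 1) * C, by positivity, fun a b c d t hb hd ht => ?_⟩
    rw [norm_mul, mul_assoc, mul_div_assoc]
    exact mul_le_mul (by linarith) (h a b c d t hb hd ht) (norm_nonneg _) (by positivity)

end KernelBounds

/-! ### Convolution of the heat kernel with Laplace integrals. -/

section KernelRepresentation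

open Filter Topology

theorem heatKernel1_eq_gaussTerm (r t : ℝ) :
    heatKernel1 r t = 1 / √(4 * Real.pi) * gaussTerm 0 0 r t := by
  unfold heatKernel1 gaussTerm
  rw [Real.sqrt_mul (by positivity)]
  field_simp
  simp

theorem heatKernel1_nonneg (r t : ℝ) : 0 ≤ heatKernel1 r t := by
  unfold heatKernel1
  positivity

theorem heatKernel1_neg (r t : ℝ) : heatKernel1 (-r) t = heatKernel1 r t := by
  simp [heatKernel1]

theorem heatKernel_eq_mul (a b : ℝ) {t : ℝ} (ht : 0 < t) :
    heatKernel (a, b) t = heatKernel1 a t * heatKernel1 b t := by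
  unfold heatKernel heatKernel1 normSq
  rw [mul_mul_mul_comm, ← Real.exp_add, div_mul_div_comm, Real.mul_self_sqrt (by positivity)]
  congr 2
  · ring
  · ring

theorem integrable_heatKernel1 (x : ℝ) {t : ℝ} (ht : 0 < t) :
    Integrable fun z : ℝ => heatKernel1 (x - z) t := by
  have h : Integrable fun z : ℝ => heatKernel1 z t := by
    unfold heatKernel1
    refine Integrable.const_mul ?_ _
    convert integrable_exp_neg_mul_sq (b := 1 / (4 * t)) (by positivity) using 3
    ring
  exact h.comp_sub_left x

theorem continuous_heatKernel1 (t : ℝ) : Continuous fun z : ℝ => heatKernel1 z t := by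
  unfold heatKernel1
  fun_prop

/-- The Fourier transform of the one-dimensional heat kernel. -/
theorem integral_heatKernel1_mul_exp (x ξ : ℝ) {t : ℝ} (ht : 0 < t) :
    ∫ z : ℝ, (heatKernel1 (x - z) t : ℂ) * Complex.exp (-(z * ξ) * Complex.I) =
      Complex.exp (-(x * ξ) * Complex.I - t * ξ ^ 2) := by
  have e : ∀ z : ℝ, (heatKernel1 (x - z) t : ℂ) * Complex.exp (-(z * ξ) * Complex.I) =
      (fun u : ℝ => (heatKernel1 u t : ℂ) * Complex.exp (-((x - u) * ξ) * Complex.I)) (x - z) := by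
    intro z
    simp
  simp_rw [e]
  rw [integral_sub_left_eq_self (fun u : ℝ => (heatKernel1 u t : ℂ) *
    Complex.exp (-((x - u) * ξ) * Complex.I)) volume x]
  have hb : 0 < ((1 / (4 * t) : ℝ) : ℂ).re := by
    rw [Complex.ofReal_re]
    positivity
  have hg := fourierIntegral_gaussian hb ξ
  have e2 : ∀ u : ℝ, (heatKernel1 u t : ℂ) * Complex.exp (-((x - u) * ξ) * Complex.I) =
      ((1 / √(4 * Real.pi * t) : ℝ) : ℂ) * Complex.exp (-(x * ξ) * Complex.I) *
        (Complex.exp (Complex.I * ξ * u) *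
          Complex.exp (-((1 / (4 * t) : ℝ) : ℂ) * u ^ 2)) := by
    intro u
    unfold heatKernel1
    push_cast
    rw [mul_assoc (1 / _ : ℂ), mul_assoc (1 / _ : ℂ), ← Complex.exp_add, ← Complex.exp_add,
      ← Complex.exp_add]
    congr 2
    field_simp
    ring
  simp_rw [e2]
  rw [integral_const_mul, hg]
  have e3 : ((Real.pi : ℂ) / ((1 / (4 * t) : ℝ) : ℂ)) ^ (1 / 2 : ℂ) = (√(4 * Real.pi * t) : ℝ) := by
    rw [Real.sqrt_eq_rpow, Complex.ofReal_cpow (by positivity)]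
    push_cast
    congr 1
    field_simp
  have hne : (√(4 * Real.pi * t) : ℂ) ≠ 0 := by
    rw [Complex.ofReal_ne_zero]
    positivity
  have hexp : Complex.exp (-(ξ : ℂ) ^ 2 / (4 * ((1 / (4 * t) : ℝ) : ℂ))) =
      Complex.exp (-(t * ξ ^ 2)) := by
    congr 1
    push_cast
    have : (t : ℂ) ≠ 0 := Complex.ofReal_ne_zero.2 ht.ne'
    field_simp
  rw [e3, hexp, sub_eq_add_neg, Complex.exp_add]
  push_cast
  field_simp

theorem integrableOn_pow_mul_exp_neg (n : ℕ) {s : ℝ} (hs : 0 < s) :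
    IntegrableOn (fun ξ : ℝ => ξ ^ n * Real.exp (-s * ξ)) (Ioi 0) := by
  have := integrableOn_rpow_mul_exp_neg_mul_rpow (p := 1) (s := n) (b := s)
    (by have : (0 : ℝ) ≤ n := n.cast_nonneg
        linarith) zero_lt_one hs
  simpa using this

theorem norm_pow_mul_exp (n : ℕ) (w : ℂ) {ξ : ℝ} (hξ : 0 < ξ) :
    ‖(ξ : ℂ) ^ n * Complex.exp (-w * ξ)‖ = ξ ^ n * Real.exp (-w.re * ξ) := by
  rw [norm_mul, norm_pow, Complex.norm_real, Real.norm_of_nonneg hξ.le, Complex.norm_exp]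
  simp

theorem integrableOn_pow_mul_cexp (n : ℕ) {w : ℂ} (hw : 0 < w.re) :
    IntegrableOn (fun ξ : ℝ => (ξ : ℂ) ^ n * Complex.exp (-w * ξ)) (Ioi 0) := by
  refine Integrable.mono' (integrableOn_pow_mul_exp_neg n hw) (by fun_prop) ?_
  exact (ae_restrict_iff' measurableSet_Ioi).2 (Eventually.of_forall fun ξ hξ =>
    (norm_pow_mul_exp n w hξ).le)

theorem integral_cexp_Ioi {w : ℂ} (hw : 0 < w.re) :
    ∫ ξ in Ioi (0 : ℝ), (ξ : ℂ) ^ 0 * Complex.exp (-w * ξ) = 1 / w := by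
  have := integral_exp_mul_complex_Ioi (a := -w) (by simpa using hw) 0
  simpa using this

theorem integral_mul_cexp_Ioi {w : ℂ} (hw : 0 < w.re) :
    ∫ ξ in Ioi (0 : ℝ), (ξ : ℂ) ^ 1 * Complex.exp (-w * ξ) = 1 / w ^ 2 := by
  have hw0 : w ≠ 0 := by
    rintro rfl
    simp at hw
  have hd : ∀ ξ : ℝ, HasDerivAt (fun ξ : ℝ => (ξ : ℂ) ^ 1 * Complex.exp (-w * ξ))
      ((ξ : ℂ) ^ 0 * Complex.exp (-w * ξ) - w * ((ξ : ℂ) ^ 1 * Complex.exp (-w * ξ))) ξ := by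
    intro ξ
    have h0 : HasDerivAt (fun q : ℝ => (q : ℂ)) 1 ξ := Complex.ofRealCLM.hasDerivAt
    refine ((h0.pow 1).mul (h0.const_mul (-w)).cexp).congr_deriv ?_
    simp
    ring
  have hi0 := integrableOn_pow_mul_cexp 0 hw
  have hi1 := integrableOn_pow_mul_cexp 1 hw
  have hi : IntegrableOn (fun ξ : ℝ => (ξ : ℂ) ^ 0 * Complex.exp (-w * ξ) -
      w * ((ξ : ℂ) ^ 1 * Complex.exp (-w * ξ))) (Ioi 0) := hi0.sub (hi1.const_mul w)
  have hlim := tendsto_zero_of_hasDerivAt_of_integrableOn_Ioi (fun ξ _ => hd ξ) hi hi1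
  have h := integral_Ioi_of_hasDerivAt_of_tendsto (hd 0).continuousAt.continuousWithinAt
    (fun ξ _ => hd ξ) hi hlim
  rw [integral_sub hi0 (hi1.const_mul w), integral_const_mul, integral_cexp_Ioi hw] at h
  simp only [Complex.ofReal_zero, pow_one, zero_mul, sub_zero] at h
  simp only [pow_one]
  field_simp at h ⊢
  linear_combination -h

/-- For `s > 0` the oscillating factors have modulus one, and the product of `heatKernel1` with `ξ ^
n e^{-sξ}` is a majorant; this supplies Fubini on every line strictly below the singularity. -/
theorem integrable_heatKernel1_mul_laplace (n : ℕ) (x y : ℝ) {s t : ℝ} (hs : 0 < s) (ht : 0 < t) :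
    Integrable (Function.uncurry fun (z ξ : ℝ) => (heatKernel1 (x - z) t : ℂ) *
      ((ξ : ℂ) ^ n * Complex.exp (-((s : ℂ) + (z - y : ℝ) * Complex.I) * ξ)))
      (volume.prod (volume.restrict (Ioi 0))) := by
  have h := (integrable_heatKernel1 x ht).mul_prod (integrableOn_pow_mul_exp_neg n hs)
  refine h.mono' ?_ ?_
  · have := continuous_heatKernel1 t
    refine Continuous.aestronglyMeasurable ?_
    simp only [Function.uncurry_def]
    fun_prop
  · have hae : ∀ᵐ p : ℝ × ℝ ∂(volume.prod (volume.restrict (Ioi 0))), 0 < p.2 :=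
      Measure.quasiMeasurePreserving_snd.ae (ae_restrict_mem measurableSet_Ioi)
    filter_upwards [hae] with p hp
    simp only [Function.uncurry_def]
    rw [norm_mul, norm_pow_mul_exp n _ hp, Complex.norm_real,
      Real.norm_of_nonneg (heatKernel1_nonneg _ _)]
    simp

/-- After exchanging the integrals, the `z`-integral is the Fourier transform of a Gaussian centred
at `x`: it contributes `e^{-tξ²}` and replaces `z` by `x` in the phase. -/
theorem integral_heatKernel1_mul_laplace (n : ℕ) (x y : ℝ) {s t : ℝ} (hs : 0 < s) (ht : 0 < t) :
    ∫ z : ℝ, (heatKernel1 (x - z) t : ℂ) * ∫ ξ in Ioi (0 : ℝ),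
        (ξ : ℂ) ^ n * Complex.exp (-((s : ℂ) + (z - y : ℝ) * Complex.I) * ξ) =
      laplaceGauss n ((s : ℂ) + (x - y : ℝ) * Complex.I) t := by
  simp_rw [← integral_const_mul]
  rw [integral_integral_swap (integrable_heatKernel1_mul_laplace n x y hs ht)]
  unfold laplaceGauss
  refine integral_congr_ae (Eventually.of_forall fun ξ => ?_)
  have e : ∀ z : ℝ, (heatKernel1 (x - z) t : ℂ) *
      ((ξ : ℂ) ^ n * Complex.exp (-((s : ℂ) + (z - y : ℝ) * Complex.I) * ξ)) =
      ((ξ : ℂ) ^ n * Complex.exp (-((s : ℂ) - y * Complex.I) * ξ)) *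
        ((heatKernel1 (x - z) t : ℂ) * Complex.exp (-(z * ξ) * Complex.I)) := by
    intro z
    have : Complex.exp (-((s : ℂ) + (z - y : ℝ) * Complex.I) * ξ) =
        Complex.exp (-((s : ℂ) - y * Complex.I) * ξ) * Complex.exp (-(z * ξ) * Complex.I) := by
      rw [← Complex.exp_add]
      congr 1
      push_cast
      ring
    rw [this]
    ring
  simp only [e]
  rw [integral_const_mul, integral_heatKernel1_mul_exp x ξ ht, mul_assoc, ← Complex.exp_add]
  congr 2
  push_cast
  ring

theorem integrable_heatKernel1_mul_laplace_left (n : ℕ) (x y : ℝ) {s t : ℝ} (hs : 0 < s)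
    (ht : 0 < t) :
    Integrable fun z : ℝ => (heatKernel1 (x - z) t : ℂ) * ∫ ξ in Ioi (0 : ℝ),
        (ξ : ℂ) ^ n * Complex.exp (-((s : ℂ) + (z - y : ℝ) * Complex.I) * ξ) := by
  simpa only [Function.uncurry_def, integral_const_mul] using
    (integrable_heatKernel1_mul_laplace n x y hs ht).integral_prod_left

end KernelRepresentation

/-! ### Derivatives of the fundamental solution as real and imaginary parts. -/

section NewtonDerivatives

open Filter Topology

theorem newton_eq (a s : ℝ) : newton (a, s) = -(1 / (4 * Real.pi)) * Real.log (a ^ 2 + s ^ 2) := by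
  unfold newton normSq
  rw [Real.log_sqrt (by positivity)]
  field_simp
  ring

theorem hasDerivAt_newton_fst {a s : ℝ} (h : a ^ 2 + s ^ 2 ≠ 0) :
    HasDerivAt (fun r => newton (r, s)) (-(1 / (2 * Real.pi)) * (a / (a ^ 2 + s ^ 2))) a := by
  simp_rw [newton_eq]
  refine ((((hasDerivAt_pow 2 a).add_const (s ^ 2)).log h).const_mul _).congr_deriv ?_
  field_simp
  ring

theorem hasDerivAt_newton_snd {a s : ℝ} (h : a ^ 2 + s ^ 2 ≠ 0) :
    HasDerivAt (fun r => newton (a, r)) (-(1 / (2 * Real.pi)) * (s / (a ^ 2 + s ^ 2))) s := by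
  simp_rw [newton_eq]
  refine ((((hasDerivAt_pow 2 s).const_add (a ^ 2)).log h).const_mul _).congr_deriv ?_
  field_simp
  ring

theorem partialDeriv_zero_newton {a s : ℝ} (h : a ^ 2 + s ^ 2 ≠ 0) :
    partialDeriv 0 newton (a, s) = -(1 / (2 * Real.pi)) * (a / (a ^ 2 + s ^ 2)) := by
  simpa [partialDeriv] using (hasDerivAt_newton_fst h).deriv

theorem hasDerivAt_conjugate_poisson (a : ℝ) {s : ℝ} (hs : s ≠ 0) :
    HasDerivAt (fun a => a / (a ^ 2 + s ^ 2)) ((s ^ 2 - a ^ 2) / (a ^ 2 + s ^ 2) ^ 2) a := by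
  refine ((hasDerivAt_id a).div ((hasDerivAt_pow 2 a).add_const (s ^ 2))
    (by positivity)).congr_deriv ?_
  simp
  ring

theorem partialDeriv_zero_zero_newton (a : ℝ) {s : ℝ} (hs : s ≠ 0) :
    partialDeriv 0 (partialDeriv 0 newton) (a, s) =
      -(1 / (2 * Real.pi)) * ((s ^ 2 - a ^ 2) / (a ^ 2 + s ^ 2) ^ 2) := by
  have h : (fun r => partialDeriv 0 newton (r, s)) =
      fun r => -(1 / (2 * Real.pi)) * (r / (r ^ 2 + s ^ 2)) :=
    funext fun r => partialDeriv_zero_newton (by positivity)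
  unfold partialDeriv at h ⊢
  simp only [↓reduceIte] at h ⊢
  rw [h]
  exact ((hasDerivAt_conjugate_poisson a hs).const_mul _).deriv

theorem inv_add_mul_I_im (a s : ℝ) :
    (1 / ((s : ℂ) + a * Complex.I)).im = -(a / (a ^ 2 + s ^ 2)) := by
  rw [one_div, Complex.inv_im, Complex.normSq_add_mul_I]
  simp
  ring

theorem inv_sq_add_mul_I_re (a s : ℝ) :
    (1 / ((s : ℂ) + a * Complex.I) ^ 2).re = (s ^ 2 - a ^ 2) / (a ^ 2 + s ^ 2) ^ 2 := by
  rw [one_div, Complex.inv_re, map_pow, Complex.normSq_add_mul_I]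
  simp [sq]
  ring

end NewtonDerivatives

/-! ### `W*` as a kernel term; its relation to the Green matrix and its estimates. -/

section KernelFormulas

open Filter Topology

theorem wTildeIntegrand_eq (x y : ℝ × ℝ) {t z₂ : ℝ} (ht : 0 < t) (hz : z₂ < y.2) (z₁ : ℝ) :
    wTildeIntegrand x y t z₂ z₁ = heatKernel1 (x.2 + z₂) t * (-(1 / (2 * Real.pi))) *
      ((heatKernel1 (x.1 - z₁) t : ℂ) * ∫ ξ in Ioi (0 : ℝ), (ξ : ℂ) ^ 1 *
        Complex.exp (-((y.2 - z₂ : ℝ) + (z₁ - y.1 : ℝ) * Complex.I) * ξ)).re := by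
  have hs : 0 < y.2 - z₂ := by linarith
  rw [integral_mul_cexp_Ioi (by simpa using hs), Complex.re_ofReal_mul, inv_sq_add_mul_I_re]
  have e1 : x - reflect (z₁, z₂) = (x.1 - z₁, x.2 + z₂) := by
    ext <;> simp [reflect]
  have e2 : ((z₁, z₂) - y : ℝ × ℝ) = (z₁ - y.1, z₂ - y.2) := rfl
  unfold wTildeIntegrand
  rw [e1, e2, heatKernel_eq_mul _ _ ht, partialDeriv_zero_zero_newton _ (by linarith)]
  ring

theorem integrable_wTildeIntegrand (x y : ℝ × ℝ) {t z₂ : ℝ} (ht : 0 < t) (hz : z₂ < y.2) :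
    Integrable (wTildeIntegrand x y t z₂) := by
  rw [funext (wTildeIntegrand_eq x y ht hz)]
  exact (integrable_heatKernel1_mul_laplace_left 1 x.1 y.1 (sub_pos.2 hz) ht).re.const_mul _

theorem integral_wTildeIntegrand (x y : ℝ × ℝ) {t z₂ : ℝ} (ht : 0 < t) (hz : z₂ < y.2) :
    ∫ z₁, wTildeIntegrand x y t z₂ z₁ =
      -(1 / (2 * Real.pi)) * (1 / √(4 * Real.pi)) *
        (gaussLaplace 0 0 1 (x.2 + z₂) (y.2 - z₂) (x.1 - y.1) t).re := by
  simp_rw [wTildeIntegrand_eq x y ht hz]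
  have h := integrable_heatKernel1_mul_laplace_left 1 x.1 y.1 (sub_pos.2 hz) ht
  have h2 := integral_re h
  simp only [RCLike.re_to_complex] at h2
  rw [integral_const_mul, h2, integral_heatKernel1_mul_laplace 1 x.1 y.1 (sub_pos.2 hz) ht]
  unfold gaussLaplace
  rw [Complex.re_ofReal_mul, heatKernel1_eq_gaussTerm]
  ring

theorem greenIntegrand_eq (x y : ℝ × ℝ) {t w₂ : ℝ} (ht : 0 < t) (hw : w₂ < y.2) (w₁ : ℝ) :
    greenIntegrand 0 y x t w₂ w₁ = heatKernel1 (x.2 + w₂) t * (-(1 / (2 * Real.pi))) *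
      ((heatKernel1 (x.1 - w₁) t : ℂ) * ∫ ξ in Ioi (0 : ℝ), (ξ : ℂ) ^ 0 *
        Complex.exp (-((y.2 - w₂ : ℝ) + (w₁ - y.1 : ℝ) * Complex.I) * ξ)).im := by
  have hs : 0 < y.2 - w₂ := by linarith
  rw [integral_cexp_Ioi (by simpa using hs), Complex.im_ofReal_mul, inv_add_mul_I_im]
  have e1 : ((w₁, w₂) - reflect x : ℝ × ℝ) = (-(x.1 - w₁), x.2 + w₂) := by
    ext <;> simp [reflect]
    ring
  have e2 : (y - (w₁, w₂) : ℝ × ℝ) = (y.1 - w₁, y.2 - w₂) := rfl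
  unfold greenIntegrand
  rw [e1, e2, heatKernel_eq_mul _ _ ht, partialDeriv_zero_newton (by positivity), heatKernel1_neg,
    ← neg_sub w₁ y.1, neg_sq]
  ring

theorem integrable_greenIntegrand (x y : ℝ × ℝ) {t w₂ : ℝ} (ht : 0 < t) (hw : w₂ < y.2) :
    Integrable (greenIntegrand 0 y x t w₂) := by
  rw [funext (greenIntegrand_eq x y ht hw)]
  exact (integrable_heatKernel1_mul_laplace_left 0 x.1 y.1 (sub_pos.2 hw) ht).im.const_mul _

theorem integral_greenIntegrand (x y : ℝ × ℝ) {t w₂ : ℝ} (ht : 0 < t) (hw : w₂ < y.2) :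
    ∫ w₁, greenIntegrand 0 y x t w₂ w₁ =
      -(1 / (2 * Real.pi)) * (1 / √(4 * Real.pi)) *
        (gaussLaplace 0 0 0 (x.2 + w₂) (y.2 - w₂) (x.1 - y.1) t).im := by
  simp_rw [greenIntegrand_eq x y ht hw]
  have h := integrable_heatKernel1_mul_laplace_left 0 x.1 y.1 (sub_pos.2 hw) ht
  have h2 := integral_im h
  simp only [RCLike.im_to_complex] at h2
  rw [integral_const_mul, h2, integral_heatKernel1_mul_laplace 0 x.1 y.1 (sub_pos.2 hw) ht]
  unfold gaussLaplace
  rw [Complex.im_ofReal_mul, heatKernel1_eq_gaussTerm]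
  ring

/-- The slice `b = s` through the singular point is a null set and is excluded from the first
requirement; on the others the inner integral agrees with a function continuous up to `s`. -/
theorem iteratedIntegrable_of_eq {s : ℝ} (hs : 0 ≤ s) {f : ℝ → ℝ → ℝ} {g : ℝ → ℝ}
    (hf : ∀ b < s, Integrable (f b)) (hg : Continuous g) (h : ∀ b < s, ∫ a, f b a = g b) :
    IteratedIntegrable s f := by
  refine ⟨fun b hb => hf b hb.2, ?_⟩
  refine (hg.intervalIntegrable 0 s).congr_ae ?_
  rw [uIoc_of_le hs]
  have h0 : ∀ᵐ b : ℝ ∂(volume.restrict (Ioc 0 s)), b ≠ s :=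
    ae_restrict_of_ae (Measure.ae_ne volume s)
  filter_upwards [h0, ae_restrict_mem measurableSet_Ioc] with b hb hb2
  exact (h b (lt_of_le_of_ne hb2.2 hb)).symm

theorem intervalIntegral_congr_lt {s : ℝ} (hs : 0 ≤ s) {f g : ℝ → ℝ} (h : ∀ b < s, f b = g b) :
    ∫ b in (0 : ℝ)..s, f b = ∫ b in (0 : ℝ)..s, g b := by
  refine intervalIntegral.integral_congr_ae ?_
  filter_upwards [Measure.ae_ne volume s] with b hb hb2
  rw [uIoc_of_le hs] at hb2
  exact h b (lt_of_le_of_ne hb2.2 hb)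

theorem continuous_gaussLaplace_strip (m i n : ℕ) (x y : ℝ × ℝ) {t : ℝ} (ht : 0 < t) :
    Continuous fun b => gaussLaplace m i n (x.2 + b) (y.2 - b) (x.1 - y.1) t :=
  continuousOn_univ.1 (ContinuousOn.gaussLaplace m i n
    (by fun_prop) (by fun_prop) (by fun_prop) (by fun_prop) fun _ _ => ht)

theorem iteratedIntegrable_wTildeIntegrand (x y : ℝ × ℝ) (hy : 0 ≤ y.2) {t : ℝ} (ht : 0 < t) :
    IteratedIntegrable y.2 (wTildeIntegrand x y t) :=
  iteratedIntegrable_of_eq hy (fun _ hb => integrable_wTildeIntegrand x y ht hb)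
    (continuous_const.mul (Complex.continuous_re.comp (continuous_gaussLaplace_strip 0 0 1 x y ht)))
    (fun _ hb => integral_wTildeIntegrand x y ht hb)

theorem iteratedIntegrable_greenIntegrand (x y : ℝ × ℝ) (hy : 0 ≤ y.2) {t : ℝ} (ht : 0 < t) :
    IteratedIntegrable y.2 (greenIntegrand 0 y x t) :=
  iteratedIntegrable_of_eq hy (fun _ hb => integrable_greenIntegrand x y ht hb)
    (continuous_const.mul (Complex.continuous_im.comp (continuous_gaussLaplace_strip 0 0 0 x y ht)))
    (fun _ hb => integral_greenIntegrand x y ht hb)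

theorem wTilde_eq_stripTerm (x y : ℝ × ℝ) (hy : 0 ≤ y.2) {t : ℝ} (ht : 0 < t) :
    wTilde x y t = -(2 / Real.pi) * (1 / √(4 * Real.pi)) *
      (stripTerm 0 0 1 x.1 x.2 y.1 y.2 t).re := by
  unfold wTilde stripTerm
  rw [intervalIntegral_congr_lt hy fun b hb => integral_wTildeIntegrand x y ht hb,
    intervalIntegral.integral_const_mul]
  have := Complex.reCLM.intervalIntegral_comp_comm (μ := volume)
    ((continuous_gaussLaplace_strip 0 0 1 x y ht).intervalIntegrable 0 y.2)
  simp only [Complex.reCLM_apply] at this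
  rw [this]
  field_simp
  ring

theorem greenPotential_eq_stripTerm (x y : ℝ × ℝ) (hy : 0 ≤ y.2) {t : ℝ} (ht : 0 < t) :
    greenPotential 0 y x t = -(1 / (2 * Real.pi)) * (1 / √(4 * Real.pi)) *
      (stripTerm 0 0 0 x.1 x.2 y.1 y.2 t).im := by
  unfold greenPotential stripTerm
  rw [intervalIntegral_congr_lt hy fun b hb => integral_greenIntegrand x y ht hb,
    intervalIntegral.integral_const_mul]
  have := Complex.imCLM.intervalIntegral_comp_comm (μ := volume)
    ((continuous_gaussLaplace_strip 0 0 0 x y ht).intervalIntegrable 0 y.2)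
  simp only [Complex.imCLM_apply] at this
  rw [this]

/-- The first coordinate of `y` enters the strip integral only through `c`, and differentiation
there yields `i` times the integral with `K₁`; the imaginary part of `i z` is the real part of `z`.
-/
theorem hasDerivAt_greenPotential (x y : ℝ × ℝ) (hy : 0 ≤ y.2) {t : ℝ} (ht : 0 < t) :
    HasDerivAt (fun r : ℝ => greenPotential 0 (r, y.2) x t)
      (-(1 / (2 * Real.pi)) * (1 / √(4 * Real.pi)) *
        (stripTerm 0 0 1 x.1 x.2 y.1 y.2 t).re) y.1 := by
  simp_rw [fun r : ℝ => greenPotential_eq_stripTerm x (r, y.2) hy ht]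
  have h := HasFDerivAt.comp_hasDerivAt (l := Complex.imCLM) y.1 Complex.imCLM.hasFDerivAt
    (hasDerivAt_stripTerm_c 0 0 0 x.1 x.2 y.1 y.2 ht)
  refine (h.const_mul _).congr_deriv ?_
  simp

theorem heatKernel_sub_reflect (x y : ℝ × ℝ) {t : ℝ} (ht : 0 < t) :
    heatKernel (x - reflect y) t = heatKernel1 (x.1 - y.1) t * heatKernel1 (x.2 + y.2) t := by
  have e1 : x - reflect y = (x.1 - y.1, x.2 + y.2) := by
    ext <;> simp [reflect]
  rw [e1, heatKernel_eq_mul _ _ ht]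

theorem wStar_eq_neg_greenStar (x y : ℝ × ℝ) (hy : 0 ≤ y.2) {t : ℝ} (ht : 0 < t) :
    wStar x y t = -greenStar 0 0 y x t := by
  unfold wStar greenStar
  have h1 : partialDeriv 0 (fun x' => greenPotential 0 x' x t) y =
      -(1 / (2 * Real.pi)) * (1 / √(4 * Real.pi)) *
        (stripTerm 0 0 1 x.1 x.2 y.1 y.2 t).re := by
    simpa [partialDeriv] using (hasDerivAt_greenPotential x y hy ht).deriv
  rw [h1, wTilde_eq_stripTerm x y hy ht, heatKernel_sub_reflect x y ht,
    heatKernel_sub_reflect y x ht, ← heatKernel1_neg (x.1 - y.1), neg_sub, add_comm x.2]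
  simp
  field_simp
  ring

/-- The kernel term with real part `W*`. -/
noncomputable def wStarTerm (a b c d t : ℝ) : ℂ :=
  ((1 / (4 * Real.pi) : ℝ) : ℂ) * ((gaussTerm 0 0 (b + d) t * gaussTerm 0 0 (a - c) t : ℝ) : ℂ) +
    ((-(2 / Real.pi) * (1 / √(4 * Real.pi)) : ℝ) : ℂ) * stripTerm 0 0 1 a b c d t

/-- The indices `(0, 0, 2)` encode the decay `(|x - y*|² + t)⁻¹` of `W*` itself, from which all
derivative bounds are counted. -/
theorem kernelTerm_wStarTerm : KernelTerm 0 0 2 wStarTerm :=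
  .add (.smul _ (.gauss (m := 0) (i := 0) (m' := 0) (i' := 0) rfl))
    (.smul _ (.strip (m := 0) (i := 0) (n := 1) rfl le_rfl))

theorem wStar_eq_re (x y : ℝ × ℝ) (hy : 0 ≤ y.2) {t : ℝ} (ht : 0 < t) :
    wStar x y t = (wStarTerm x.1 x.2 y.1 y.2 t).re := by
  unfold wStar wStarTerm
  rw [wTilde_eq_stripTerm x y hy ht, heatKernel_sub_reflect x y ht, Complex.add_re,
    Complex.re_ofReal_mul, Complex.re_ofReal_mul, Complex.ofReal_re, heatKernel1_eq_gaussTerm,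
    heatKernel1_eq_gaussTerm]
  have h : √(4 * Real.pi) * √(4 * Real.pi) = 4 * Real.pi := Real.mul_self_sqrt (by positivity)
  have h2 : 1 / √(4 * Real.pi) * (1 / √(4 * Real.pi)) = 1 / (4 * Real.pi) := by
    rw [div_mul_div_comm, h, one_mul]
  rw [← h2]
  ring

theorem contDiffOn_wStar :
    ContDiffOn ℝ ∞ (fun p : (ℝ × ℝ) × (ℝ × ℝ) × ℝ => wStar p.1 p.2.1 p.2.2)
      (halfPlane ×ˢ (halfPlane ×ˢ Ioi (0 : ℝ))) := by
  have hsub : halfPlane ×ˢ (halfPlane ×ˢ Ioi (0 : ℝ)) ⊆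
      {p : (ℝ × ℝ) × (ℝ × ℝ) × ℝ | 0 < p.2.2} := fun p hp => hp.2.2
  exact (Complex.reCLM.contDiff.comp_contDiffOn (kernelTerm_wStarTerm.contDiffOn.mono hsub)).congr fun p hp =>
    wStar_eq_re p.1 p.2.1 (le_of_lt hp.2.1) hp.2.2

theorem sqrt_pow_eq_rpow {r : ℝ} (hr : 0 ≤ r) (n : ℕ) : √r ^ n = r ^ ((n : ℝ) / 2) := by
  rw [Real.sqrt_eq_rpow, ← Real.rpow_natCast, ← Real.rpow_mul hr]
  congr 1
  ring

theorem exists_abs_mixedDeriv_wStar_le (s k₁ k₂ m₁ m₂ : ℕ) : ∃ C : ℝ, 0 < C ∧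
    ∀ x ∈ halfPlane, ∀ y ∈ halfPlane, ∀ t : ℝ, 0 < t →
      |mixedDeriv s k₁ k₂ m₁ m₂ wStar x y t| ≤
        C * Real.exp (-(1 / 16) * x.2 ^ 2 / t) /
          (t ^ ((s : ℝ) + (k₂ : ℝ) / 2) * (y.2 ^ 2 + t) ^ ((m₂ : ℝ) / 2) *
            (normSq (x - reflect y) + t) ^ (((k₁ : ℝ) + (m₁ : ℝ) + 2) / 2)) := by
  obtain ⟨g, hg, h⟩ := kernelTerm_wStarTerm.exists_mixedDeriv (F := wStar)
    (fun a b c d t hd ht => wStar_eq_re (a, b) (c, d) hd.le ht) s k₁ k₂ m₁ m₂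
  obtain ⟨C, hC, hb⟩ := hg.exists_bound
  refine ⟨C, hC, fun x hx y hy t ht => ?_⟩
  rw [h x y t hy ht]
  refine (Complex.abs_re_le_norm _).trans ((hb x.1 x.2 y.1 y.2 t hx hy ht).trans (le_of_eq ?_))
  rw [sqrt_pow_eq_rpow ht.le, sqrt_pow_eq_rpow (by positivity), sqrt_pow_eq_rpow (by positivity)]
  have e1 : normSq (x - reflect y) = (x.1 - y.1) ^ 2 + (x.2 + y.2) ^ 2 := by
    simp [normSq, reflect]
  have e2 : -x.2 ^ 2 / (16 * t) = -(1 / 16) * x.2 ^ 2 / t := by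
    field_simp
  have e3 : ((0 + (k₂ + 2 * s) : ℕ) : ℝ) / 2 = s + k₂ / 2 := by
    push_cast
    ring
  have e4 : ((2 + (m₁ + k₁) : ℕ) : ℝ) / 2 = (k₁ + m₁ + 2) / 2 := by
    push_cast
    ring
  rw [e1, e2, e3, e4, zero_add]

end KernelFormulas

/-! ### Parabolic scaling. -/

section Scaling

open Filter Topology

theorem laplaceGauss_scaling (n : ℕ) (w : ℂ) (t : ℝ) {l : ℝ} (hl : 0 < l) :
    (l : ℂ) ^ (n + 1) * laplaceGauss n (l * w) (l ^ 2 * t) = laplaceGauss n w t := by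
  have hl0 : (l : ℂ) ≠ 0 := Complex.ofReal_ne_zero.2 hl.ne'
  have h := integral_comp_mul_left_Ioi
    (fun ξ : ℝ => (ξ : ℂ) ^ n * Complex.exp (-w * ξ - t * ξ ^ 2)) 0 hl
  rw [mul_zero] at h
  unfold laplaceGauss
  have e : ∀ ξ : ℝ, (ξ : ℂ) ^ n * Complex.exp (-(l * w) * ξ - (l ^ 2 * t : ℝ) * ξ ^ 2) =
      ((l : ℂ) ^ n)⁻¹ * (((l * ξ : ℝ) : ℂ) ^ n *
        Complex.exp (-w * (l * ξ : ℝ) - t * (l * ξ : ℝ) ^ 2)) := by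
    intro ξ
    push_cast
    rw [mul_pow]
    field_simp
  simp_rw [e]
  rw [integral_const_mul, h, Complex.real_smul]
  generalize (∫ x in Ioi (0 : ℝ), (x : ℂ) ^ n * Complex.exp (-w * x - t * x ^ 2)) = I
  push_cast
  field_simp
  ring

theorem heatKernel1_scaling (r t : ℝ) {l : ℝ} (hl : 0 < l) :
    l * heatKernel1 (l * r) (l ^ 2 * t) = heatKernel1 r t := by
  unfold heatKernel1
  have h : √(4 * Real.pi * (l ^ 2 * t)) = l * √(4 * Real.pi * t) := by
    rw [show 4 * Real.pi * (l ^ 2 * t) = l ^ 2 * (4 * Real.pi * t) by ring,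
      Real.sqrt_mul (by positivity), Real.sqrt_sq hl.le]
  have h2 : -(l * r) ^ 2 / (4 * (l ^ 2 * t)) = -r ^ 2 / (4 * t) := by
    field_simp
  rw [h, h2]
  field_simp

theorem heatKernel_scaling (p : ℝ × ℝ) {t : ℝ} (ht : 0 < t) {l : ℝ} (hl : 0 < l) :
    l ^ 2 * heatKernel (l • p) (l ^ 2 * t) = heatKernel p t := by
  have e : l • p = (l * p.1, l * p.2) := rfl
  rw [e, heatKernel_eq_mul _ _ (by positivity), ← Prod.mk.eta (p := p), heatKernel_eq_mul _ _ ht,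
    ← heatKernel1_scaling p.1 t hl, ← heatKernel1_scaling p.2 t hl]
  ring

theorem gaussTerm_zero_scaling (r t : ℝ) {l : ℝ} (hl : 0 < l) :
    l * gaussTerm 0 0 (l * r) (l ^ 2 * t) = gaussTerm 0 0 r t := by
  have h := heatKernel1_scaling r t hl
  rw [heatKernel1_eq_gaussTerm, heatKernel1_eq_gaussTerm, mul_left_comm] at h
  exact mul_left_cancel₀ (by positivity) h

theorem stripTerm_scaling (a b c d t : ℝ) {l : ℝ} (hl : 0 < l) :
    (l : ℂ) ^ 2 * stripTerm 0 0 1 (l * a) (l * b) (l * c) (l * d) (l ^ 2 * t) =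
      stripTerm 0 0 1 a b c d t := by
  unfold stripTerm
  have h := intervalIntegral.smul_integral_comp_mul_left (a := 0) (b := d)
    (fun s => gaussLaplace 0 0 1 (l * b + s) (l * d - s) (l * a - l * c) (l ^ 2 * t)) l
  rw [mul_zero] at h
  rw [← h, Complex.real_smul, ← mul_assoc, ← intervalIntegral.integral_const_mul]
  refine intervalIntegral.integral_congr fun s _ => ?_
  have e1 := gaussTerm_zero_scaling (b + s) t hl
  have e2 := laplaceGauss_scaling 1 (((d - s : ℝ) : ℂ) + (a - c : ℝ) * Complex.I) t hl
  simp only [gaussLaplace]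
  rw [← e1, ← e2]
  push_cast
  ring_nf

theorem wTr_scaling (x y : ℝ × ℝ) (t : ℝ) {l : ℝ} (hl : 0 < l) :
    l ^ 2 * wTr (l • x) (l • y) (l ^ 2 * t) = wTr x y t := by
  unfold wTr
  simp only [Prod.smul_fst, Prod.smul_snd, smul_eq_mul]
  have h := Measure.integral_comp_mul_left (fun z : ℝ =>
    heatKernel1 (l * x.1 - z) (l ^ 2 * t) * poisson (l * y.2) (z - l * y.1)) l
  rw [abs_of_pos (inv_pos.2 hl), smul_eq_mul] at h
  have e : ∀ z : ℝ, heatKernel1 (x.1 - z) t * poisson y.2 (z - y.1) = l ^ 2 *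
      (heatKernel1 (l * x.1 - l * z) (l ^ 2 * t) * poisson (l * y.2) (l * z - l * y.1)) := by
    intro z
    rw [← heatKernel1_scaling (x.1 - z) t hl]
    have hp : poisson y.2 (z - y.1) = l * poisson (l * y.2) (l * z - l * y.1) := by
      unfold poisson
      -- The denominator vanishes when `y₂ = 0` and `z₁ = y₁`, so only the powers of `l` are
      -- cancelled.
      rw [← mul_sub, mul_pow, mul_pow, ← mul_add, mul_left_comm, mul_div_mul_comm, ← mul_assoc]
      have : l * (l / l ^ 2) = 1 := by
        field_simp
      rw [this, one_mul]
    rw [hp, mul_sub]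
    ring
  simp_rw [e]
  rw [integral_const_mul, h, ← heatKernel1_scaling x.2 t hl]
  field_simp

theorem wKernel_scaling {x y : ℝ × ℝ} (hy : 0 ≤ y.2) {t : ℝ} (ht : 0 < t) {l : ℝ} (hl : 0 < l) :
    wKernel x y t = l ^ 2 * wKernel (l • x) (l • y) (l ^ 2 * t) := by
  have hr : l • x - reflect (l • y) = l • (x - reflect y) := by
    ext <;> simp [reflect] <;> ring
  have hly : 0 ≤ (l • y).2 := by
    simp only [Prod.smul_snd, smul_eq_mul]
    positivity
  unfold wKernel wStar
  rw [hr, ← smul_sub, wTilde_eq_stripTerm x y hy ht, wTilde_eq_stripTerm _ _ hly (by positivity),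
    ← heatKernel_scaling (x - y) ht hl, ← heatKernel_scaling (x - reflect y) ht hl,
    ← wTr_scaling x y t hl, ← stripTerm_scaling x.1 x.2 y.1 y.2 t hl, ← Complex.ofReal_pow,
    Complex.re_ofReal_mul]
  simp only [Prod.smul_fst, Prod.smul_snd, smul_eq_mul]
  ring

end Scaling

/-! ### Integrability of weakly singular kernels against finite measures. -/

section SingularKernels

open Filter Topology
open scoped ENNReal

/-- The function `|r|^{-1/2}`. -/
noncomputable def invSqrtAbs (r : ℝ) : ℝ := 1 / √|r|

theorem invSqrtAbs_nonneg (r : ℝ) : 0 ≤ invSqrtAbs r := by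
  unfold invSqrtAbs
  positivity

theorem measurable_invSqrtAbs : Measurable invSqrtAbs := by
  unfold invSqrtAbs
  fun_prop

theorem integrableOn_invSqrtAbs : IntegrableOn invSqrtAbs (Icc (-1) 1) := by
  have h1 : IntervalIntegrable invSqrtAbs volume 0 1 := by
    refine (intervalIntegral.intervalIntegrable_rpow' (a := 0) (b := 1)
      (by norm_num : (-1 : ℝ) < -(1 / 2))).congr_ae ?_
    rw [uIoc_of_le zero_le_one]
    filter_upwards [ae_restrict_mem measurableSet_Ioc] with r hr
    rw [invSqrtAbs, abs_of_pos hr.1, Real.sqrt_eq_rpow, Real.rpow_neg hr.1.le]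
    exact (one_div _).symm
  have h2 : IntervalIntegrable invSqrtAbs volume (-1) 0 := by
    have := ((IntervalIntegrable.iff_comp_neg).1 h1).symm
    have e : (fun r : ℝ => invSqrtAbs (-r)) = invSqrtAbs := by
      funext r
      simp [invSqrtAbs]
    rwa [e, neg_zero] at this
  have := (h2.trans h1)
  rw [intervalIntegrable_iff_integrableOn_Ioc_of_le (by norm_num)] at this
  exact (integrableOn_Icc_iff_integrableOn_Ioc (by simp)).2 this

/-- Nonnegative bounded integrable functions of one variable. -/
structure TestWeight (G : ℝ → ℝ) : Prop where
  measurable : Measurable G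
  nonneg : ∀ r, 0 ≤ G r
  bounded : ∃ B, ∀ r, G r ≤ B
  integrable : Integrable G

/-- Within distance one of `y` the weight is bounded and `invSqrtAbs` integrable; farther away
`invSqrtAbs ≤ 1` and the weight is integrable. Translation invariance makes the bound uniform in
`y`. -/
theorem TestWeight.exists_lintegral_le {G : ℝ → ℝ} (hG : TestWeight G) : ∃ C : ℝ≥0∞, C ≠ ⊤ ∧
    ∀ y, ∫⁻ r, ENNReal.ofReal (G r) * ENNReal.ofReal (invSqrtAbs (r - y)) ≤ C := by
  obtain ⟨B, hB⟩ := hG.bounded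
  set F : ℝ → ℝ≥0∞ := (Icc (-1) 1).indicator fun u => ENNReal.ofReal (invSqrtAbs u) with hF
  have hFm : Measurable F := (measurable_invSqrtAbs.ennreal_ofReal).indicator measurableSet_Icc
  have hFi : ∫⁻ u, F u ≠ ⊤ := by
    rw [hF, lintegral_indicator measurableSet_Icc]
    exact integrableOn_invSqrtAbs.lintegral_lt_top.ne
  refine ⟨(ENNReal.ofReal B * ∫⁻ u, F u) + ∫⁻ r, ENNReal.ofReal (G r),
    ENNReal.add_ne_top.2 ⟨ENNReal.mul_ne_top ENNReal.ofReal_ne_top hFi,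
      hG.integrable.lintegral_lt_top.ne⟩, fun y => ?_⟩
  calc ∫⁻ r, ENNReal.ofReal (G r) * ENNReal.ofReal (invSqrtAbs (r - y))
      ≤ ∫⁻ r, (ENNReal.ofReal B * F (r - y) + ENNReal.ofReal (G r)) := by
        refine lintegral_mono fun r => ?_
        by_cases hr : r - y ∈ Icc (-1 : ℝ) 1
        · simp only [hF, indicator_of_mem hr]
          exact le_add_right (mul_le_mul_left (ENNReal.ofReal_le_ofReal (hB r)) _)
        · refine le_add_left ?_
          have h1 : 1 ≤ √|r - y| := by
            rw [Real.one_le_sqrt]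
            by_contra! h
            exact hr (abs_le.1 h.le)
          have h2 : invSqrtAbs (r - y) ≤ 1 := by
            rw [invSqrtAbs, div_le_one (by linarith)]
            exact h1
          calc ENNReal.ofReal (G r) * ENNReal.ofReal (invSqrtAbs (r - y))
              ≤ ENNReal.ofReal (G r) * 1 := by
                gcongr
                exact ENNReal.ofReal_le_one.2 h2
            _ = _ := mul_one _
    _ = (ENNReal.ofReal B * ∫⁻ u, F u) + ∫⁻ r, ENNReal.ofReal (G r) := by
        rw [lintegral_add_right _ hG.measurable.ennreal_ofReal,
          lintegral_const_mul _ (f := fun r => F (r - y)) (hFm.comp (measurable_id.sub_const y)),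
          lintegral_sub_right_eq_self (fun u => F u) y]

theorem testWeight_gauss : TestWeight fun r => Real.exp (-r ^ 2) where
  measurable := by fun_prop
  nonneg r := (Real.exp_pos _).le
  bounded := ⟨1, fun r => Real.exp_le_one_iff.2 (by nlinarith [sq_nonneg r])⟩
  integrable := by simpa using integrable_exp_neg_mul_sq (b := 1) one_pos

theorem TestWeight.of_le {G G' : ℝ → ℝ} (hG : TestWeight G) (hm : Measurable G')
    (h0 : ∀ r, 0 ≤ G' r) {C : ℝ} (h : ∀ r, G' r ≤ C * G r) : TestWeight G' where
  measurable := hm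
  nonneg := h0
  bounded := by
    obtain ⟨B, hB⟩ := hG.bounded
    refine ⟨|C| * B, fun r => (h r).trans ?_⟩
    have := hG.nonneg r
    exact (mul_le_mul_of_nonneg_right (le_abs_self C) this).trans
      (mul_le_mul_of_nonneg_left (hB r) (abs_nonneg C))
  integrable := (hG.integrable.const_mul C).mono' hm.aestronglyMeasurable
    (Eventually.of_forall fun r => by rw [Real.norm_of_nonneg (h0 r)]; exact h r)

/-- The kernel `|z₁ - y₁|^{-1/2} |z₂ - y₂|^{-1/2}`. -/
noncomputable def sqrtKernel (z y : ℝ × ℝ) : ℝ := invSqrtAbs (z.1 - y.1) * invSqrtAbs (z.2 - y.2)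

theorem sqrtKernel_nonneg (z y : ℝ × ℝ) : 0 ≤ sqrtKernel z y :=
  mul_nonneg (invSqrtAbs_nonneg _) (invSqrtAbs_nonneg _)

variable (ν : Measure closedHalfPlane) [IsFiniteMeasure ν]

/-- For fixed `y` the plane integral splits into two one-dimensional ones, bounded independently of
`y`; a finite measure in `y` then costs nothing. -/
theorem integrable_weight_mul_sqrtKernel {G₁ G₂ : ℝ → ℝ} (h₁ : TestWeight G₁) (h₂ : TestWeight G₂) :
    Integrable (fun p : (ℝ × ℝ) × closedHalfPlane =>
      G₁ p.1.1 * G₂ p.1.2 * sqrtKernel p.1 (p.2 : ℝ × ℝ)) (volume.prod ν) := by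
  have hm₁ := h₁.measurable
  have hm₂ := h₂.measurable
  have hk := measurable_invSqrtAbs
  have hm : Measurable fun p : (ℝ × ℝ) × closedHalfPlane =>
      G₁ p.1.1 * G₂ p.1.2 * sqrtKernel p.1 (p.2 : ℝ × ℝ) := by
    unfold sqrtKernel
    fun_prop
  refine ⟨hm.aestronglyMeasurable, ?_⟩
  obtain ⟨C₁, hC₁, hb₁⟩ := h₁.exists_lintegral_le
  obtain ⟨C₂, hC₂, hb₂⟩ := h₂.exists_lintegral_le
  rw [hasFiniteIntegral_iff_enorm, lintegral_prod_symm _ hm.enorm.aemeasurable]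
  refine lt_of_le_of_lt (lintegral_mono (g := fun _ => C₁ * C₂) fun y => ?_) ?_
  · calc ∫⁻ z : ℝ × ℝ, ‖G₁ z.1 * G₂ z.2 * sqrtKernel z (y : ℝ × ℝ)‖ₑ
        = ∫⁻ z : ℝ × ℝ, (ENNReal.ofReal (G₁ z.1) * ENNReal.ofReal (invSqrtAbs (z.1 - y.1.1))) *
            (ENNReal.ofReal (G₂ z.2) * ENNReal.ofReal (invSqrtAbs (z.2 - y.1.2))) := by
          refine lintegral_congr fun z => ?_
          have n1 := h₁.nonneg z.1
          have n2 := h₂.nonneg z.2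
          have n3 := invSqrtAbs_nonneg (z.1 - y.1.1)
          have n4 := invSqrtAbs_nonneg (z.2 - y.1.2)
          unfold sqrtKernel
          rw [Real.enorm_of_nonneg (by positivity), mul_mul_mul_comm,
            ENNReal.ofReal_mul (by positivity), ENNReal.ofReal_mul n1, ENNReal.ofReal_mul n2]
      _ = (∫⁻ r, ENNReal.ofReal (G₁ r) * ENNReal.ofReal (invSqrtAbs (r - y.1.1))) *
            ∫⁻ r, ENNReal.ofReal (G₂ r) * ENNReal.ofReal (invSqrtAbs (r - y.1.2)) := by
          rw [Measure.volume_eq_prod]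
          have hm (G : ℝ → ℝ) (hG : Measurable G) (c : ℝ) : AEMeasurable (fun r =>
              ENNReal.ofReal (G r) * ENNReal.ofReal (invSqrtAbs (r - c))) volume := by
            fun_prop
          exact lintegral_prod_mul (hm G₁ hm₁ _) (hm G₂ hm₂ _)
      _ ≤ C₁ * C₂ := mul_le_mul' (hb₁ _) (hb₂ _)
  · rw [lintegral_const]
    exact ENNReal.mul_lt_top (ENNReal.mul_lt_top hC₁.lt_top hC₂.lt_top) (measure_lt_top ν univ)

/-- Almost every line parallel to the boundary avoids `ν`, and `|b - y₂|^{-1/2}` is integrable. -/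
theorem ae_ne_and_integrable_invSqrtAbs :
    ∀ᵐ b : ℝ, (∀ᵐ y : closedHalfPlane ∂ν, b ≠ (y : ℝ × ℝ).2) ∧
      Integrable (fun y : closedHalfPlane => invSqrtAbs (b - (y : ℝ × ℝ).2)) ν := by
  have hm : MeasurableSet {p : ℝ × closedHalfPlane | p.1 ≠ (p.2 : ℝ × ℝ).2} :=
    (measurableSet_eq_fun (by fun_prop) (by fun_prop)).compl
  have h1 : ∀ᵐ b : ℝ, ∀ᵐ y : closedHalfPlane ∂ν, b ≠ (y : ℝ × ℝ).2 :=
    (Measure.ae_ae_comm (μ := volume) (ν := ν) hm).2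
      (Eventually.of_forall fun y => Measure.ae_ne volume _)
  have hk := measurable_invSqrtAbs
  have hi : Integrable (fun p : ℝ × closedHalfPlane =>
      Real.exp (-p.1 ^ 2) * invSqrtAbs (p.1 - (p.2 : ℝ × ℝ).2)) (volume.prod ν) := by
    refine ⟨by fun_prop, ?_⟩
    obtain ⟨C, hC, hb⟩ := testWeight_gauss.exists_lintegral_le
    rw [hasFiniteIntegral_iff_enorm, lintegral_prod_symm _ (by fun_prop)]
    refine lt_of_le_of_lt (lintegral_mono (g := fun _ => C) fun y => ?_) ?_
    · refine le_trans (le_of_eq (lintegral_congr fun r => ?_)) (hb (y : ℝ × ℝ).2)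
      rw [Real.enorm_of_nonneg (mul_nonneg (Real.exp_pos _).le (invSqrtAbs_nonneg _)),
        ENNReal.ofReal_mul (Real.exp_pos _).le]
    · rw [lintegral_const]
      exact ENNReal.mul_lt_top hC.lt_top (measure_lt_top ν univ)
  filter_upwards [h1, hi.prod_right_ae] with b hb1 hb2
  refine ⟨hb1, ?_⟩
  have := hb2.const_mul (Real.exp (-b ^ 2))⁻¹
  refine this.congr (Eventually.of_forall fun y => ?_)
  have := (Real.exp_pos (-b ^ 2)).ne'
  field_simp

/-- Kernels on the half plane with a singularity controlled by `sqrtKernel`. -/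
structure SingularKernel (k : ℝ × ℝ → ℝ × ℝ → ℝ) : Prop where
  measurable : Measurable fun p : (ℝ × ℝ) × (ℝ × ℝ) => k p.1 p.2
  bound : ∀ z y : ℝ × ℝ, 0 < z.2 → 0 ≤ y.2 → z.1 ≠ y.1 → z.2 ≠ y.2 →
    |k z y| ≤ (2 + z.2) * sqrtKernel z y

theorem measurableSet_halfPlane : MeasurableSet halfPlane :=
  measurableSet_lt measurable_const measurable_snd

theorem isOpen_halfPlane : IsOpen halfPlane := isOpen_lt continuous_const continuous_snd

theorem volume_restrict_halfPlane :
    (volume.restrict halfPlane : Measure (ℝ × ℝ)) = volume.prod (volume.restrict (Ioi 0)) := by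
  have : halfPlane = univ ×ˢ Ioi (0 : ℝ) := by
    ext z
    simp [halfPlane]
  rw [this, Measure.volume_eq_prod, ← Measure.prod_restrict, Measure.restrict_univ]

/-- For each fixed `y` the exceptional points form two lines, a Lebesgue null set. The order of the
quantifiers matters, since `ν` may charge points and lines. -/
theorem ae_fst_ne_and_snd_ne : ∀ᵐ p : (ℝ × ℝ) × closedHalfPlane
    ∂((volume.restrict halfPlane).prod ν),
      0 < p.1.2 ∧ p.1.1 ≠ (p.2 : ℝ × ℝ).1 ∧ p.1.2 ≠ (p.2 : ℝ × ℝ).2 := by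
  have hpos : ∀ᵐ z : ℝ × ℝ ∂(volume.restrict halfPlane), 0 < z.2 :=
    ae_restrict_mem measurableSet_halfPlane
  have h0 : ∀ᵐ p : (ℝ × ℝ) × closedHalfPlane ∂((volume.restrict halfPlane).prod ν), 0 < p.1.2 :=
    Measure.quasiMeasurePreserving_fst.ae hpos
  have hm : MeasurableSet {p : (ℝ × ℝ) × closedHalfPlane |
      p.1.1 ≠ (p.2 : ℝ × ℝ).1 ∧ p.1.2 ≠ (p.2 : ℝ × ℝ).2} :=
    (measurableSet_eq_fun (by fun_prop) (by fun_prop)).compl.inter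
      (measurableSet_eq_fun (by fun_prop) (by fun_prop)).compl
  have h1 : ∀ᵐ p : (ℝ × ℝ) × closedHalfPlane ∂((volume.restrict halfPlane).prod ν),
      p.1.1 ≠ (p.2 : ℝ × ℝ).1 ∧ p.1.2 ≠ (p.2 : ℝ × ℝ).2 := by
    refine (Measure.ae_prod_iff_ae_ae hm).2 ?_
    refine (Measure.ae_ae_comm hm).2 (Eventually.of_forall fun y => ?_)
    refine ae_restrict_of_ae ?_
    rw [Measure.volume_eq_prod]
    have a1 : ∀ᵐ z : ℝ × ℝ ∂(volume.prod volume), z.1 ≠ (y : ℝ × ℝ).1 :=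
      Measure.quasiMeasurePreserving_fst.ae (Measure.ae_ne volume _)
    have a2 : ∀ᵐ z : ℝ × ℝ ∂(volume.prod volume), z.2 ≠ (y : ℝ × ℝ).2 :=
      Measure.quasiMeasurePreserving_snd.ae (Measure.ae_ne volume _)
    filter_upwards [a1, a2] with z hz1 hz2 using ⟨hz1, hz2⟩
  filter_upwards [h0, h1] with p hp0 hp1 using ⟨hp0, hp1⟩

/-- Weights on the half plane for which singular kernels are integrable. -/
structure PlaneWeight (w : ℝ × ℝ → ℝ) : Prop where
  measurable : Measurable w
  bound : ∃ G₁ G₂ : ℝ → ℝ, TestWeight G₁ ∧ TestWeight G₂ ∧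
    ∀ z : ℝ × ℝ, 0 < z.2 → |w z| * (2 + z.2) ≤ G₁ z.1 * G₂ z.2

variable {ν} {k : ℝ × ℝ → ℝ × ℝ → ℝ} {w : ℝ × ℝ → ℝ} {σ : closedHalfPlane → ℝ}

theorem SingularKernel.integrable_prod (hk : SingularKernel k) (hw : PlaneWeight w)
    (hσ : Measurable σ) (hσ1 : ∀ y, |σ y| ≤ 1) :
    Integrable (fun p : (ℝ × ℝ) × closedHalfPlane => w p.1 * (k p.1 (p.2 : ℝ × ℝ) * σ p.2))
      ((volume.restrict halfPlane).prod ν) := by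
  obtain ⟨G₁, G₂, h₁, h₂, hb⟩ := hw.bound
  have hi : Integrable (fun p : (ℝ × ℝ) × closedHalfPlane =>
      G₁ p.1.1 * G₂ p.1.2 * sqrtKernel p.1 (p.2 : ℝ × ℝ)) ((volume.restrict halfPlane).prod ν) :=
    (integrable_weight_mul_sqrtKernel ν h₁ h₂).mono_measure
      (Measure.prod_mono Measure.restrict_le_self le_rfl)
  have hkm := hk.measurable
  have hwm := hw.measurable
  refine hi.mono' ?_ ?_
  · have : Measurable fun p : (ℝ × ℝ) × closedHalfPlane => k p.1 (p.2 : ℝ × ℝ) :=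
      hkm.comp (measurable_fst.prodMk (measurable_subtype_coe.comp measurable_snd))
    exact (by fun_prop : Measurable fun p : (ℝ × ℝ) × closedHalfPlane =>
      w p.1 * (k p.1 (p.2 : ℝ × ℝ) * σ p.2)).aestronglyMeasurable
  · filter_upwards [ae_fst_ne_and_snd_ne ν] with p hp
    rw [norm_mul, norm_mul, Real.norm_eq_abs, Real.norm_eq_abs, Real.norm_eq_abs]
    have hy : 0 ≤ (p.2 : ℝ × ℝ).2 := p.2.2
    have k1 := hk.bound p.1 p.2 hp.1 hy hp.2.1 hp.2.2
    have k2 := sqrtKernel_nonneg p.1 p.2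
    calc |w p.1| * (|k p.1 p.2| * |σ p.2|)
        ≤ |w p.1| * ((2 + p.1.2) * sqrtKernel p.1 p.2 * 1) := by
          have := (abs_nonneg _).trans k1
          have := hσ1 p.2
          gcongr
      _ = |w p.1| * (2 + p.1.2) * sqrtKernel p.1 p.2 := by ring
      _ ≤ _ := by
        exact mul_le_mul_of_nonneg_right (hb p.1 hp.1) k2

variable (ν) (σ) in
/-- The integral `∫ k(z,y) σ(y) ν(dy)`. -/
noncomputable def kernelPotential (k : ℝ × ℝ → ℝ × ℝ → ℝ) (z : ℝ × ℝ) : ℝ :=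
  ∫ y : closedHalfPlane, k z (y : ℝ × ℝ) * σ y ∂ν

theorem SingularKernel.integrable_weight_mul (hk : SingularKernel k) (hw : PlaneWeight w)
    (hσ : Measurable σ) (hσ1 : ∀ y, |σ y| ≤ 1) :
    IntegrableOn (fun z => w z * kernelPotential ν σ k z) halfPlane := by
  have h := (hk.integrable_prod (ν := ν) hw hσ hσ1).integral_prod_left
  simp only [integral_const_mul] at h
  exact h

theorem SingularKernel.integral_weight_mul (hk : SingularKernel k) (hw : PlaneWeight w)
    (hσ : Measurable σ) (hσ1 : ∀ y, |σ y| ≤ 1) :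
    ∫ z in halfPlane, w z * kernelPotential ν σ k z =
      ∫ y : closedHalfPlane, (∫ z in halfPlane, w z * k z (y : ℝ × ℝ)) * σ y ∂ν := by
  have h := integral_integral_swap (f := fun (z : ℝ × ℝ) (y : closedHalfPlane) =>
    w z * (k z (y : ℝ × ℝ) * σ y)) (hk.integrable_prod (ν := ν) hw hσ hσ1)
  simp only [integral_const_mul] at h
  unfold kernelPotential
  rw [h]
  congr 1
  funext y
  rw [← integral_mul_const]
  congr 1
  funext z
  ring

theorem planeWeight_gauss :
    PlaneWeight fun z : ℝ × ℝ => Real.exp (-z.1 ^ 2) * Real.exp (-z.2 ^ 2) where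
  measurable := by fun_prop
  bound := by
    obtain ⟨C, hC, h⟩ := exists_abs_pow_mul_exp_le 1 (by norm_num : (0 : ℝ) < 1 / 2)
    have hg : TestWeight fun r : ℝ => (2 + |r|) * Real.exp (-r ^ 2) := by
      have hhalf : TestWeight fun r : ℝ => Real.exp (-(1 / 2) * r ^ 2) :=
        ⟨by fun_prop, fun r => (Real.exp_pos _).le,
          ⟨1, fun r => Real.exp_le_one_iff.2 (by nlinarith [sq_nonneg r])⟩,
          integrable_exp_neg_mul_sq (by norm_num)⟩
      refine hhalf.of_le (C := 2 + C) (by fun_prop) (fun r => by positivity) fun r => ?_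
      have e : Real.exp (-r ^ 2) = Real.exp (-(1 / 2) * r ^ 2) * Real.exp (-(1 / 2) * r ^ 2) := by
        rw [← Real.exp_add]
        congr 1
        ring
      have h1 := h r
      have h2 : Real.exp (-(1 / 2) * r ^ 2) ≤ 1 :=
        Real.exp_le_one_iff.2 (by nlinarith [sq_nonneg r])
      rw [e, ← mul_assoc]
      gcongr
      rw [pow_one] at h1
      nlinarith
    refine ⟨_, _, testWeight_gauss, hg, fun z hz => ?_⟩
    rw [abs_of_pos (by positivity), abs_of_pos hz]
    exact le_of_eq (by ring)

theorem PlaneWeight.of_le (hw : PlaneWeight w) {w' : ℝ × ℝ → ℝ} (hm : Measurable w') {C : ℝ}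
    (h : ∀ z : ℝ × ℝ, 0 < z.2 → |w' z| ≤ C * |w z|) : PlaneWeight w' where
  measurable := hm
  bound := by
    obtain ⟨G₁, G₂, h₁, h₂, hb⟩ := hw.bound
    refine ⟨fun r => |C| * G₁ r, G₂, h₁.of_le (C := |C|) (h₁.measurable.const_mul _)
      (fun r => mul_nonneg (abs_nonneg _) (h₁.nonneg r)) fun r => le_rfl, h₂, fun z hz => ?_⟩
    have hz' : 0 ≤ 2 + z.2 := by linarith
    calc |w' z| * (2 + z.2) ≤ (C * |w z|) * (2 + z.2) :=
          mul_le_mul_of_nonneg_right (h z hz) hz'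
      _ ≤ (|C| * |w z|) * (2 + z.2) := by
          gcongr
          exact le_abs_self C
      _ = |C| * (|w z| * (2 + z.2)) := by ring
      _ ≤ |C| * (G₁ z.1 * G₂ z.2) := mul_le_mul_of_nonneg_left (hb z hz) (abs_nonneg C)
      _ = _ := by ring

theorem planeWeight_of_hasCompactSupport (hwc : Continuous w) (hws : HasCompactSupport w) :
    PlaneWeight w := by
  have h1 : HasCompactSupport fun z : ℝ × ℝ => w z * Real.exp (z.1 ^ 2 + z.2 ^ 2) := hws.mul_right
  obtain ⟨C, hC⟩ := h1.exists_bound_of_continuous (by fun_prop)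
  refine planeWeight_gauss.of_le hwc.measurable (C := C) fun z _ => ?_
  have h2 := hC z
  rw [norm_mul, Real.norm_eq_abs, Real.norm_of_nonneg (Real.exp_pos _).le] at h2
  rw [abs_of_pos (a := Real.exp (-z.1 ^ 2) * Real.exp (-z.2 ^ 2)) (by positivity),
    ← Real.exp_add, ← neg_add, Real.exp_neg, ← div_eq_mul_inv,
    le_div_iff₀ (Real.exp_pos _)]
  exact h2

/-- Integrability holds against a positive Gaussian weight, which is then removed by multiplication
with its continuous inverse. -/
theorem SingularKernel.locallyIntegrableOn (hk : SingularKernel k)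
    (hσ : Measurable σ) (hσ1 : ∀ y, |σ y| ≤ 1) :
    LocallyIntegrableOn (kernelPotential ν σ k) halfPlane := by
  have h := (hk.integrable_weight_mul (ν := ν) planeWeight_gauss hσ hσ1).locallyIntegrableOn
  have hc : ContinuousOn (fun z : ℝ × ℝ => Real.exp (z.1 ^ 2 + z.2 ^ 2)) halfPlane := by fun_prop
  refine (h.continuousOn_mul hc isOpen_halfPlane.isLocallyClosed).congr ?_
  refine Eventually.of_forall fun z => ?_
  simp only [← Real.exp_add, ← mul_assoc]
  ring_nf
  simp

theorem SingularKernel.ae_integrable (hk : SingularKernel k) :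
    ∀ᵐ z ∂(volume.restrict halfPlane), Integrable (fun y : closedHalfPlane => k z (y : ℝ × ℝ)) ν := by
  have h := (hk.integrable_prod (ν := ν) (σ := fun _ => 1) planeWeight_gauss (by fun_prop)
    (by simp)).prod_right_ae
  filter_upwards [h] with z hz
  have := hz.const_mul (Real.exp (-z.1 ^ 2) * Real.exp (-z.2 ^ 2))⁻¹
  refine this.congr (Eventually.of_forall fun y => ?_)
  have h1 := (Real.exp_pos (-z.1 ^ 2)).ne'
  have h2 := (Real.exp_pos (-z.2 ^ 2)).ne'
  field_simp

end SingularKernels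

/-! ### The Green function, its gradient and the kernel of the nonlocal operator. -/

section GreenKernels

open Filter Topology

/-- The conjugate Poisson kernel. -/
noncomputable def conjPoisson (s r : ℝ) : ℝ := r / (Real.pi * (r ^ 2 + s ^ 2))

/-- With `α = √|r|` and `β = √|s|` this is `α β³ ≤ α⁴ + β⁴`. -/
theorem abs_div_sq_add_sq_le {r s : ℝ} (hr : r ≠ 0) (hs : s ≠ 0) :
    |s| / (r ^ 2 + s ^ 2) ≤ invSqrtAbs r * invSqrtAbs s := by
  obtain ⟨α, hα⟩ : ∃ α, α = √|r| := ⟨_, rfl⟩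
  obtain ⟨β, hβ⟩ : ∃ β, β = √|s| := ⟨_, rfl⟩
  have hα0 : 0 < α := hα ▸ Real.sqrt_pos.2 (abs_pos.2 hr)
  have hβ0 : 0 < β := hβ ▸ Real.sqrt_pos.2 (abs_pos.2 hs)
  have hr2 : α ^ 2 = |r| := hα ▸ Real.sq_sqrt (abs_nonneg r)
  have hs2 : β ^ 2 = |s| := hβ ▸ Real.sq_sqrt (abs_nonneg s)
  unfold invSqrtAbs
  rw [← sq_abs r, ← sq_abs s, ← hα, ← hβ, ← hr2, ← hs2, div_mul_div_comm,
    div_le_div_iff₀ (by positivity) (by positivity)]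
  have : 0 ≤ (α - β) ^ 2 * (α ^ 2 + α * β + β ^ 2) := by positivity
  have h3 : 0 ≤ α ^ 3 * β := by positivity
  have h4 : 0 ≤ α ^ 4 := by positivity
  rcases le_total α β with h | h
  · have : β ^ 3 * α ≤ β ^ 3 * β := by gcongr
    nlinarith
  · have h5 : β ^ 3 ≤ α ^ 3 := by gcongr
    have : β ^ 3 * α ≤ α ^ 3 * α := by gcongr
    have h6 : 0 ≤ β ^ 4 := by positivity
    nlinarith

theorem abs_poisson_le {r s : ℝ} (hr : r ≠ 0) (hs : s ≠ 0) :
    |poisson s r| ≤ invSqrtAbs r * invSqrtAbs s := by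
  refine le_trans ?_ (abs_div_sq_add_sq_le hr hs)
  have : 0 < r ^ 2 + s ^ 2 := by positivity
  rw [poisson, abs_div, abs_of_pos (a := Real.pi * _) (by positivity)]
  gcongr
  nlinarith [Real.pi_gt_three]

theorem abs_conjPoisson_le {r s : ℝ} (hr : r ≠ 0) (hs : s ≠ 0) :
    |conjPoisson s r| ≤ invSqrtAbs r * invSqrtAbs s := by
  rw [mul_comm]
  refine le_trans ?_ (abs_div_sq_add_sq_le hs hr)
  have : 0 < r ^ 2 + s ^ 2 := by positivity
  rw [conjPoisson, abs_div, abs_of_pos (a := Real.pi * _) (by positivity), add_comm (s ^ 2)]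
  gcongr
  nlinarith [Real.pi_gt_three]

/-- The image point is at least as far away as the original one, so image terms satisfy the same
bounds. -/
theorem invSqrtAbs_add_le {z b : ℝ} (hz : 0 < z) (hb : 0 ≤ b) (h : z ≠ b) :
    invSqrtAbs (z + b) ≤ invSqrtAbs (z - b) := by
  have h1 : 0 < |z - b| := abs_pos.2 (sub_ne_zero.2 h)
  have h2 : |z - b| ≤ |z + b| := by
    rw [abs_of_nonneg (a := z + b) (by linarith)]
    exact abs_le.2 ⟨by linarith, by linarith⟩
  unfold invSqrtAbs
  gcongr

theorem conjPoisson_neg (s r : ℝ) : conjPoisson (-s) r = conjPoisson s r := by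
  simp [conjPoisson]

theorem poisson_neg (s r : ℝ) : poisson (-s) r = -poisson s r := by
  simp [poisson, neg_div]

/-- The derivative of the Green function in the tangential direction. -/
noncomputable def greenFst (z y : ℝ × ℝ) : ℝ :=
  -(1 / 2) * (conjPoisson (z.2 - y.2) (z.1 - y.1) - conjPoisson (z.2 + y.2) (z.1 - y.1))

/-- The derivative of the Green function in the normal direction. -/
noncomputable def greenSnd (z y : ℝ × ℝ) : ℝ :=
  -(1 / 2) * (poisson (z.2 - y.2) (z.1 - y.1) - poisson (z.2 + y.2) (z.1 - y.1))

/-- The kernel of `(H∂₂ - ∂₁)(-Δ_D)⁻¹`. -/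
noncomputable def gradKernel (z y : ℝ × ℝ) : ℝ :=
  if z.2 < y.2 then conjPoisson (z.2 - y.2) (z.1 - y.1) else 0

/-- The kernel of `H∂₂(-Δ_D)⁻¹`. -/
noncomputable def hilbertKernel (z y : ℝ × ℝ) : ℝ := greenFst z y + gradKernel z y

theorem greenD_eq (z y : ℝ × ℝ) : greenD z y =
    newton (z.1 - y.1, z.2 - y.2) - newton (z.1 - y.1, z.2 + y.2) := by
  simp [greenD, reflect, Prod.sub_def]

/-- `4π D = log (1 + 4 z₂ y₂ / |z-y|²)`, so the growth of the two logarithms at infinity cancels.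
With `q` the comparison kernel, `|z-y|⁻² ≤ 2q²` and `y₂ ≤ z₂ + |z₂-y₂|` bound the argument by `(1 +
3 z₂ q)²`, and `log (1 + u) ≤ u` finishes. Here the factor `z₂` arises. -/
theorem abs_greenD_le {z y : ℝ × ℝ} (hz : 0 < z.2) (hy : 0 ≤ y.2) (h1 : z.1 ≠ y.1)
    (h2 : z.2 ≠ y.2) : |greenD z y| ≤ z.2 * sqrtKernel z y := by
  obtain ⟨a, ha⟩ : ∃ a, a = z.1 - y.1 := ⟨_, rfl⟩
  obtain ⟨d, hd⟩ : ∃ d, d = z.2 - y.2 := ⟨_, rfl⟩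
  obtain ⟨q, hq⟩ : ∃ q, q = sqrtKernel z y := ⟨_, rfl⟩
  have ha0 : a ≠ 0 := ha ▸ sub_ne_zero.2 h1
  have hd0 : d ≠ 0 := hd ▸ sub_ne_zero.2 h2
  have hq0 : 0 ≤ q := hq ▸ sqrtKernel_nonneg z y
  have hR : 0 < a ^ 2 + d ^ 2 := by positivity
  have b1 : |d| / (a ^ 2 + d ^ 2) ≤ q := by
    rw [hq, sqrtKernel, ← ha, ← hd]
    exact abs_div_sq_add_sq_le ha0 hd0
  have b2 : |a| / (a ^ 2 + d ^ 2) ≤ q := by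
    rw [hq, sqrtKernel, ← ha, ← hd, mul_comm, add_comm]
    exact abs_div_sq_add_sq_le hd0 ha0
  have b3 : 1 / (a ^ 2 + d ^ 2) ≤ 2 * q ^ 2 := by
    have e : 1 / (a ^ 2 + d ^ 2) =
        (|a| / (a ^ 2 + d ^ 2)) ^ 2 + (|d| / (a ^ 2 + d ^ 2)) ^ 2 := by
      rw [div_pow, div_pow, sq_abs, sq_abs]
      field_simp
    rw [e, two_mul]
    gcongr
  have hN : a ^ 2 + (z.2 + y.2) ^ 2 = a ^ 2 + d ^ 2 + 4 * z.2 * y.2 := by rw [hd]; ring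
  have hN0 : 0 < a ^ 2 + d ^ 2 + 4 * z.2 * y.2 := by positivity
  have hD : greenD z y = 1 / (4 * Real.pi) *
      Real.log ((a ^ 2 + d ^ 2 + 4 * z.2 * y.2) / (a ^ 2 + d ^ 2)) := by
    rw [greenD_eq, newton_eq, newton_eq, ← ha, ← hd, hN, Real.log_div hN0.ne' hR.ne']
    ring
  have hlog0 : 0 ≤ Real.log ((a ^ 2 + d ^ 2 + 4 * z.2 * y.2) / (a ^ 2 + d ^ 2)) := by
    refine Real.log_nonneg ((one_le_div hR).2 ?_)
    have : 0 ≤ 4 * z.2 * y.2 := by positivity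
    linarith
  have hratio : (a ^ 2 + d ^ 2 + 4 * z.2 * y.2) / (a ^ 2 + d ^ 2) ≤ (1 + 3 * (z.2 * q)) ^ 2 := by
    have hyd : y.2 ≤ z.2 + |d| := by
      have := neg_abs_le d
      rw [hd] at this ⊢
      linarith
    calc (a ^ 2 + d ^ 2 + 4 * z.2 * y.2) / (a ^ 2 + d ^ 2)
        ≤ (a ^ 2 + d ^ 2 + 4 * z.2 * (z.2 + |d|)) / (a ^ 2 + d ^ 2) := by gcongr
      _ = 1 + 4 * z.2 ^ 2 * (1 / (a ^ 2 + d ^ 2)) + 4 * z.2 * (|d| / (a ^ 2 + d ^ 2)) := by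
          field_simp
          ring
      _ ≤ 1 + 4 * z.2 ^ 2 * (2 * q ^ 2) + 4 * z.2 * q := by gcongr
      _ ≤ (1 + 3 * (z.2 * q)) ^ 2 := by nlinarith [mul_nonneg hz.le hq0, sq_nonneg (z.2 * q)]
  have hzq : 0 ≤ z.2 * q := by positivity
  have hlog : Real.log ((a ^ 2 + d ^ 2 + 4 * z.2 * y.2) / (a ^ 2 + d ^ 2)) ≤ 6 * (z.2 * q) := by
    refine (Real.log_le_log (by positivity) hratio).trans ?_
    rw [Real.log_pow]
    have := Real.log_le_sub_one_of_pos (x := 1 + 3 * (z.2 * q)) (by positivity)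
    push_cast
    linarith
  rw [hD, abs_of_nonneg (by positivity), ← hq]
  calc 1 / (4 * Real.pi) * Real.log ((a ^ 2 + d ^ 2 + 4 * z.2 * y.2) / (a ^ 2 + d ^ 2))
      ≤ 1 / 12 * (6 * (z.2 * q)) := by
        gcongr
        linarith [Real.pi_gt_three]
    _ ≤ z.2 * q := by linarith

theorem singularKernel_greenD : SingularKernel greenD where
  measurable := by
    unfold greenD newton normSq reflect
    fun_prop
  bound z y hz hy h1 h2 := (abs_greenD_le hz hy h1 h2).trans
    (mul_le_mul_of_nonneg_right (by linarith) (sqrtKernel_nonneg _ _))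

theorem abs_half_sub_le {a b c : ℝ} (ha : |a| ≤ c) (hb : |b| ≤ c) : |-(1 / 2) * (a - b)| ≤ c := by
  rw [abs_mul, abs_neg, abs_of_pos (by norm_num : (0 : ℝ) < 1 / 2)]
  linarith [abs_sub a b]

theorem abs_greenFst_le {z y : ℝ × ℝ} (hz : 0 < z.2) (hy : 0 ≤ y.2) (h1 : z.1 ≠ y.1)
    (h2 : z.2 ≠ y.2) : |greenFst z y| ≤ sqrtKernel z y := by
  refine abs_half_sub_le (abs_conjPoisson_le (sub_ne_zero.2 h1) (sub_ne_zero.2 h2)) ?_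
  refine (abs_conjPoisson_le (sub_ne_zero.2 h1) (by positivity)).trans ?_
  exact mul_le_mul_of_nonneg_left (invSqrtAbs_add_le hz hy h2) (invSqrtAbs_nonneg _)

theorem abs_greenSnd_le {z y : ℝ × ℝ} (hz : 0 < z.2) (hy : 0 ≤ y.2) (h1 : z.1 ≠ y.1)
    (h2 : z.2 ≠ y.2) : |greenSnd z y| ≤ sqrtKernel z y := by
  refine abs_half_sub_le (abs_poisson_le (sub_ne_zero.2 h1) (sub_ne_zero.2 h2)) ?_
  refine (abs_poisson_le (sub_ne_zero.2 h1) (by positivity)).trans ?_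
  exact mul_le_mul_of_nonneg_left (invSqrtAbs_add_le hz hy h2) (invSqrtAbs_nonneg _)

theorem abs_gradKernel_le {z y : ℝ × ℝ} (h1 : z.1 ≠ y.1) (h2 : z.2 ≠ y.2) :
    |gradKernel z y| ≤ sqrtKernel z y := by
  unfold gradKernel
  split_ifs
  · exact abs_conjPoisson_le (sub_ne_zero.2 h1) (sub_ne_zero.2 h2)
  · simpa using sqrtKernel_nonneg z y

theorem singularKernel_greenFst : SingularKernel greenFst where
  measurable := by
    unfold greenFst conjPoisson
    fun_prop
  bound z y hz hy h1 h2 := (abs_greenFst_le hz hy h1 h2).trans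
    (by nlinarith [sqrtKernel_nonneg z y])

theorem singularKernel_greenSnd : SingularKernel greenSnd where
  measurable := by
    unfold greenSnd poisson
    fun_prop
  bound z y hz hy h1 h2 := (abs_greenSnd_le hz hy h1 h2).trans
    (by nlinarith [sqrtKernel_nonneg z y])

theorem measurable_gradKernel : Measurable fun p : (ℝ × ℝ) × (ℝ × ℝ) => gradKernel p.1 p.2 := by
  unfold gradKernel conjPoisson
  exact Measurable.ite (measurableSet_lt (by fun_prop) (by fun_prop)) (by fun_prop) (by fun_prop)

theorem singularKernel_gradKernel : SingularKernel gradKernel where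
  measurable := measurable_gradKernel
  bound z y hz hy h1 h2 := (abs_gradKernel_le h1 h2).trans
    (by nlinarith [sqrtKernel_nonneg z y])

theorem singularKernel_hilbertKernel : SingularKernel hilbertKernel where
  measurable := singularKernel_greenFst.measurable.add measurable_gradKernel
  bound z y hz hy h1 h2 := by
    have e1 := abs_greenFst_le hz hy h1 h2
    have e2 := abs_gradKernel_le h1 h2
    have e3 := abs_add_le (greenFst z y) (gradKernel z y)
    have := sqrtKernel_nonneg z y
    unfold hilbertKernel
    nlinarith

theorem hasDerivAt_greenD_fst {r b : ℝ} {y : ℝ × ℝ} (hb : 0 < b) (hy : 0 ≤ y.2) (h : b ≠ y.2) :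
    HasDerivAt (fun r => greenD (r, b) y) (greenFst (r, b) y) r := by
  have h1 : b - y.2 ≠ 0 := sub_ne_zero.2 h
  have h2 : b + y.2 ≠ 0 := by positivity
  have e1 := (hasDerivAt_newton_fst (a := r - y.1) (s := b - y.2) (by positivity)).comp_sub_const r y.1
  have e2 := (hasDerivAt_newton_fst (a := r - y.1) (s := b + y.2) (by positivity)).comp_sub_const r y.1
  simp only [greenD_eq]
  refine (e1.sub e2).congr_deriv ?_
  unfold greenFst conjPoisson
  have := Real.pi_ne_zero
  field_simp
  ring

theorem hasDerivAt_greenD_snd {a r : ℝ} {y : ℝ × ℝ} (h : a ≠ y.1) :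
    HasDerivAt (fun r => greenD (a, r) y) (greenSnd (a, r) y) r := by
  have h1 : a - y.1 ≠ 0 := sub_ne_zero.2 h
  have e1 := (hasDerivAt_newton_snd (a := a - y.1) (s := r - y.2) (by positivity)).comp_sub_const r y.2
  have e2 := (hasDerivAt_newton_snd (a := a - y.1) (s := r + y.2) (by positivity)).comp_add_const r y.2
  simp only [greenD_eq]
  refine (e1.sub e2).congr_deriv ?_
  unfold greenSnd poisson
  have := Real.pi_ne_zero
  field_simp
  ring

end GreenKernels

/-! ### Weak derivatives of potentials, and their uniqueness. -/

section WeakDerivatives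

open Filter Topology

theorem integral_mul_deriv_of_hasCompactSupport {u u' φ : ℝ → ℝ} (hu : ∀ r, HasDerivAt u (u' r) r)
    (hu' : Continuous u') (hφ : ContDiff ℝ 1 φ) (hs : HasCompactSupport φ) :
    ∫ r, u r * deriv φ r = -∫ r, u' r * φ r := by
  have hc : Continuous u := continuous_iff_continuousAt.2 fun r => (hu r).continuousAt
  have hd : Continuous (deriv φ) := hφ.continuous_deriv le_rfl
  exact integral_mul_deriv_eq_deriv_mul_of_integrable (fun r _ => hu r)
    (fun r _ => (hφ.differentiable one_ne_zero r).hasDerivAt)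
    ((hc.mul hd).integrable_of_hasCompactSupport hs.deriv.mul_left)
    ((hu'.mul hφ.continuous).integrable_of_hasCompactSupport hs.mul_left)
    ((hc.mul hφ.continuous).integrable_of_hasCompactSupport hs.mul_left)

theorem partialDeriv_zero_eq {φ : ℝ × ℝ → ℝ} (hφ : Differentiable ℝ φ) (z : ℝ × ℝ) :
    partialDeriv 0 φ z = fderiv ℝ φ z (1, 0) := by
  have h : HasDerivAt (fun r : ℝ => (r, z.2)) (1, 0) z.1 :=
    (hasDerivAt_id z.1).prodMk (hasDerivAt_const z.1 z.2)
  simpa [partialDeriv, Function.comp_def] using ((hφ z).hasFDerivAt.comp_hasDerivAt z.1 h).deriv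

theorem partialDeriv_one_eq {φ : ℝ × ℝ → ℝ} (hφ : Differentiable ℝ φ) (z : ℝ × ℝ) :
    partialDeriv 1 φ z = fderiv ℝ φ z (0, 1) := by
  have h : HasDerivAt (fun r : ℝ => (z.1, r)) (0, 1) z.2 :=
    (hasDerivAt_const z.2 z.1).prodMk (hasDerivAt_id z.2)
  simpa [partialDeriv, Function.comp_def] using ((hφ z).hasFDerivAt.comp_hasDerivAt z.2 h).deriv

theorem planeWeight_partialDeriv {φ : ℝ × ℝ → ℝ} (hφ : ContDiff ℝ ∞ φ) (hs : HasCompactSupport φ)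
    (i : Fin 2) : PlaneWeight (partialDeriv i φ) := by
  have hd : Differentiable ℝ φ := hφ.differentiable (by simp)
  have hc : ∀ v : ℝ × ℝ, PlaneWeight fun z => fderiv ℝ φ z v := fun v =>
    planeWeight_of_hasCompactSupport ((hφ.continuous_fderiv (by simp)).clm_apply continuous_const)
      (hs.fderiv_apply ℝ v)
  fin_cases i
  · exact (funext (partialDeriv_zero_eq hd)).symm ▸ hc (1, 0)
  · exact (funext (partialDeriv_one_eq hd)).symm ▸ hc (0, 1)

/-- The case of the Dirac mass at `y` in the product statement. -/
theorem SingularKernel.integrable_weight_mul_kernel {k : ℝ × ℝ → ℝ × ℝ → ℝ} {w : ℝ × ℝ → ℝ}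
    (hk : SingularKernel k) (hw : PlaneWeight w) {y : ℝ × ℝ} (hy : 0 ≤ y.2) :
    Integrable (fun z => w z * k z y) (volume.prod (volume.restrict (Ioi 0))) := by
  have h := (hk.integrable_prod (ν := Measure.dirac (⟨y, hy⟩ : closedHalfPlane)) (σ := fun _ => 1)
    hw (by fun_prop) (by simp)).prod_left_ae
  rw [ae_dirac_eq, eventually_pure, volume_restrict_halfPlane] at h
  simpa using h

/-- Integration by parts on horizontal lines at height `b > 0`: if `b ≠ y₂` the line meets neither
`y` nor `y*`, so the kernel is smooth on it. The singularity is seen only by a null set of lines. -/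
theorem integral_greenD_mul_partialDeriv_zero {φ : ℝ × ℝ → ℝ} (hφ : ContDiff ℝ ∞ φ)
    (hs : HasCompactSupport φ) {y : ℝ × ℝ} (hy : 0 ≤ y.2) :
    ∫ z in halfPlane, partialDeriv 0 φ z * greenD z y =
      -∫ z in halfPlane, φ z * greenFst z y := by
  have hw := planeWeight_of_hasCompactSupport hφ.continuous hs
  rw [volume_restrict_halfPlane,
    integral_prod_symm _ (singularKernel_greenD.integrable_weight_mul_kernel
      (planeWeight_partialDeriv hφ hs 0) hy),
    integral_prod_symm _ (singularKernel_greenFst.integrable_weight_mul_kernel hw hy),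
    ← integral_neg]
  refine integral_congr_ae ?_
  filter_upwards [ae_restrict_mem measurableSet_Ioi,
    ae_restrict_of_ae (Measure.ae_ne volume y.2)] with b hb hne
  have h1 : b - y.2 ≠ 0 := sub_ne_zero.2 hne
  have hb : 0 < b := hb
  have h2 : b + y.2 ≠ 0 := by positivity
  have hemb : Topology.IsClosedEmbedding fun r : ℝ => (r, b) := by
    exact Topology.IsClosedEmbedding.of_continuous_injective_isClosedMap (by fun_prop)
      (fun r s h => (Prod.ext_iff.1 h).1) (isClosedMap_prodMk_right b)
  have := integral_mul_deriv_of_hasCompactSupport (u := fun r => greenD (r, b) y)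
    (u' := fun r => greenFst (r, b) y) (φ := fun r => φ (r, b))
    (fun r => hasDerivAt_greenD_fst hb hy hne) (by
      unfold greenFst conjPoisson
      have p1 : ∀ r : ℝ, (r - y.1) ^ 2 + (b - y.2) ^ 2 ≠ 0 := fun r => by positivity
      have p2 : ∀ r : ℝ, (r - y.1) ^ 2 + (b + y.2) ^ 2 ≠ 0 := fun r => by positivity
      have := Real.pi_ne_zero
      fun_prop (disch := simp [*])) (by
      have : ContDiff ℝ 1 φ := hφ.of_le (by simp)
      fun_prop) (hs.comp_isClosedEmbedding hemb)
  simpa [partialDeriv, mul_comm] using this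

/-- The same on vertical lines with `a ≠ y₁`. Since `φ` is supported in the open half plane, the
half line can be completed to a full line and no boundary term appears. -/
theorem integral_greenD_mul_partialDeriv_one {φ : ℝ × ℝ → ℝ} (hφ : ContDiff ℝ ∞ φ)
    (hs : HasCompactSupport φ) (ht : tsupport φ ⊆ halfPlane) {y : ℝ × ℝ} (hy : 0 ≤ y.2) :
    ∫ z in halfPlane, partialDeriv 1 φ z * greenD z y =
      -∫ z in halfPlane, φ z * greenSnd z y := by
  have hw := planeWeight_of_hasCompactSupport hφ.continuous hs
  rw [volume_restrict_halfPlane,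
    integral_prod _ (singularKernel_greenD.integrable_weight_mul_kernel
      (planeWeight_partialDeriv hφ hs 1) hy),
    integral_prod _ (singularKernel_greenSnd.integrable_weight_mul_kernel hw hy),
    ← integral_neg]
  refine integral_congr_ae ?_
  filter_upwards [Measure.ae_ne volume y.1] with a hne
  have h1 : a - y.1 ≠ 0 := sub_ne_zero.2 hne
  have hemb : Topology.IsClosedEmbedding fun r : ℝ => (a, r) := by
    exact Topology.IsClosedEmbedding.of_continuous_injective_isClosedMap (by fun_prop)
      (fun r s h => (Prod.ext_iff.1 h).2) (isClosedMap_prodMk_left a)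
  have := integral_mul_deriv_of_hasCompactSupport (u := fun r => greenD (a, r) y)
    (u' := fun r => greenSnd (a, r) y) (φ := fun r => φ (a, r))
    (fun r => hasDerivAt_greenD_snd hne) (by
      unfold greenSnd poisson
      have p1 : ∀ r : ℝ, (a - y.1) ^ 2 + (r - y.2) ^ 2 ≠ 0 := fun r => by positivity
      have p2 : ∀ r : ℝ, (a - y.1) ^ 2 + (r + y.2) ^ 2 ≠ 0 := fun r => by positivity
      have := Real.pi_ne_zero
      fun_prop (disch := simp [*])) (by
      have : ContDiff ℝ 1 φ := hφ.of_le (by simp)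
      fun_prop) (hs.comp_isClosedEmbedding hemb)
  have hz : ∀ z ∉ halfPlane, z ∉ tsupport φ := fun z hz h => hz (ht h)
  rw [setIntegral_eq_integral_of_forall_compl_eq_zero,
    setIntegral_eq_integral_of_forall_compl_eq_zero]
  · simpa [partialDeriv, mul_comm] using this
  · intro r hr
    rw [image_eq_zero_of_notMem_tsupport (hz (a, r) hr), zero_mul]
  · intro r hr
    rw [partialDeriv_one_eq (hφ.differentiable (by simp)),
      image_eq_zero_of_notMem_tsupport (fun h => hz (a, r) hr (tsupport_fderiv_subset ℝ h))]
    simp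

variable {ν : Measure closedHalfPlane} [IsFiniteMeasure ν] {σ : closedHalfPlane → ℝ}

theorem isWeakPartial_kernelPotential_zero (hσ : Measurable σ) (hσ1 : ∀ y, |σ y| ≤ 1) :
    IsWeakPartial 0 (kernelPotential ν σ greenD) (kernelPotential ν σ greenFst) := by
  refine ⟨singularKernel_greenD.locallyIntegrableOn hσ hσ1,
    singularKernel_greenFst.locallyIntegrableOn hσ hσ1, fun φ hφ hs _ => ?_⟩
  have h1 := singularKernel_greenD.integral_weight_mul (ν := ν) (planeWeight_partialDeriv hφ hs 0)
    hσ hσ1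
  have h2 := singularKernel_greenFst.integral_weight_mul (ν := ν)
    (planeWeight_of_hasCompactSupport hφ.continuous hs) hσ hσ1
  simp only [mul_comm (kernelPotential _ _ _ _)]
  rw [h1, h2, ← integral_neg]
  refine integral_congr_ae (Eventually.of_forall fun y => ?_)
  simp only
  rw [integral_greenD_mul_partialDeriv_zero hφ hs y.2, neg_mul]

theorem isWeakPartial_kernelPotential_one (hσ : Measurable σ) (hσ1 : ∀ y, |σ y| ≤ 1) :
    IsWeakPartial 1 (kernelPotential ν σ greenD) (kernelPotential ν σ greenSnd) := by
  refine ⟨singularKernel_greenD.locallyIntegrableOn hσ hσ1,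
    singularKernel_greenSnd.locallyIntegrableOn hσ hσ1, fun φ hφ hs ht => ?_⟩
  have h1 := singularKernel_greenD.integral_weight_mul (ν := ν) (planeWeight_partialDeriv hφ hs 1)
    hσ hσ1
  have h2 := singularKernel_greenSnd.integral_weight_mul (ν := ν)
    (planeWeight_of_hasCompactSupport hφ.continuous hs) hσ hσ1
  simp only [mul_comm (kernelPotential _ _ _ _)]
  rw [h1, h2, ← integral_neg]
  refine integral_congr_ae (Eventually.of_forall fun y => ?_)
  simp only
  rw [integral_greenD_mul_partialDeriv_one hφ hs ht y.2, neg_mul]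

theorem StokesHalfPlane.IsWeakPartial.congr_ae {i : Fin 2} {f f' g : ℝ × ℝ → ℝ} (h : IsWeakPartial i f g)
    (hf : f =ᵐ[volume.restrict halfPlane] f') : IsWeakPartial i f' g := by
  refine ⟨h.1.congr hf, h.2.1, fun φ hφ hs ht => ?_⟩
  rw [← h.2.2 φ hφ hs ht]
  refine integral_congr_ae ?_
  filter_upwards [hf] with z hz
  rw [hz]

theorem StokesHalfPlane.IsWeakPartial.ae_eq {i : Fin 2} {f g g' : ℝ × ℝ → ℝ} (h : IsWeakPartial i f g)
    (h' : IsWeakPartial i f g') : g =ᵐ[volume.restrict halfPlane] g' := by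
  have key := isOpen_halfPlane.ae_eq_zero_of_integral_contDiff_smul_eq_zero
    (h.2.1.sub h'.2.1) fun φ hφ hs ht => ?_
  · rw [EventuallyEq, ae_restrict_iff' measurableSet_halfPlane]
    filter_upwards [key] with z hz hzm using sub_eq_zero.1 (hz hzm)
  · have e := (h.2.2 φ hφ hs ht).symm.trans (h'.2.2 φ hφ hs ht)
    rw [neg_inj] at e
    have hint (g : ℝ × ℝ → ℝ) (hg : LocallyIntegrableOn g halfPlane) :
        Integrable (fun z => g z * φ z) (volume.restrict halfPlane) := by
      have h1 : IntegrableOn (fun z => g z * φ z) (tsupport φ) :=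
        (hg.integrableOn_compact_subset ht hs.isCompact).mul_continuousOn
          hφ.continuous.continuousOn hs.isCompact
      refine Integrable.restrict ((integrableOn_iff_integrable_of_support_subset ?_).1 h1)
      exact (Function.support_mul_subset_right g φ).trans (subset_tsupport φ)
    have h0 : ∫ z, φ z • (g - g') z = ∫ z in halfPlane, (g z * φ z - g' z * φ z) := by
      rw [← setIntegral_eq_integral_of_forall_compl_eq_zero (s := halfPlane)]
      · congr 1
        funext z
        simp only [Pi.sub_apply, smul_eq_mul]
        ring
      · intro z hz
        rw [image_eq_zero_of_notMem_tsupport (fun h => hz (ht h)), zero_smul]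
    rw [h0, integral_sub (hint g h.2.1) (hint g' h'.2.1), e, sub_self]

end WeakDerivatives

/-! ### The Hilbert transform by duality; the Poisson kernel and its conjugate. -/

section HilbertPairs

open Filter Topology

theorem continuous_fourier {f : ℝ → ℂ} (hf : Integrable f) : Continuous (𝓕 f) :=
  VectorFourier.fourierIntegral_continuous Real.continuous_fourierChar continuous_inner hf

theorem norm_fourier_le (f : ℝ → ℂ) (r : ℝ) : ‖𝓕 f r‖ ≤ ∫ x, ‖f x‖ :=
  VectorFourier.norm_fourierIntegral_le_integral_norm _ _ _ f r

theorem integral_fourier_mul_eq {f g : ℝ → ℂ} (hf : Integrable f) (hg : Integrable g) :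
    ∫ x, 𝓕 f x * g x = ∫ x, f x * 𝓕 g x := by
  have := VectorFourier.integral_fourierIntegral_smul_eq_flip (L := innerₗ ℝ)
    Real.continuous_fourierChar continuous_inner hf hg
  rwa [flip_innerₗ] at this

theorem integral_fourierInv_mul_eq {f g : ℝ → ℂ} (hf : Integrable f) (hg : Integrable g) :
    ∫ x, 𝓕⁻ f x * g x = ∫ x, f x * 𝓕⁻ g x := by
  rw [Real.fourierInv_eq_fourier_comp_neg f, integral_fourier_mul_eq hf.comp_neg hg,
    ← integral_neg_eq_self]
  simp only [neg_neg]
  refine integral_congr_ae (Eventually.of_forall fun x => ?_)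
  simp only [Real.fourierInv_eq_fourier_neg]

/-- The Fourier multiplier of the Hilbert transform. -/
noncomputable def hilbertMul (ξ : ℝ) : ℂ := -Complex.I * ((ξ / |ξ| : ℝ) : ℂ)

theorem measurable_hilbertMul : Measurable hilbertMul := by
  unfold hilbertMul
  fun_prop

theorem norm_hilbertMul_le (ξ : ℝ) : ‖hilbertMul ξ‖ ≤ 1 := by
  rw [hilbertMul, norm_mul, norm_neg, Complex.norm_I, one_mul, Complex.norm_real, norm_div,
    Real.norm_eq_abs, Real.norm_eq_abs, abs_abs]
  exact div_self_le_one _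

theorem hilbertMul_of_pos {ξ : ℝ} (h : 0 < ξ) : hilbertMul ξ = -Complex.I := by
  simp [hilbertMul, abs_of_pos h, h.ne']

theorem hilbertMul_neg {ξ : ℝ} (h : 0 < ξ) : hilbertMul (-ξ) = Complex.I := by
  simp [hilbertMul, abs_of_pos h, h.ne']

theorem integrable_hilbertMul_mul {f : ℝ → ℂ} (hf : Integrable f) :
    Integrable fun ξ => hilbertMul ξ * f ξ :=
  hf.bdd_mul measurable_hilbertMul.aestronglyMeasurable (Eventually.of_forall norm_hilbertMul_le)

/-- The dual form of the defining identity of the Hilbert transform. -/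
theorem isHilbertTransform_iff {f h : ℝ → ℝ} : IsHilbertTransform f h ↔
    Integrable f ∧ (∃ N : ℕ, Integrable (fun r => h r / (1 + r ^ 2) ^ N)) ∧ ∀ θ : 𝓢(ℝ, ℂ),
      ∫ r : ℝ, (h r : ℂ) * 𝓕 (θ : ℝ → ℂ) r =
        ∫ r : ℝ, (f r : ℂ) * 𝓕 (fun ξ => hilbertMul ξ * θ ξ) r := by
  refine and_congr_right fun hf => and_congr_right fun _ => forall_congr' fun θ => ?_
  rw [← integral_fourier_mul_eq (f := fun r => (f r : ℂ)) hf.ofReal (integrable_hilbertMul_mul θ.integrable)]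
  have : ∀ ξ : ℝ, -Complex.I * ((ξ / |ξ| : ℝ) : ℂ) * 𝓕 (fun r : ℝ => (f r : ℂ)) ξ * θ ξ =
      𝓕 (fun r : ℝ => (f r : ℂ)) ξ * (hilbertMul ξ * θ ξ) := fun ξ => by
    rw [hilbertMul]
    ring
  simp only [this]

theorem StokesHalfPlane.IsHilbertTransform.congr_left {f f' h : ℝ → ℝ} (hh : IsHilbertTransform f h)
    (hf : f =ᵐ[volume] f') : IsHilbertTransform f' h := by
  refine ⟨hh.1.congr hf, hh.2.1, fun θ => ?_⟩
  have : (fun r => (f r : ℂ)) =ᵐ[volume] fun r => (f' r : ℂ) := by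
    filter_upwards [hf] with r hr
    rw [hr]
  simp only [hh.2.2 θ, Real.fourier_congr_ae this]

theorem StokesHalfPlane.IsHilbertTransform.locallyIntegrable {f h : ℝ → ℝ} (hh : IsHilbertTransform f h) :
    LocallyIntegrable h := by
  obtain ⟨N, hN⟩ := hh.2.1
  have := (hN.locallyIntegrable.locallyIntegrableOn univ).continuousOn_mul
    (g := fun r : ℝ => (1 + r ^ 2) ^ N) (by fun_prop) isOpen_univ.isLocallyClosed
  rw [locallyIntegrableOn_univ] at this
  refine this.congr (Eventually.of_forall fun r => ?_)
  have : (1 + r ^ 2) ^ N ≠ 0 := by positivity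
  simp only
  field_simp

/-- Every smooth compactly supported function is the Fourier transform of a Schwartz function, so
the defining identity fixes all pairings of `h` with test functions. -/
theorem StokesHalfPlane.IsHilbertTransform.ae_eq {f h h' : ℝ → ℝ} (hh : IsHilbertTransform f h)
    (hh' : IsHilbertTransform f h') : h =ᵐ[volume] h' := by
  refine ae_eq_of_integral_contDiff_smul_eq hh.locallyIntegrable hh'.locallyIntegrable
    fun g hg hs => ?_
  have hg' : ContDiff ℝ ∞ fun r => (g r : ℂ) := Complex.ofRealCLM.contDiff.comp hg
  have hs' : HasCompactSupport fun r => (g r : ℂ) := hs.comp_left Complex.ofReal_zero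
  have e := (hh.2.2 (𝓕⁻ (hs'.toSchwartzMap hg'))).trans
    (hh'.2.2 (𝓕⁻ (hs'.toSchwartzMap hg'))).symm
  have e1 : 𝓕 ((𝓕⁻ (hs'.toSchwartzMap hg') : 𝓢(ℝ, ℂ)) : ℝ → ℂ) = fun r => (g r : ℂ) := by
    rw [← SchwartzMap.fourier_coe, FourierTransform.fourier_fourierInv_eq]
    rfl
  rw [e1] at e
  simp only [← Complex.ofReal_mul, integral_complex_ofReal, Complex.ofReal_inj] at e
  simpa only [smul_eq_mul, mul_comm] using e

theorem integrable_and_integral_of_halves {F : ℝ → ℂ} {α β w w' : ℂ} (hw : 0 < w.re)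
    (hw' : 0 < w'.re) (h1 : ∀ ξ : ℝ, 0 < ξ → F ξ = α * Complex.exp (-w * ξ))
    (h2 : ∀ ξ : ℝ, 0 < ξ → F (-ξ) = β * Complex.exp (-w' * ξ)) :
    Integrable F ∧ ∫ ξ, F ξ = α * (1 / w) + β * (1 / w') := by
  set A : ℂ → ℂ → ℝ → ℂ := fun α w => (Ioi 0).indicator fun ξ : ℝ =>
    α * ((ξ : ℂ) ^ 0 * Complex.exp (-w * ξ)) with hA
  have hi (α w : ℂ) (hw : 0 < w.re) : Integrable (A α w) :=
    (integrable_indicator_iff measurableSet_Ioi).2 ((integrableOn_pow_mul_cexp 0 hw).const_mul α)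
  have he (α w : ℂ) (hw : 0 < w.re) : ∫ ξ, A α w ξ = α * (1 / w) := by
    rw [hA, integral_indicator measurableSet_Ioi, integral_const_mul, integral_cexp_Ioi hw]
  have hF : (fun ξ => A α w ξ + A β w' (-ξ)) =ᵐ[volume] F := by
    filter_upwards [Measure.ae_ne volume 0] with ξ hξ
    rcases hξ.lt_or_gt with h | h
    · have h' : 0 < -ξ := by linarith
      have := h2 (-ξ) h'
      rw [neg_neg] at this
      simp [hA, this, h, h.le]
    · simp [hA, h1 ξ h, h, h.le]
  have i1 := hi α w hw
  have i2 := (hi β w' hw').comp_neg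
  refine ⟨(i1.add i2).congr hF, ?_⟩
  rw [← integral_congr_ae hF, integral_add i1 i2, integral_neg_eq_self, he α w hw, he β w' hw']

/-- Exponentials with separate amplitudes on the two half lines. -/
noncomputable def halfExp (α β : ℂ) (s c ξ : ℝ) : ℂ :=
  (if 0 < ξ then α else β) * Complex.exp (-(2 * Real.pi * (s * |ξ| + c * ξ * Complex.I)))

theorem integrable_halfExp (α β : ℂ) {s : ℝ} (hs : 0 < s) (c : ℝ) :
    Integrable (halfExp α β s c) := by
  refine (integrable_and_integral_of_halves (α := α) (β := β)
    (w := 2 * Real.pi * (s + c * Complex.I)) (w' := 2 * Real.pi * (s - c * Complex.I))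
    (by simp; positivity) (by simp; positivity) (fun ξ h => ?_) fun ξ h => ?_).1
  · rw [halfExp, if_pos h, abs_of_pos h]
    ring_nf
  · rw [halfExp, if_neg (by linarith), abs_neg, abs_of_pos h]
    push_cast
    ring_nf

theorem fourierInv_halfExp (α β : ℂ) {s : ℝ} (hs : 0 < s) (c r : ℝ) :
    𝓕⁻ (halfExp α β s c) r = α * (1 / (2 * Real.pi * (s - (r - c) * Complex.I))) +
      β * (1 / (2 * Real.pi * (s + (r - c) * Complex.I))) := by
  rw [Real.fourierInv_eq']
  refine (integrable_and_integral_of_halves (α := α) (β := β)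
    (by simp; positivity) (by simp; positivity) (fun ξ h => ?_) fun ξ h => ?_).2
  · rw [halfExp, if_pos h, abs_of_pos h, smul_eq_mul, mul_left_comm, ← Complex.exp_add]
    congr 2
    simp
    ring
  · rw [halfExp, if_neg (by linarith), abs_neg, abs_of_pos h, smul_eq_mul, mul_left_comm,
      ← Complex.exp_add]
    congr 2
    simp
    ring

theorem fourierInv_halfExp_poisson {s : ℝ} (hs : 0 < s) (c r : ℝ) :
    𝓕⁻ (halfExp 1 1 s c) r = (poisson s (r - c) : ℂ) := by
  have h : ((r : ℂ) - c) ^ 2 + (s : ℂ) ^ 2 ≠ 0 := by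
    norm_cast
    positivity
  have e : ((s : ℂ) - (r - c) * Complex.I) * (s + (r - c) * Complex.I) = (r - c) ^ 2 + s ^ 2 := by
    linear_combination (-(r - c : ℂ) ^ 2) * Complex.I_sq
  have h1 : (s : ℂ) - (r - c) * Complex.I ≠ 0 := left_ne_zero_of_mul (e ▸ h)
  have h2 : (s : ℂ) + (r - c) * Complex.I ≠ 0 := right_ne_zero_of_mul (e ▸ h)
  have hp : (Real.pi : ℂ) ≠ 0 := by exact_mod_cast Real.pi_ne_zero
  rw [fourierInv_halfExp 1 1 hs, poisson]
  push_cast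
  rw [← e]
  field_simp
  ring

theorem fourierInv_halfExp_conjPoisson {s : ℝ} (hs : 0 < s) (c r : ℝ) :
    𝓕⁻ (halfExp (-Complex.I) Complex.I s c) r = (conjPoisson s (r - c) : ℂ) := by
  have h : ((r : ℂ) - c) ^ 2 + (s : ℂ) ^ 2 ≠ 0 := by
    norm_cast
    positivity
  have e : ((s : ℂ) - (r - c) * Complex.I) * (s + (r - c) * Complex.I) = (r - c) ^ 2 + s ^ 2 := by
    linear_combination (-(r - c : ℂ) ^ 2) * Complex.I_sq
  have h1 : (s : ℂ) - (r - c) * Complex.I ≠ 0 := left_ne_zero_of_mul (e ▸ h)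
  have h2 : (s : ℂ) + (r - c) * Complex.I ≠ 0 := right_ne_zero_of_mul (e ▸ h)
  have hp : (Real.pi : ℂ) ≠ 0 := by exact_mod_cast Real.pi_ne_zero
  rw [fourierInv_halfExp _ _ hs, conjPoisson]
  push_cast
  rw [← e]
  have h3 : (r : ℂ) - c = -Complex.I * ((s + (r - c) * Complex.I) - (s - (r - c) * Complex.I)) / 2 := by
    linear_combination (r - c : ℂ) * Complex.I_sq
  generalize (s : ℂ) - (r - c) * Complex.I = A at *
  generalize (s : ℂ) + (r - c) * Complex.I = B at *
  rw [h3]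
  field_simp
  ring

theorem poisson_eq_inv {s : ℝ} (hs : 0 < s) (r : ℝ) :
    poisson s r = 1 / (Real.pi * s) * (1 + (r / s) ^ 2)⁻¹ := by
  have := Real.pi_ne_zero
  have : s ^ 2 + r ^ 2 ≠ 0 := by positivity
  have : r ^ 2 + s ^ 2 ≠ 0 := by positivity
  unfold poisson
  field_simp
  ring

theorem integrable_poisson {s : ℝ} (hs : 0 < s) : Integrable (poisson s) := by
  rw [funext (poisson_eq_inv hs)]
  exact (integrable_inv_one_add_sq.comp_div hs.ne').const_mul _

theorem integral_poisson {s : ℝ} (hs : 0 < s) : ∫ r, poisson s r = 1 := by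
  simp only [poisson_eq_inv hs]
  rw [integral_const_mul, Measure.integral_comp_div (fun r : ℝ => (1 + r ^ 2)⁻¹),
    integral_univ_inv_one_add_sq, abs_of_pos hs, smul_eq_mul]
  have := Real.pi_ne_zero
  field_simp

/-- Inversion is legitimate because `halfExp 1 1 s c` is continuous and both it and the Poisson
kernel are integrable. -/
theorem fourier_poisson {s : ℝ} (hs : 0 < s) (c : ℝ) :
    𝓕 (fun r : ℝ => (poisson s (r - c) : ℂ)) = halfExp 1 1 s c := by
  rw [← funext (fourierInv_halfExp_poisson hs c)]
  have hc : Continuous (halfExp 1 1 s c) := by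
    unfold halfExp
    simp only [ite_self]
    fun_prop
  refine hc.fourier_fourierInv_eq (integrable_halfExp 1 1 hs c) ?_
  have h : Integrable (𝓕⁻ (halfExp 1 1 s c)) := by
    rw [funext (fourierInv_halfExp_poisson hs c)]
    exact ((integrable_poisson hs).comp_sub_right c).ofReal
  have e : 𝓕 (halfExp 1 1 s c) = fun r => 𝓕⁻ (halfExp 1 1 s c) (-r) := by
    funext r
    rw [Real.fourierInv_eq_fourier_neg, neg_neg]
  rw [e]
  exact h.comp_neg

/-- The Hilbert transform of the Poisson kernel is its conjugate. -/
theorem integral_conjPoisson_mul_fourier {s : ℝ} (hs : 0 < s) (c : ℝ) (θ : 𝓢(ℝ, ℂ)) :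
    ∫ r : ℝ, (conjPoisson s (r - c) : ℂ) * 𝓕 (θ : ℝ → ℂ) r =
      ∫ r : ℝ, (poisson s (r - c) : ℂ) * 𝓕 (fun ξ => hilbertMul ξ * θ ξ) r := by
  have hθ : Integrable (𝓕 (θ : ℝ → ℂ)) := by
    rw [← SchwartzMap.fourier_coe]
    exact SchwartzMap.integrable _
  have hinv : 𝓕⁻ (𝓕 (θ : ℝ → ℂ)) = θ := by
    rw [← SchwartzMap.fourier_coe, ← SchwartzMap.fourierInv_coe,
      FourierTransform.fourierInv_fourier_eq]
  rw [← integral_fourier_mul_eq (f := fun r : ℝ => (poisson s (r - c) : ℂ))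
    ((integrable_poisson hs).comp_sub_right c).ofReal (integrable_hilbertMul_mul θ.integrable), fourier_poisson hs]
  -- The conjugate kernel decays only like `1/r`, so its transform is not taken directly: it is
  -- written as an inverse transform of an integrable function, and the transform is moved to the
  -- test function.
  simp only [← fourierInv_halfExp_conjPoisson hs c]
  rw [integral_fourierInv_mul_eq (integrable_halfExp _ _ hs c) hθ, hinv]
  refine integral_congr_ae ?_
  filter_upwards [Measure.ae_ne volume 0] with ξ hξ
  rcases hξ.lt_or_gt with h | h
  · have := hilbertMul_neg (neg_pos.2 h)
    rw [neg_neg] at this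
    rw [this, halfExp, halfExp, if_neg h.not_gt, if_neg h.not_gt]
    ring
  · rw [hilbertMul_of_pos h, halfExp, halfExp, if_pos h, if_pos h]
    ring

end HilbertPairs

/-! ### The tangential Hilbert transform of the normal derivative. -/

section TangentialHilbert

open Filter Topology

theorem abs_conjPoisson_le_inv {s : ℝ} (hs : 0 < s) (r : ℝ) : |conjPoisson s r| ≤ 1 / s := by
  have h : 0 < Real.pi * (r ^ 2 + s ^ 2) := by positivity
  rw [conjPoisson, abs_div, abs_of_pos h, div_le_div_iff₀ h hs, one_mul, ← sq_abs r]
  have := Real.pi_gt_three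
  nlinarith [sq_nonneg (|r| - s), mul_nonneg (abs_nonneg r) hs.le, sq_nonneg |r|, sq_nonneg s]

theorem continuous_conjPoisson {s : ℝ} (hs : s ≠ 0) : Continuous (conjPoisson s) := by
  unfold conjPoisson
  have p1 : ∀ r : ℝ, r ^ 2 + s ^ 2 ≠ 0 := fun r => by positivity
  have := Real.pi_ne_zero
  fun_prop (disch := simp [*])

theorem integrable_conjPoisson_mul {s : ℝ} (hs : 0 < s) (c : ℝ) {g : ℝ → ℂ} (hg : Integrable g) :
    Integrable fun r => (conjPoisson s (r - c) : ℂ) * g r := by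
  have hc := continuous_conjPoisson hs.ne'
  refine hg.bdd_mul (c := 1 / s) (by fun_prop) (Eventually.of_forall fun r => ?_)
  rw [Complex.norm_real]
  exact abs_conjPoisson_le_inv hs _

theorem integrable_mul_fourier {f : ℝ → ℝ} (hf : Integrable f) {g : ℝ → ℂ} (hg : Integrable g) :
    Integrable fun r => (f r : ℂ) * 𝓕 g r := by
  refine (hf.ofReal.bdd_mul (continuous_fourier hg).aestronglyMeasurable
    (Eventually.of_forall (norm_fourier_le g))).congr (Eventually.of_forall fun r => ?_)
  exact mul_comm _ _

/-- Take `s = |b - y₂|` and `ε` the sign of `b - y₂`. The Poisson kernel is odd in its parameter and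
the conjugate one even, so below `y` the two direct terms would carry different signs; adding
`gradKernel` flips the sign of the conjugate term, and `P ↦ Q` becomes a match term by term. -/
theorem exists_hilbertKernel_eq {b : ℝ} {y : ℝ × ℝ} (h : b ≠ y.2) :
    ∃ ε s : ℝ, 0 < s ∧ |ε| = 1 ∧ (∀ r, hilbertKernel (r, b) y =
      -(1 / 2) * (ε * conjPoisson s (r - y.1) - conjPoisson (b + y.2) (r - y.1))) ∧
      ∀ r, greenSnd (r, b) y =
        -(1 / 2) * (ε * poisson s (r - y.1) - poisson (b + y.2) (r - y.1)) := by
  rcases h.lt_or_gt with h | h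
  · refine ⟨-1, y.2 - b, sub_pos.2 h, by simp, fun r => ?_, fun r => ?_⟩
    · rw [hilbertKernel, gradKernel, if_pos h, greenFst, ← conjPoisson_neg (b - y.2), neg_sub]
      ring
    · rw [greenSnd, ← neg_sub y.2 b, poisson_neg]
      ring
  · refine ⟨1, b - y.2, sub_pos.2 h, by simp, fun r => ?_, fun r => ?_⟩
    · rw [hilbertKernel, gradKernel, if_neg h.not_gt, greenFst]
      ring
    · rw [greenSnd]
      ring

theorem integral_hilbertKernel_mul_fourier {b : ℝ} {y : ℝ × ℝ} (hb : 0 < b) (hy : 0 ≤ y.2)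
    (h : b ≠ y.2) (θ : 𝓢(ℝ, ℂ)) :
    ∫ r : ℝ, (hilbertKernel (r, b) y : ℂ) * 𝓕 (θ : ℝ → ℂ) r =
      ∫ r : ℝ, (greenSnd (r, b) y : ℂ) * 𝓕 (fun ξ => hilbertMul ξ * θ ξ) r := by
  obtain ⟨ε, s, hs, -, h1, h2⟩ := exists_hilbertKernel_eq h
  have hs' : 0 < b + y.2 := by positivity
  have hθ : Integrable (𝓕 (θ : ℝ → ℂ)) := by
    rw [← SchwartzMap.fourier_coe]
    exact SchwartzMap.integrable _
  have hm := integrable_hilbertMul_mul θ.integrable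
  have e1 : ∀ r : ℝ, (hilbertKernel (r, b) y : ℂ) * 𝓕 (θ : ℝ → ℂ) r =
      (-(1 / 2) * ε) * ((conjPoisson s (r - y.1) : ℂ) * 𝓕 (θ : ℝ → ℂ) r) +
        (1 / 2) * ((conjPoisson (b + y.2) (r - y.1) : ℂ) * 𝓕 (θ : ℝ → ℂ) r) := fun r => by
    rw [h1]
    push_cast
    ring
  have e2 : ∀ r : ℝ, (greenSnd (r, b) y : ℂ) * 𝓕 (fun ξ => hilbertMul ξ * θ ξ) r =
      (-(1 / 2) * ε) * ((poisson s (r - y.1) : ℂ) * 𝓕 (fun ξ => hilbertMul ξ * θ ξ) r) +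
        (1 / 2) * ((poisson (b + y.2) (r - y.1) : ℂ) * 𝓕 (fun ξ => hilbertMul ξ * θ ξ) r) :=
    fun r => by
    rw [h2]
    push_cast
    ring
  simp only [e1, e2]
  rw [integral_add ((integrable_conjPoisson_mul hs _ hθ).const_mul _)
    ((integrable_conjPoisson_mul hs' _ hθ).const_mul _),
    integral_add ((integrable_mul_fourier ((integrable_poisson hs).comp_sub_right y.1) hm).const_mul _)
    ((integrable_mul_fourier ((integrable_poisson hs').comp_sub_right y.1) hm).const_mul _)]
  simp only [integral_const_mul]
  rw [integral_conjPoisson_mul_fourier hs, integral_conjPoisson_mul_fourier hs']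

/-- Each Poisson kernel has mass one, so the `L¹` norm on a line is bounded uniformly in `y`; this
is what puts `∂₂ψ(·, b)` in `L¹` for any finite measure. -/
theorem integrable_greenSnd {b : ℝ} {y : ℝ × ℝ} (hb : 0 < b) (hy : 0 ≤ y.2) (h : b ≠ y.2) :
    Integrable (fun r => greenSnd (r, b) y) ∧ ∫ r, ‖greenSnd (r, b) y‖ ≤ 1 := by
  obtain ⟨ε, s, hs, hε, -, h2⟩ := exists_hilbertKernel_eq h
  have hs' : 0 < b + y.2 := by positivity
  have i1 := (integrable_poisson hs).comp_sub_right y.1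
  have i2 := (integrable_poisson hs').comp_sub_right y.1
  have hi : Integrable (fun r => greenSnd (r, b) y) := by
    simp only [h2]
    exact ((i1.const_mul ε).sub i2).const_mul _
  refine ⟨hi, ?_⟩
  have hp (s : ℝ) (hs : 0 < s) (r : ℝ) : 0 ≤ poisson s r := by
    unfold poisson
    positivity
  calc ∫ r, ‖greenSnd (r, b) y‖
      ≤ ∫ r, (1 / 2) * (poisson s (r - y.1) + poisson (b + y.2) (r - y.1)) := by
        refine integral_mono hi.norm ((i1.add i2).const_mul _) fun r => ?_
        have a1 := hp s hs (r - y.1)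
        have a2 := hp _ hs' (r - y.1)
        have := abs_sub (ε * poisson s (r - y.1)) (poisson (b + y.2) (r - y.1))
        rw [abs_mul, hε, one_mul, abs_of_nonneg a1, abs_of_nonneg a2] at this
        simp only [h2, Real.norm_eq_abs]
        rw [abs_mul, abs_neg, abs_of_pos (by norm_num : (0 : ℝ) < 1 / 2)]
        exact mul_le_mul_of_nonneg_left this (by norm_num)
    _ = 1 := by
        rw [integral_const_mul, integral_add i1 i2, integral_sub_right_eq_self (poisson s),
          integral_sub_right_eq_self (poisson (b + y.2)), integral_poisson hs,
          integral_poisson hs']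
        norm_num

theorem abs_hilbertKernel_le {z y : ℝ × ℝ} (hz : 0 < z.2) (hy : 0 ≤ y.2) (h1 : z.1 ≠ y.1)
    (h2 : z.2 ≠ y.2) : |hilbertKernel z y| ≤ 2 * sqrtKernel z y := by
  have e1 := abs_greenFst_le hz hy h1 h2
  have e2 := abs_gradKernel_le h1 h2
  have e3 := abs_add_le (greenFst z y) (gradKernel z y)
  unfold hilbertKernel
  linarith

theorem testWeight_norm_fourier (θ : 𝓢(ℝ, ℂ)) : TestWeight fun r => ‖𝓕 (θ : ℝ → ℂ) r‖ where
  measurable := (continuous_fourier θ.integrable).norm.measurable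
  nonneg r := norm_nonneg _
  bounded := ⟨_, norm_fourier_le _⟩
  integrable := by
    rw [← SchwartzMap.fourier_coe]
    exact (SchwartzMap.integrable _).norm

theorem testWeight_inv_one_add_sq : TestWeight fun r => (1 + r ^ 2)⁻¹ where
  measurable := by fun_prop
  nonneg r := by positivity
  bounded := ⟨1, fun r => inv_le_one_of_one_le₀ (by nlinarith [sq_nonneg r])⟩
  integrable := integrable_inv_one_add_sq

variable {ν : Measure closedHalfPlane} [IsFiniteMeasure ν] {σ : closedHalfPlane → ℝ}

theorem ae_fst_ne : ∀ᵐ p : ℝ × closedHalfPlane ∂(volume.prod ν), p.1 ≠ (p.2 : ℝ × ℝ).1 := by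
  have hm : MeasurableSet {p : ℝ × closedHalfPlane | p.1 ≠ (p.2 : ℝ × ℝ).1} :=
    (measurableSet_eq_fun (by fun_prop) (by fun_prop)).compl
  exact (Measure.ae_prod_iff_ae_ae hm).2
    ((Measure.ae_ae_comm hm).2 (Eventually.of_forall fun y => Measure.ae_ne volume (y : ℝ × ℝ).1))

/-- On a fixed line the normal factor `|b - y₂|^{-1/2}` is no longer averaged, so its
`ν`-integrability is assumed; it holds for almost every `b`. -/
theorem TestWeight.integrable_mul_of_le {G : ℝ → ℝ} (hG : TestWeight G) {b : ℝ}
    (hi : Integrable (fun y : closedHalfPlane => invSqrtAbs (b - (y : ℝ × ℝ).2)) ν)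
    {K : ℝ × closedHalfPlane → ℝ} (hK : Measurable K)
    (hb : ∀ᵐ p ∂(volume.prod ν), |K p| ≤ 2 * sqrtKernel (p.1, b) (p.2 : ℝ × ℝ)) :
    Integrable (fun p => G p.1 * K p) (volume.prod ν) := by
  have hG' := hG.measurable
  obtain ⟨C, hC, hCb⟩ := hG.exists_lintegral_le
  have hm : Measurable invSqrtAbs := measurable_invSqrtAbs
  have hdom : Integrable (fun p : ℝ × closedHalfPlane => 2 * (G p.1 *
      (invSqrtAbs (p.1 - (p.2 : ℝ × ℝ).1) * invSqrtAbs (b - (p.2 : ℝ × ℝ).2)))) (volume.prod ν) := by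
    refine Integrable.const_mul ?_ 2
    refine ⟨by fun_prop, ?_⟩
    rw [hasFiniteIntegral_iff_enorm, lintegral_prod_symm _ (by fun_prop)]
    calc ∫⁻ y, ∫⁻ r, ‖G r * (invSqrtAbs (r - (y : ℝ × ℝ).1) *
            invSqrtAbs (b - (y : ℝ × ℝ).2))‖ₑ ∂volume ∂ν
        ≤ ∫⁻ y : closedHalfPlane, C * ‖invSqrtAbs (b - (y : ℝ × ℝ).2)‖ₑ ∂ν := by
          refine lintegral_mono fun y => ?_
          refine le_trans (le_of_eq ?_) (mul_le_mul_left (hCb (y : ℝ × ℝ).1) _)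
          rw [← lintegral_mul_const _ (by fun_prop)]
          refine lintegral_congr fun r => ?_
          rw [enorm_mul, enorm_mul, ← mul_assoc, Real.enorm_of_nonneg (hG.nonneg r),
            Real.enorm_of_nonneg (invSqrtAbs_nonneg (r - _))]
      _ < ⊤ := by
          rw [lintegral_const_mul _ (by fun_prop)]
          exact ENNReal.mul_lt_top hC.lt_top hi.2
  refine hdom.mono' (by fun_prop) ?_
  filter_upwards [hb] with p hp
  have h5 := hG.nonneg p.1
  rw [norm_mul, Real.norm_eq_abs, Real.norm_eq_abs, abs_of_nonneg h5]
  calc G p.1 * |K p| ≤ G p.1 * (2 * sqrtKernel (p.1, b) p.2) := by gcongr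
    _ = _ := by
      rw [sqrtKernel]
      ring

theorem SingularKernel.measurable_slice {k : ℝ × ℝ → ℝ × ℝ → ℝ} (hk : SingularKernel k) (b : ℝ)
    (hσ : Measurable σ) :
    Measurable fun p : ℝ × closedHalfPlane => k (p.1, b) (p.2 : ℝ × ℝ) * σ p.2 := by
  have h1 : Measurable fun p : ℝ × closedHalfPlane => ((p.1, b), (p.2 : ℝ × ℝ)) :=
    (measurable_fst.prodMk measurable_const).prodMk (measurable_subtype_coe.comp measurable_snd)
  exact (hk.measurable.comp h1).mul (hσ.comp measurable_snd)

theorem abs_mul_le_of_abs_le_one {a s c : ℝ} (h : |a| ≤ c) (hs : |s| ≤ 1) : |a * s| ≤ c := by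
  rw [abs_mul]
  exact (mul_le_of_le_one_right (abs_nonneg a) hs).trans h

theorem ae_abs_hilbertKernel_le {b : ℝ} (hb : 0 < b)
    (hne : ∀ᵐ y : closedHalfPlane ∂ν, b ≠ (y : ℝ × ℝ).2) (hσ1 : ∀ y, |σ y| ≤ 1) :
    ∀ᵐ p : ℝ × closedHalfPlane ∂(volume.prod ν),
      |hilbertKernel (p.1, b) (p.2 : ℝ × ℝ) * σ p.2| ≤ 2 * sqrtKernel (p.1, b) (p.2 : ℝ × ℝ) := by
  have h2 : ∀ᵐ p : ℝ × closedHalfPlane ∂(volume.prod ν), b ≠ (p.2 : ℝ × ℝ).2 :=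
    Measure.quasiMeasurePreserving_snd.ae hne
  filter_upwards [ae_fst_ne (ν := ν), h2] with p h1 h2
  exact abs_mul_le_of_abs_le_one (abs_hilbertKernel_le (z := (p.1, b)) hb p.2.2 h1 h2) (hσ1 _)

theorem integrable_greenSnd_prod {b : ℝ} (hb : 0 < b)
    (hne : ∀ᵐ y : closedHalfPlane ∂ν, b ≠ (y : ℝ × ℝ).2)
    (hσ : Measurable σ) (hσ1 : ∀ y, |σ y| ≤ 1) :
    Integrable (fun p : ℝ × closedHalfPlane => greenSnd (p.1, b) (p.2 : ℝ × ℝ) * σ p.2)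
      (volume.prod ν) := by
  have hk := (singularKernel_greenSnd.measurable_slice b hσ).aestronglyMeasurable
    (μ := volume.prod ν)
  have hi (y : closedHalfPlane) (hy : b ≠ (y : ℝ × ℝ).2) :
      Integrable (fun r => greenSnd (r, b) (y : ℝ × ℝ) * σ y) :=
    (integrable_greenSnd hb y.2 hy).1.mul_const _
  refine (integrable_prod_iff' hk).2 ⟨?_, ?_⟩
  · filter_upwards [hne] with y hy using hi y hy
  · refine (integrable_const (1 : ℝ)).mono' hk.norm.prod_swap.integral_prod_right' ?_
    filter_upwards [hne] with y hy
    rw [Real.norm_of_nonneg (integral_nonneg fun r => norm_nonneg _)]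
    refine le_trans (integral_mono (hi y hy).norm (integrable_greenSnd hb y.2 hy).1.norm
      fun r => ?_) (integrable_greenSnd hb y.2 hy).2
    exact abs_mul_le_of_abs_le_one le_rfl (hσ1 _)

theorem integral_integral_mul_swap {Y : Type*} [MeasurableSpace Y] {ν : Measure Y} [SFinite ν]
    {K : ℝ → Y → ℝ} {s : Y → ℝ} {g : ℝ → ℂ}
    (h : Integrable (fun p : ℝ × Y => ((K p.1 p.2 * s p.2 : ℝ) : ℂ) * g p.1) (volume.prod ν)) :
    ∫ r, ((∫ y, K r y * s y ∂ν : ℝ) : ℂ) * g r = ∫ y, ((s y : ℂ) * ∫ r, (K r y : ℂ) * g r) ∂ν := by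
  have h' := integral_integral_swap (f := fun r y => ((K r y * s y : ℝ) : ℂ) * g r) h
  simp only [integral_mul_const, integral_complex_ofReal] at h'
  rw [h']
  congr 1
  funext y
  rw [← integral_const_mul]
  congr 1
  funext r
  push_cast
  ring

/-- On almost every line the measure does not charge the singular height, and Fubini reduces the
dual identity for the potentials to the identity for each fixed `y`. -/
theorem isTangentialHilbert_kernelPotential (hσ : Measurable σ) (hσ1 : ∀ y, |σ y| ≤ 1) :
    IsTangentialHilbert (kernelPotential ν σ greenSnd) (kernelPotential ν σ hilbertKernel) := by
  refine ⟨singularKernel_hilbertKernel.locallyIntegrableOn hσ hσ1, ?_⟩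
  filter_upwards [ae_restrict_mem measurableSet_Ioi,
    ae_restrict_of_ae (ae_ne_and_integrable_invSqrtAbs ν)] with b hb ⟨hne, hi⟩
  have hi2 := integrable_greenSnd_prod hb hne hσ hσ1
  have hkm := singularKernel_hilbertKernel.measurable_slice b hσ
  have hkb := ae_abs_hilbertKernel_le hb hne hσ1
  -- The exponent `1` suffices for temperedness, since `1 / (1 + r ^ 2)` is already an admissible
  -- weight.
  refine isHilbertTransform_iff.2 ⟨hi2.integral_prod_left, ⟨1, ?_⟩, fun θ => ?_⟩
  · have := (testWeight_inv_one_add_sq.integrable_mul_of_le hi hkm hkb).integral_prod_left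
    simp only [integral_const_mul] at this
    simp only [pow_one, div_eq_inv_mul]
    exact this
  · have hΘ : Continuous (𝓕 (θ : ℝ → ℂ)) := continuous_fourier θ.integrable
    have hΨ := continuous_fourier (integrable_hilbertMul_mul θ.integrable)
    have j1 := (testWeight_norm_fourier θ).integrable_mul_of_le hi hkm hkb
    have j1' : Integrable (fun p : ℝ × closedHalfPlane =>
        ((hilbertKernel (p.1, b) (p.2 : ℝ × ℝ) * σ p.2 : ℝ) : ℂ) * 𝓕 (θ : ℝ → ℂ) p.1)
        (volume.prod ν) := by
      refine j1.mono ((Complex.measurable_ofReal.comp hkm).mul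
          (hΘ.measurable.comp measurable_fst)).aestronglyMeasurable
        (Eventually.of_forall fun p => ?_)
      rw [norm_mul, norm_mul, Complex.norm_real, norm_norm, mul_comm]
    have j2 : Integrable (fun p : ℝ × closedHalfPlane =>
        ((greenSnd (p.1, b) (p.2 : ℝ × ℝ) * σ p.2 : ℝ) : ℂ) *
          𝓕 (fun ξ => hilbertMul ξ * θ ξ) p.1) (volume.prod ν) := by
      refine (hi2.ofReal.bdd_mul (f := fun p : ℝ × closedHalfPlane =>
        𝓕 (fun ξ => hilbertMul ξ * θ ξ) p.1) (hΨ.measurable.comp measurable_fst).aestronglyMeasurable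
        (Eventually.of_forall fun p => norm_fourier_le _ p.1)).congr
        (Eventually.of_forall fun p => mul_comm _ _)
    unfold kernelPotential
    rw [integral_integral_mul_swap (K := fun r (y : closedHalfPlane) => hilbertKernel (r, b) y) j1',
      integral_integral_mul_swap (K := fun r (y : closedHalfPlane) => greenSnd (r, b) y) j2]
    refine integral_congr_ae ?_
    filter_upwards [hne] with y hy
    rw [integral_hilbertKernel_mul_fourier hb y.2 hy θ]

theorem kernelPotential_hilbertKernel_ae (hσ : Measurable σ) (hσ1 : ∀ y, |σ y| ≤ 1) :
    kernelPotential ν σ hilbertKernel =ᵐ[volume.restrict halfPlane] fun z =>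
      kernelPotential ν σ greenFst z + kernelPotential ν σ gradKernel z := by
  filter_upwards [singularKernel_greenFst.ae_integrable (ν := ν),
    singularKernel_gradKernel.ae_integrable (ν := ν)] with z h1 h2
  have hb {f : closedHalfPlane → ℝ} (hf : Integrable f ν) : Integrable (fun y => f y * σ y) ν :=
    hf.mul_bdd (c := 1) hσ.aestronglyMeasurable (Eventually.of_forall hσ1)
  unfold kernelPotential
  rw [← MeasureTheory.integral_add (μ := ν) (hb h1) (hb h2)]
  refine integral_congr_ae (Eventually.of_forall fun y => ?_)
  simp only [hilbertKernel]
  ring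

/-- The tangential Hilbert transform is determined almost everywhere. -/
theorem StokesHalfPlane.IsTangentialHilbert.ae_eq {f f' h h' : ℝ × ℝ → ℝ}
    (hf : f =ᵐ[volume.restrict halfPlane] f') (H : IsTangentialHilbert f h)
    (H' : IsTangentialHilbert f' h') : h =ᵐ[volume.restrict halfPlane] h' := by
  have hm (h : ℝ × ℝ → ℝ) (hl : LocallyIntegrableOn h halfPlane) :
      AEStronglyMeasurable h (volume.prod (volume.restrict (Ioi 0))) :=
    volume_restrict_halfPlane ▸ hl.aestronglyMeasurable
  have swap (u u' : ℝ × ℝ → ℝ) (hu : u =ᵐ[volume.prod (volume.restrict (Ioi 0))] u') :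
      ∀ᵐ b ∂(volume.restrict (Ioi (0 : ℝ))), ∀ᵐ a : ℝ, u (a, b) = u' (a, b) := by
    have h1 : ∀ᵐ q : ℝ × ℝ ∂((volume.restrict (Ioi (0 : ℝ))).prod volume), u q.swap = u' q.swap :=
      (Measure.measurePreserving_swap (μ := volume.restrict (Ioi (0 : ℝ)))
        (ν := (volume : Measure ℝ))).quasiMeasurePreserving.ae hu
    exact Measure.ae_ae_of_ae_prod h1
  rw [volume_restrict_halfPlane] at hf ⊢
  have a1 := hm h H.1
  have a2 := hm h' H'.1
  -- Measurable representatives are used because passing from almost every line back to the plane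
  -- needs a measurable set of coincidence.
  have key : ∀ᵐ b ∂(volume.restrict (Ioi (0 : ℝ))), ∀ᵐ a : ℝ, a1.mk h (a, b) = a2.mk h' (a, b) := by
    filter_upwards [H.2, H'.2, swap _ _ hf, swap _ _ a1.ae_eq_mk, swap _ _ a2.ae_eq_mk]
      with b h1 h2 h3 h4 h5
    filter_upwards [(h1.congr_left h3).ae_eq h2, h4, h5] with a e1 e2 e3
    rw [← e2, ← e3, e1]
  have hset : MeasurableSet {z : ℝ × ℝ | a1.mk h z = a2.mk h' z} :=
    measurableSet_eq_fun a1.stronglyMeasurable_mk.measurable a2.stronglyMeasurable_mk.measurable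
  have key2 : a1.mk h =ᵐ[volume.prod (volume.restrict (Ioi 0))] a2.mk h' :=
    (Measure.ae_prod_iff_ae_ae hset).2 ((Measure.ae_ae_comm hset).2 key)
  exact a1.ae_eq_mk.trans (key2.trans a2.ae_eq_mk.symm)

end TangentialHilbert

/-! ### Reduction of signed measures to a density against the variation. -/

section SignedMeasures

open Filter Topology

theorem lsmul_flip_real : (ContinuousLinearMap.lsmul ℝ ℝ : ℝ →L[ℝ] ℝ →L[ℝ] ℝ).flip =
    ContinuousLinearMap.lsmul ℝ ℝ := by
  ext
  simp

theorem isFiniteMeasure_variation {Y : Type*} [MeasurableSpace Y] (μ : SignedMeasure Y) :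
    IsFiniteMeasure μ.variation := by
  rw [← SignedMeasure.totalVariation_eq_variation, SignedMeasure.totalVariation]
  infer_instance

/-- Polar decomposition of a signed measure. -/
theorem exists_sign_integral_eq {Y : Type*} [MeasurableSpace Y] (μ : SignedMeasure Y) :
    ∃ σ : Y → ℝ, Measurable σ ∧ (∀ y, |σ y| ≤ 1) ∧ ∀ f : Y → ℝ, VectorMeasure.Integrable μ f →
      ∫ᵛ y, f y ∂•μ = ∫ y, f y * σ y ∂μ.variation := by
  classical
  obtain ⟨s, hs, hps, hns⟩ := μ.toJordanDecomposition.mutuallySingular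
  set p := μ.toJordanDecomposition.posPart with hp
  set n := μ.toJordanDecomposition.negPart with hn
  have hvar : μ.variation = p + n := (SignedMeasure.totalVariation_eq_variation μ).symm
  have hμ : μ = p.toSignedMeasure - n.toSignedMeasure :=
    (SignedMeasure.toSignedMeasure_toJordanDecomposition μ).symm
  -- The positive part vanishes on `s` and the negative part off `s`, so the density is `-1` on `s`.
  have hσ : Measurable (s.piecewise (fun _ => (-1 : ℝ)) fun _ => 1) :=
    measurable_const.piecewise hs measurable_const
  have hσ1 (y : Y) : |s.piecewise (fun _ => (-1 : ℝ)) (fun _ => 1) y| ≤ 1 := by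
    by_cases hy : y ∈ s <;> simp [hy]
  refine ⟨s.piecewise (fun _ => -1) fun _ => 1, hσ, hσ1, fun f hf => ?_⟩
  have hf' : Integrable f (p + n) := hvar ▸ hf
  have hfp := hf'.left_of_add_measure
  have hfn := hf'.right_of_add_measure
  have hm {m : Measure Y} (h : Integrable f m) :
      Integrable (fun y => f y * s.piecewise (fun _ => (-1 : ℝ)) (fun _ => 1) y) m :=
    h.mul_bdd (c := 1) hσ.aestronglyMeasurable (Eventually.of_forall hσ1)
  have e1 : ∫ᵛ y, f y ∂•μ = ∫ y, f y ∂p - ∫ y, f y ∂n := by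
    conv_lhs => rw [hμ]
    rw [VectorMeasure.integral_sub_vectorMeasure
      (by rwa [VectorMeasure.Integrable, Measure.variation_toSignedMeasure])
      (by rwa [VectorMeasure.Integrable, Measure.variation_toSignedMeasure]), ← lsmul_flip_real,
      VectorMeasure.integral_toSignedMeasure, VectorMeasure.integral_toSignedMeasure]
  rw [e1, hvar, integral_add_measure (hm hfp) (hm hfn), sub_eq_add_neg, ← integral_neg]
  congr 1
  · refine integral_congr_ae ?_
    filter_upwards [measure_eq_zero_iff_ae_notMem.1 hps] with y hy
    simp [hy]
  · refine integral_congr_ae ?_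
    filter_upwards [measure_eq_zero_iff_ae_notMem.1 hns] with y hy
    rw [notMem_compl_iff] at hy
    simp [hy]

end SignedMeasures

/-! ### Tangential derivatives of heat kernels as admissible weights. -/

section HeatWeights

open Filter Topology

theorem testWeight_shifted_gauss (x : ℝ) {c : ℝ} (hc : 0 < c) :
    TestWeight fun r => Real.exp (-c * (r - x) ^ 2) where
  measurable := by fun_prop
  nonneg r := (Real.exp_pos _).le
  bounded := ⟨1, fun r => Real.exp_le_one_iff.2 (by nlinarith [sq_nonneg (r - x)])⟩
  integrable := (integrable_exp_neg_mul_sq hc).comp_sub_right x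

/-- The affine factor accommodates both the factor `x₁ - z₁` from the tangential derivative and the
growth `2 + z₂` of the kernel bounds; half of the Gaussian absorbs it. -/
theorem testWeight_mul_heatKernel1 (x a b : ℝ) (ha : 0 ≤ a) (hb : 0 ≤ b) {t : ℝ} (ht : 0 < t) :
    TestWeight fun r => (a + b * |r - x|) * heatKernel1 (r - x) t := by
  obtain ⟨C, hC, h⟩ := exists_abs_pow_mul_exp_le 1 (by positivity : (0 : ℝ) < 1 / (8 * t))
  refine (testWeight_shifted_gauss x (by positivity : (0 : ℝ) < 1 / (8 * t))).of_le
    (C := 1 / √(4 * Real.pi * t) * (a + b * C)) ?_ (fun r => ?_) fun r => ?_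
  · unfold heatKernel1
    fun_prop
  · unfold heatKernel1
    positivity
  · have e : Real.exp (-(r - x) ^ 2 / (4 * t)) =
        Real.exp (-(1 / (8 * t)) * (r - x) ^ 2) * Real.exp (-(1 / (8 * t)) * (r - x) ^ 2) := by
      rw [← Real.exp_add]
      congr 1
      field_simp
      ring
    have h1 := h (r - x)
    rw [pow_one] at h1
    have h2 : Real.exp (-(1 / (8 * t)) * (r - x) ^ 2) ≤ 1 := by
      refine Real.exp_le_one_iff.2 ?_
      have : 0 ≤ 1 / (8 * t) * (r - x) ^ 2 := by positivity
      linarith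
    rw [heatKernel1, e]
    calc (a + b * |r - x|) * (1 / √(4 * Real.pi * t) *
          (Real.exp (-(1 / (8 * t)) * (r - x) ^ 2) * Real.exp (-(1 / (8 * t)) * (r - x) ^ 2)))
        = 1 / √(4 * Real.pi * t) * (a * Real.exp (-(1 / (8 * t)) * (r - x) ^ 2) +
            b * (|r - x| * Real.exp (-(1 / (8 * t)) * (r - x) ^ 2))) *
            Real.exp (-(1 / (8 * t)) * (r - x) ^ 2) := by ring
      _ ≤ 1 / √(4 * Real.pi * t) * (a * 1 + b * C) * Real.exp (-(1 / (8 * t)) * (r - x) ^ 2) := by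
          gcongr
      _ = _ := by ring

theorem TestWeight.add {G G' : ℝ → ℝ} (hG : TestWeight G) (hG' : TestWeight G') :
    TestWeight fun r => G r + G' r where
  measurable := hG.measurable.add hG'.measurable
  nonneg r := add_nonneg (hG.nonneg r) (hG'.nonneg r)
  bounded := by
    obtain ⟨B, hB⟩ := hG.bounded
    obtain ⟨B', hB'⟩ := hG'.bounded
    exact ⟨B + B', fun r => add_le_add (hB r) (hB' r)⟩
  integrable := hG.integrable.add hG'.integrable

theorem hasDerivAt_heatKernel_fst (a c r : ℝ) {t : ℝ} (ht : 0 < t) :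
    HasDerivAt (fun r => heatKernel (a - r, c) t) ((a - r) / (2 * t) * heatKernel (a - r, c) t) r := by
  unfold heatKernel normSq
  have h1 : HasDerivAt (fun r : ℝ => -((a - r) ^ 2 + c ^ 2) / (4 * t))
      (-(2 * (a - r) ^ 1 * (-1)) / (4 * t)) r := by
    have := (((hasDerivAt_id r).const_sub a).pow 2).add_const (c ^ 2)
    simpa using this.neg.div_const (4 * t)
  refine (h1.exp.const_mul _).congr_deriv ?_
  field_simp
  ring

theorem partialDeriv_heatKernelN (t : ℝ) (ht : 0 < t) (x z : ℝ × ℝ) :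
    partialDeriv 0 (heatKernelN t x) z = (x.1 - z.1) / (2 * t) * heatKernel1 (x.1 - z.1) t *
      (heatKernel1 (x.2 - z.2) t + heatKernel1 (x.2 + z.2) t) := by
  have := (hasDerivAt_heatKernel_fst x.1 (x.2 - z.2) z.1 ht).add
    (hasDerivAt_heatKernel_fst x.1 (x.2 + z.2) z.1 ht)
  have e : (fun r => heatKernelN t x (r, z.2)) =
      (fun r => heatKernel (x.1 - r, x.2 - z.2) t) + fun r => heatKernel (x.1 - r, x.2 + z.2) t := by
    funext r
    simp [heatKernelN, reflect, Prod.sub_def]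
  rw [partialDeriv, if_pos rfl, e, this.deriv, heatKernel_eq_mul _ _ ht, heatKernel_eq_mul _ _ ht]
  ring

theorem partialDeriv_heatKernelD (t : ℝ) (ht : 0 < t) (x z : ℝ × ℝ) :
    partialDeriv 0 (heatKernelD t x) z = (x.1 - z.1) / (2 * t) * heatKernel1 (x.1 - z.1) t *
      (heatKernel1 (x.2 - z.2) t - heatKernel1 (x.2 + z.2) t) := by
  have := (hasDerivAt_heatKernel_fst x.1 (x.2 - z.2) z.1 ht).sub
    (hasDerivAt_heatKernel_fst x.1 (x.2 + z.2) z.1 ht)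
  have e : (fun r => heatKernelD t x (r, z.2)) =
      (fun r => heatKernel (x.1 - r, x.2 - z.2) t) - fun r => heatKernel (x.1 - r, x.2 + z.2) t := by
    funext r
    simp [heatKernelD, reflect, Prod.sub_def]
  rw [partialDeriv, if_pos rfl, e, this.deriv, heatKernel_eq_mul _ _ ht, heatKernel_eq_mul _ _ ht]
  ring

theorem planeWeight_heat (x : ℝ × ℝ) {t : ℝ} (ht : 0 < t) {κ : ℝ → ℝ} (hκ : Measurable κ)
    (hb : ∀ r, |κ r| ≤ heatKernel1 (r - x.2) t + heatKernel1 (r - (-x.2)) t) :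
    PlaneWeight fun z => (x.1 - z.1) / (2 * t) * heatKernel1 (x.1 - z.1) t * κ z.2 where
  measurable := by
    unfold heatKernel1
    fun_prop
  bound := by
    refine ⟨_, _, testWeight_mul_heatKernel1 x.1 0 (1 / (2 * t)) le_rfl (by positivity) ht,
      (testWeight_mul_heatKernel1 x.2 (2 + |x.2|) 1 (by positivity) one_pos.le ht).add
        (testWeight_mul_heatKernel1 (-x.2) (2 + |x.2|) 1 (by positivity) one_pos.le ht),
      fun z hz => ?_⟩
    have e1 : heatKernel1 (x.1 - z.1) t = heatKernel1 (z.1 - x.1) t := by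
      rw [← heatKernel1_neg, neg_sub]
    have n1 := heatKernel1_nonneg (z.1 - x.1) t
    have n2 := heatKernel1_nonneg (z.2 - x.2) t
    have n3 := heatKernel1_nonneg (z.2 - (-x.2)) t
    have z1 : 2 + z.2 ≤ 2 + |x.2| + 1 * |z.2 - x.2| := by
      linarith [le_abs_self x.2, le_abs_self (z.2 - x.2)]
    have z2 : 2 + z.2 ≤ 2 + |x.2| + 1 * |z.2 - (-x.2)| := by
      linarith [neg_abs_le x.2, le_abs_self (z.2 - (-x.2)), le_abs_self x.2]
    have hz2 : 0 ≤ 2 + z.2 := by linarith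
    rw [abs_mul, abs_mul, abs_div, e1, abs_of_nonneg n1, abs_of_pos (by positivity : 0 < 2 * t),
      abs_sub_comm, mul_assoc, zero_add, one_div_mul_eq_div]
    refine mul_le_mul_of_nonneg_left ?_ (by positivity)
    calc |κ z.2| * (2 + z.2) ≤ (heatKernel1 (z.2 - x.2) t + heatKernel1 (z.2 - (-x.2)) t) *
          (2 + z.2) := mul_le_mul_of_nonneg_right (hb z.2) hz2
      _ = (2 + z.2) * heatKernel1 (z.2 - x.2) t + (2 + z.2) * heatKernel1 (z.2 - (-x.2)) t := by ring
      _ ≤ _ := add_le_add (mul_le_mul_of_nonneg_right z1 n2) (mul_le_mul_of_nonneg_right z2 n3)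

theorem heatKernel1_sub_comm (a b t : ℝ) : heatKernel1 (a - b) t = heatKernel1 (b - a) t := by
  rw [← heatKernel1_neg, neg_sub]

theorem heatKernel1_add_eq (a b t : ℝ) : heatKernel1 (a + b) t = heatKernel1 (b - (-a)) t := by
  rw [sub_neg_eq_add, add_comm]

theorem measurable_heatKernel1 (t : ℝ) : Measurable fun r => heatKernel1 r t :=
  (continuous_heatKernel1 t).measurable

theorem planeWeight_partialDeriv_heatKernelN (x : ℝ × ℝ) {t : ℝ} (ht : 0 < t) :
    PlaneWeight (partialDeriv 0 (heatKernelN t x)) := by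
  rw [funext (partialDeriv_heatKernelN t ht x)]
  have := measurable_heatKernel1 t
  refine planeWeight_heat x ht
    (κ := fun r => heatKernel1 (x.2 - r) t + heatKernel1 (x.2 + r) t) (by fun_prop) fun r => ?_
  rw [heatKernel1_sub_comm, heatKernel1_add_eq]
  exact (abs_of_nonneg (add_nonneg (heatKernel1_nonneg _ _) (heatKernel1_nonneg _ _))).le

theorem planeWeight_partialDeriv_heatKernelD (x : ℝ × ℝ) {t : ℝ} (ht : 0 < t) :
    PlaneWeight (partialDeriv 0 (heatKernelD t x)) := by
  rw [funext (partialDeriv_heatKernelD t ht x)]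
  have := measurable_heatKernel1 t
  refine planeWeight_heat x ht
    (κ := fun r => heatKernel1 (x.2 - r) t - heatKernel1 (x.2 + r) t) (by fun_prop) fun r => ?_
  rw [heatKernel1_sub_comm, heatKernel1_add_eq]
  refine (abs_sub _ _).trans (le_of_eq ?_)
  rw [abs_of_nonneg (heatKernel1_nonneg _ _), abs_of_nonneg (heatKernel1_nonneg _ _)]

/-- The tangential derivative of `z ↦ 2 Γ(x - z*, t)`. -/
noncomputable def reflectedWeight (x : ℝ × ℝ) (t : ℝ) (z : ℝ × ℝ) : ℝ :=
  (x.1 - z.1) / (2 * t) * heatKernel1 (x.1 - z.1) t * (2 * heatKernel1 (x.2 + z.2) t)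

theorem planeWeight_reflectedWeight (x : ℝ × ℝ) {t : ℝ} (ht : 0 < t) :
    PlaneWeight (reflectedWeight x t) where
  measurable := by
    unfold reflectedWeight heatKernel1
    fun_prop
  bound := by
    have := measurable_heatKernel1 t
    have h := planeWeight_heat x ht (κ := fun r => heatKernel1 (x.2 + r) t) (by fun_prop) fun r => by
      rw [heatKernel1_add_eq, abs_of_nonneg (heatKernel1_nonneg _ _)]
      linarith [heatKernel1_nonneg (r - x.2) t]
    refine (h.of_le (w' := reflectedWeight x t) ?_ (C := 2) fun z _ => ?_).bound
    · unfold reflectedWeight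
      fun_prop
    · rw [reflectedWeight, mul_left_comm, abs_mul, abs_two]

end HeatWeights

/-! ### The kernel of the nonlocal operator. -/

section NonlocalOperator

open Filter Topology

theorem integrable_mul_heatKernel1 (x : ℝ) {t : ℝ} (ht : 0 < t) :
    Integrable fun r => (x - r) / (2 * t) * heatKernel1 (x - r) t := by
  have h := (testWeight_mul_heatKernel1 x 0 (1 / (2 * t)) le_rfl (by positivity) ht).integrable
  have hm := measurable_heatKernel1 t
  refine h.mono' (by fun_prop) (Eventually.of_forall fun r => le_of_eq ?_)
  rw [norm_mul, Real.norm_eq_abs, Real.norm_of_nonneg (heatKernel1_nonneg _ _),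
    heatKernel1_sub_comm, abs_div, abs_of_pos (by positivity : 0 < 2 * t), abs_sub_comm]
  ring

theorem abs_conjPoisson_le_inv_abs {s : ℝ} (hs : s ≠ 0) (r : ℝ) :
    |conjPoisson s r| ≤ 1 / |s| := by
  have h := abs_conjPoisson_le_inv (abs_pos.2 hs) r
  rcases abs_choice s with e | e
  · rwa [e] at h ⊢
  · rw [e] at h ⊢
    rwa [conjPoisson_neg] at h

theorem hasDerivAt_conjPoisson (a b c : ℝ) {d : ℝ} (h : b - d ≠ 0) :
    HasDerivAt (fun r => conjPoisson (b - d) (r - c))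
      (-(2 * partialDeriv 0 (partialDeriv 0 newton) ((a, b) - (c, d)))) a := by
  have h1 := ((hasDerivAt_conjugate_poisson (a - c) h).comp_sub_const a c).const_mul (1 / Real.pi)
  have e : (fun r => conjPoisson (b - d) (r - c)) = fun r =>
      1 / Real.pi * ((r - c) / ((r - c) ^ 2 + (b - d) ^ 2)) := by
    funext r
    rw [conjPoisson, div_mul_div_comm, one_mul]
  rw [e]
  refine h1.congr_deriv ?_
  rw [Prod.mk_sub_mk, partialDeriv_zero_zero_newton _ h]
  field_simp

/-- Integration by parts along the line, using `∂₁Q = -2∂₁²E`; with the factor `2` of the reflected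
kernel this makes `4`. Off the singular height `Q` is bounded by `1 / |b - y₂|`, so there is no
contribution from infinity. -/
theorem integral_reflectedWeight_mul_gradKernel_slice (x y : ℝ × ℝ) {t b : ℝ} (ht : 0 < t)
    (hb : b < y.2) :
    ∫ a, reflectedWeight x t (a, b) * gradKernel (a, b) y =
      4 * ∫ a, wTildeIntegrand x y t b a := by
  have hne : b - y.2 ≠ 0 := by linarith
  have hrefl (a : ℝ) : x - reflect (a, b) = (x.1 - a, x.2 + b) := by
    simp [reflect, Prod.sub_def]
  have hu (r : ℝ) := hasDerivAt_conjPoisson r b y.1 hne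
  have hv (r : ℝ) := hasDerivAt_heatKernel_fst x.1 (x.2 + b) r ht
  have hcont := continuous_conjPoisson hne
  have hbd (r : ℝ) := abs_conjPoisson_le_inv_abs hne (r - y.1)
  have hbdd {g : ℝ → ℝ} (hg : Integrable g) :
      Integrable ((fun r => conjPoisson (b - y.2) (r - y.1)) * g) :=
    hg.bdd_mul (c := 1 / |b - y.2|) (by fun_prop) (Eventually.of_forall hbd)
  have i0 : Integrable fun r => heatKernel (x.1 - r, x.2 + b) t := by
    simp only [heatKernel_eq_mul _ _ ht]
    exact (integrable_heatKernel1 x.1 ht).mul_const _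
  have i1 : Integrable fun r => (x.1 - r) / (2 * t) * heatKernel (x.1 - r, x.2 + b) t := by
    simp only [heatKernel_eq_mul _ _ ht, ← mul_assoc]
    exact (integrable_mul_heatKernel1 x.1 ht).mul_const _
  have i2 : Integrable ((fun r => -(2 * partialDeriv 0 (partialDeriv 0 newton) ((r, b) - y))) *
      fun r => heatKernel (x.1 - r, x.2 + b) t) := by
    refine ((integrable_wTildeIntegrand x y ht hb).const_mul (-2)).congr
      (Eventually.of_forall fun r => ?_)
    simp only [wTildeIntegrand, hrefl, Pi.mul_apply]
    ring
  have key := integral_mul_deriv_eq_deriv_mul_of_integrable (fun r _ => hu r) (fun r _ => hv r)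
    (hbdd i1) i2 (hbdd i0)
  have e1 : ∀ a, reflectedWeight x t (a, b) * gradKernel (a, b) y =
      2 * (conjPoisson (b - y.2) (a - y.1) *
        ((x.1 - a) / (2 * t) * heatKernel (x.1 - a, x.2 + b) t)) := fun a => by
    rw [gradKernel, if_pos hb, reflectedWeight, heatKernel_eq_mul _ _ ht]
    ring
  have e2 : ∀ a, wTildeIntegrand x y t b a = -(1 / 2) *
      (-(2 * partialDeriv 0 (partialDeriv 0 newton) ((a, b) - y)) *
        heatKernel (x.1 - a, x.2 + b) t) := fun a => by
    rw [wTildeIntegrand, hrefl]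
    ring
  simp only [e1, e2, integral_const_mul]
  rw [key]
  ring

/-- `gradKernel` vanishes above `y`, which cuts the half plane down to the strip. Before integration
by parts the singularity has order one and the plane integral converges absolutely; afterwards it
has order two, so the parts formula is applied line by line and the result is an iterated integral.
-/
theorem integral_reflectedWeight_mul_gradKernel (x : ℝ × ℝ) {y : ℝ × ℝ} (hy : 0 ≤ y.2) {t : ℝ}
    (ht : 0 < t) :
    ∫ z in halfPlane, reflectedWeight x t z * gradKernel z y = wTilde x y t := by
  rw [volume_restrict_halfPlane, integral_prod_symm _
    (singularKernel_gradKernel.integrable_weight_mul_kernel (planeWeight_reflectedWeight x ht) hy),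
    wTilde, intervalIntegral.integral_of_le hy, ← integral_const_mul]
  have h0 : ∀ b ∈ Ioi (0 : ℝ) \ Ioc 0 y.2,
      ∫ a, reflectedWeight x t (a, b) * gradKernel (a, b) y = 0 := by
    rintro b ⟨hb, hb'⟩
    have : y.2 < b := by
      by_contra! h
      exact hb' ⟨hb, h⟩
    simp [gradKernel, this.not_gt]
  rw [setIntegral_eq_of_subset_of_forall_sdiff_eq_zero measurableSet_Ioi
    (fun b hb => hb.1) h0]
  refine integral_congr_ae ?_
  filter_upwards [ae_restrict_mem measurableSet_Ioc,
    ae_restrict_of_ae (Measure.ae_ne volume y.2)] with b hb hne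
  exact integral_reflectedWeight_mul_gradKernel_slice x y ht (lt_of_le_of_ne hb.2 hne)

/-- `W̃` is a marginal of an absolutely integrable function on the product, so no pointwise bound on
it is needed. -/
theorem integrable_wTilde (ν : Measure closedHalfPlane) [IsFiniteMeasure ν] (x : ℝ × ℝ) {t : ℝ}
    (ht : 0 < t) : Integrable (fun y : closedHalfPlane => wTilde x (y : ℝ × ℝ) t) ν := by
  have h := (singularKernel_gradKernel.integrable_prod (ν := ν) (σ := fun _ => 1)
    (planeWeight_reflectedWeight x ht) (by fun_prop) (by simp)).integral_prod_right
  refine h.congr (Eventually.of_forall fun y => ?_)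
  simp only [mul_one]
  exact integral_reflectedWeight_mul_gradKernel x y.2 ht

variable {ν : Measure closedHalfPlane} [IsFiniteMeasure ν] {σ : closedHalfPlane → ℝ}

theorem isHilbertGradient_kernelPotential {ψ : ℝ × ℝ → ℝ} (hσ : Measurable σ)
    (hσ1 : ∀ y, |σ y| ≤ 1) (hψ : kernelPotential ν σ greenD =ᵐ[volume.restrict halfPlane] ψ) :
    IsHilbertGradient ψ fun z =>
      kernelPotential ν σ hilbertKernel z - kernelPotential ν σ greenFst z :=
  ⟨_, _, _, (isWeakPartial_kernelPotential_zero hσ hσ1).congr_ae hψ,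
    (isWeakPartial_kernelPotential_one hσ hσ1).congr_ae hψ,
    isTangentialHilbert_kernelPotential hσ hσ1, fun _ => rfl⟩

/-- Both weak derivatives and the Hilbert transform are determined almost everywhere; in the
difference the kernel `greenFst` cancels. -/
theorem StokesHalfPlane.IsHilbertGradient.ae_eq {ψ v : ℝ × ℝ → ℝ} (hv : IsHilbertGradient ψ v)
    (hσ : Measurable σ) (hσ1 : ∀ y, |σ y| ≤ 1)
    (hψ : kernelPotential ν σ greenD =ᵐ[volume.restrict halfPlane] ψ) :
    v =ᵐ[volume.restrict halfPlane] kernelPotential ν σ gradKernel := by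
  obtain ⟨g₁, g₂, h, h1, h2, h3, h4⟩ := hv
  have e1 := h1.ae_eq ((isWeakPartial_kernelPotential_zero hσ hσ1).congr_ae hψ)
  have e2 := h2.ae_eq ((isWeakPartial_kernelPotential_one hσ hσ1).congr_ae hψ)
  have e3 := IsTangentialHilbert.ae_eq e2 h3 (isTangentialHilbert_kernelPotential hσ hσ1)
  filter_upwards [e1, e3, kernelPotential_hilbertKernel_ae (ν := ν) hσ hσ1] with z a1 a3 a4
  rw [h4, a1, a3, a4]
  ring

theorem kernelPotential_greenD_ae_eq {μ : SignedMeasure closedHalfPlane}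
    [IsFiniteMeasure μ.variation]
    (hμ : ∀ f : closedHalfPlane → ℝ, VectorMeasure.Integrable μ f →
      ∫ᵛ y, f y ∂•μ = ∫ y, f y * σ y ∂μ.variation) :
    kernelPotential μ.variation σ greenD =ᵐ[volume.restrict halfPlane] invLaplaceD μ := by
  filter_upwards [singularKernel_greenD.ae_integrable (ν := μ.variation)] with z hz
  exact (hμ _ hz).symm

/-- The direct parts of the two heat kernels cancel, leaving twice the reflected part; the sign of
the pairing cancels the one in front, and Fubini brings the measure outside. -/
theorem neg_heatN_sub_heatD_eq {v : ℝ × ℝ → ℝ} (hσ : Measurable σ) (hσ1 : ∀ y, |σ y| ≤ 1)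
    (hv : v =ᵐ[volume.restrict halfPlane] kernelPotential ν σ gradKernel) (x : ℝ × ℝ) {t : ℝ}
    (ht : 0 < t) :
    IntegrableOn (fun z => v z * partialDeriv 0 (heatKernelN t x) z) halfPlane ∧
      IntegrableOn (fun z => v z * partialDeriv 0 (heatKernelD t x) z) halfPlane ∧
      -(heatN t (tangentialDeriv v) x - heatD t (tangentialDeriv v) x) =
        ∫ y : closedHalfPlane, wTilde x (y : ℝ × ℝ) t * σ y ∂ν := by
  have hint {w : ℝ × ℝ → ℝ} (hw : PlaneWeight w) : IntegrableOn (fun z => v z * w z) halfPlane := by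
    refine (singularKernel_gradKernel.integrable_weight_mul (ν := ν) hw hσ hσ1).congr ?_
    filter_upwards [hv] with z hz
    rw [hz, mul_comm]
  have hN := hint (planeWeight_partialDeriv_heatKernelN x ht)
  have hD := hint (planeWeight_partialDeriv_heatKernelD x ht)
  refine ⟨hN, hD, ?_⟩
  have h1 : -(heatN t (tangentialDeriv v) x - heatD t (tangentialDeriv v) x) =
      ∫ z in halfPlane, (v z * partialDeriv 0 (heatKernelN t x) z -
        v z * partialDeriv 0 (heatKernelD t x) z) := by
    rw [integral_sub hN hD, heatN, heatD, tangentialDeriv, tangentialDeriv]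
    ring
  have h2 : ∫ z in halfPlane, (v z * partialDeriv 0 (heatKernelN t x) z -
        v z * partialDeriv 0 (heatKernelD t x) z) =
      ∫ z in halfPlane, reflectedWeight x t z * kernelPotential ν σ gradKernel z := by
    refine integral_congr_ae ?_
    filter_upwards [hv] with z hz
    rw [hz, partialDeriv_heatKernelN t ht, partialDeriv_heatKernelD t ht, reflectedWeight]
    ring
  rw [h1, h2, singularKernel_gradKernel.integral_weight_mul (planeWeight_reflectedWeight x ht) hσ hσ1]
  refine integral_congr_ae (Eventually.of_forall fun y => ?_)
  simp only
  rw [integral_reflectedWeight_mul_gradKernel x y.2 ht]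

end NonlocalOperator

/-! ### The lemma. -/

theorem lemma3p4 :
    -- The integrals and the derivative in the definitions of the kernels exist.
    (∀ x ∈ closedHalfPlane, ∀ y ∈ closedHalfPlane, ∀ t : ℝ, 0 < t →
      IteratedIntegrable y.2 (wTildeIntegrand x y t) ∧
      IteratedIntegrable y.2 (greenIntegrand 0 y x t) ∧
      DifferentiableAt ℝ (fun r : ℝ => greenPotential 0 (r, y.2) x t) y.1) ∧
    -- Scaling.
    (∀ x ∈ closedHalfPlane, ∀ y ∈ closedHalfPlane, ∀ t : ℝ, 0 < t → ∀ lam : ℝ, 0 < lam →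
      wKernel x y t = lam ^ 2 * wKernel (lam • x) (lam • y) (lam ^ 2 * t)) ∧
    -- The reflected part and the Green matrix.
    (∀ x ∈ closedHalfPlane, ∀ y ∈ closedHalfPlane, ∀ t : ℝ, 0 < t →
      wStar x y t = -greenStar 0 0 y x t) ∧
    -- Smoothness and pointwise bounds for all derivatives.
    (ContDiffOn ℝ ∞ (fun p : (ℝ × ℝ) × (ℝ × ℝ) × ℝ => wStar p.1 p.2.1 p.2.2)
        (halfPlane ×ˢ (halfPlane ×ˢ Ioi (0 : ℝ))) ∧
      ∃ c : ℝ, 0 < c ∧ ∀ s k1 k2 m1 m2 : ℕ, ∃ C : ℝ, 0 < C ∧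
        ∀ x ∈ halfPlane, ∀ y ∈ halfPlane, ∀ t : ℝ, 0 < t →
          |mixedDeriv s k1 k2 m1 m2 wStar x y t| ≤
            C * Real.exp (-c * x.2 ^ 2 / t) /
              (t ^ ((s : ℝ) + (k2 : ℝ) / 2) * (y.2 ^ 2 + t) ^ ((m2 : ℝ) / 2) *
                (normSq (x - reflect y) + t) ^ (((k1 : ℝ) + (m1 : ℝ) + 2) / 2))) ∧
    -- The kernel of the nonlocal operator.
    (∀ μ : SignedMeasure closedHalfPlane,
      (∀ᵐ z ∂(volume.restrict halfPlane),
        VectorMeasure.Integrable μ (fun y => greenD z (y : ℝ × ℝ))) ∧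
      (∃ v : ℝ × ℝ → ℝ, IsHilbertGradient (invLaplaceD μ) v) ∧
      ∀ v : ℝ × ℝ → ℝ, IsHilbertGradient (invLaplaceD μ) v →
        ∀ t : ℝ, 0 < t → ∀ x ∈ closedHalfPlane,
          IntegrableOn (fun z => v z * partialDeriv 0 (heatKernelN t x) z) halfPlane ∧
          IntegrableOn (fun z => v z * partialDeriv 0 (heatKernelD t x) z) halfPlane ∧
          VectorMeasure.Integrable μ (fun y => wTilde x (y : ℝ × ℝ) t) ∧
          -(heatN t (tangentialDeriv v) x - heatD t (tangentialDeriv v) x) =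
            ∫ᵛ y, wTilde x (y : ℝ × ℝ) t ∂•μ) := by
  refine ⟨fun x _ y hy t ht => ⟨iteratedIntegrable_wTildeIntegrand x y hy ht,
      iteratedIntegrable_greenIntegrand x y hy ht,
      (hasDerivAt_greenPotential x y hy ht).differentiableAt⟩,
    fun x _ y hy t ht lam hl => wKernel_scaling hy ht hl,
    fun x _ y hy t ht => wStar_eq_neg_greenStar x y hy ht,
    -- The rate `1 / 16` is what remains of the Gaussian `1 / 4`: half goes to the polynomial
    -- factors, and half of the rest to the comparison of distances.
    ⟨contDiffOn_wStar, 1 / 16, by norm_num, exists_abs_mixedDeriv_wStar_le⟩, fun μ => ?_⟩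
  have := isFiniteMeasure_variation μ
  obtain ⟨σ, hσ, hσ1, hμ⟩ := exists_sign_integral_eq μ
  have hψ := kernelPotential_greenD_ae_eq hμ
  refine ⟨singularKernel_greenD.ae_integrable, ⟨_, isHilbertGradient_kernelPotential hσ hσ1 hψ⟩,
    fun v hv t ht x _ => ?_⟩
  obtain ⟨hN, hD, h⟩ := neg_heatN_sub_heatD_eq hσ hσ1 (hv.ae_eq hσ hσ1 hψ) x ht
  have hi := integrable_wTilde μ.variation x ht
  exact ⟨hN, hD, hi, h.trans (hμ _ hi).symm⟩
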